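/- Let $U:\mathbb{R}\to\mathbb{R}$ be smooth, and write $\|\cdot\|$ for the norm of $L^2=L^2(\mathbb{R};\mathbb{C})$. Assume: (H1) $U'>0$ on $\mathbb{R}$, $U(y)\to U_\pm$ as $y\to\pm\infty$ for some constants $U_\pm \in \mathbb{R}$, $U''/U\in L^\infty$ and $U''/U<0$ on $\mathbb{R}$ (at the zero of $U$ the quotient is understood by continuous extension). Put $m=(-U''/U)^{1/2}>0$. (H2) For every $k\ge 0$ there is $C_k>0$ with $|m^{(k)}|\le C_k m$; $m(y)\to 0$ as $|y|\to\infty$; $m\in L^2$; and $U''/(U-U_+)$, $U''/(U-U_-)$ belong to $L^\infty\cap L^2$. (H3) The infimum of the spectrum of the operator $-\partial_y^2-m^2$ with domain $H^2(\mathbb{R})$ is larger than $-1$. For $\alpha\in\mathbb{Z}\setminus\{0\}$ let $\Delta_\alpha=\partial_y^2-\alpha^2$, $S=(1+m\Delta_\alpha^{-1}m)^{1/2}$, $H=SUS$ (a bounded self-adjoint operator on $L^2$) and $R=S\frac1m\partial_y^2\, m S^{-1}-\partial_y^2$. For $\nu\in(0,1]$ consider $$\partial_t\psi+i\alpha H\psi-\nu\Delta_\alpha\psi=\nu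 R\psi,\qquad \psi(0)=\psi_0. \tag{NS}$$ Theorem. For every compact interval $I_0\subset(U_-,U_+)$ there are constants $M_0,c_0>0$ such that for every smooth function $g:\mathbb{R}\to\mathbb{C}$ with support contained in $I_0$ there is a constant $C_0>0$ with the following property. For every $\nu\in(0,1]$, every $\alpha\in\mathbb{Z}\setminus\{0\}$ and every $\psi_0\in H^1(\mathbb{R})$, the solution $\psi$ of (NS) (continuous on $[0,\infty)$ with values in $L^2$ and, for $t>0$, $H^2$-valued, differentiable in $L^2$ and satisfying the equation) is such that, for all $t\ge0$, $g(H)\psi(t)\in H^1(\mathbb{R})$ and $$N(t)\le C_0\Big(e^{-c_0\nu^{1/3}t}N(0)+\big(\nu^{1/3}+(\nu t)^{1/2}e^{M_0\nu t}\big)\big(\|\psi_0\|+\|\alpha\psi_0\|\big)\Big),$$ where $$N(t)=\|g(H)\psi(t)\|+\|\alpha\, g(H)\psi(t)\|+\nu^{1/3}\|\partial_y g(H)\psi(t)\| .$$ -/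

import Mathlib

open MeasureTheory Filter Topology
open scoped ENNReal ContDiff SchwartzMap

namespace ShearFlow

noncomputable section

/-- The complex Hilbert space `L²(ℝ)`. -/
abbrev L2 : Type := Lp (α := ℝ) ℂ 2 volume

/-! ### Derivatives and Sobolev spaces on the line -/

/-- `g ∈ L²` is the distributional derivative of `f ∈ L²`. -/
def HasWeakDeriv (f g : L2) : Prop :=
  TemperedDistribution.derivCLM ℂ (f : 𝓢'(ℝ, ℂ)) = (g : 𝓢'(ℝ, ℂ))

/-- `f ∈ H²(ℝ)`, with second distributional derivative `h`. -/
def HasWeakDeriv2 (f h : L2) : Prop :=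
  ∃ g : L2, HasWeakDeriv f g ∧ HasWeakDeriv g h

/-- `f ∈ H¹(ℝ)`. -/
def MemH1 (f : L2) : Prop := ∃ g : L2, HasWeakDeriv f g

open Classical in
/-- The derivative `∂_y f` of `f ∈ H¹(ℝ)` (and `0` if `f ∉ H¹(ℝ)`). -/
def weakDeriv (f : L2) : L2 := if h : MemH1 f then h.choose else 0

theorem HasWeakDeriv.unique {f g h : L2} (hg : HasWeakDeriv f g) (hh : HasWeakDeriv f h) :
    g = h := by
  have hgh : Lp.toTemperedDistributionCLM ℂ volume 2 g =
      Lp.toTemperedDistributionCLM ℂ volume 2 h := by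
    rw [Lp.toTemperedDistributionCLM_apply, Lp.toTemperedDistributionCLM_apply]
    exact hg.symm.trans hh
  exact LinearMap.ker_eq_bot.mp
    (Lp.ker_toTemperedDistributionCLM_eq_bot (F := ℂ) (μ := (volume : Measure ℝ)) (p := 2)) hgh

theorem HasWeakDeriv.weakDeriv_eq {f g : L2} (hg : HasWeakDeriv f g) : weakDeriv f = g := by
  have h : MemH1 f := ⟨g, hg⟩
  unfold weakDeriv
  rw [dif_pos h]
  exact h.choose_spec.unique hg

/-! ### Bounded operators on `L²` -/

open Classical in
/-- Multiplication by a function `a ∈ L^∞(ℝ)` as a bounded operator on `L²`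
(and `0` if `a ∉ L^∞(ℝ)`). -/
def mulOp (a : ℝ → ℝ) : L2 →L[ℂ] L2 :=
  if h : MemLp (fun y => (a y : ℂ)) ∞ (volume : Measure ℝ) then
    (ContinuousLinearMap.mul ℂ ℂ).holderL volume ∞ 2 2 (h.toLp (fun y => (a y : ℂ)))
  else 0

/-- The inverse `Δ_α⁻¹` of `Δ_α = ∂_y² - α² : H² → L²`, for `α ≠ 0`: the Fourier multiplier with
symbol `-1 / ((2πξ)² + α²)`, the Fourier transform being `∫ exp (-2πiyξ) f y dy`. -/
def invLap (α : ℤ) : L2 →L[ℂ] L2 :=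
  let F : L2 ≃L[ℂ] L2 := (Lp.fourierTransformₗᵢ ℝ ℂ).toContinuousLinearEquiv
  (F.symm : L2 →L[ℂ] L2) ∘L mulOp (fun ξ => -1 / ((2 * Real.pi * ξ) ^ 2 + (α : ℝ) ^ 2)) ∘L
    (F : L2 →L[ℂ] L2)

/-- `Σ = 1 + m Δ_α⁻¹ m`. -/
def Sigma (m : ℝ → ℝ) (α : ℤ) : L2 →L[ℂ] L2 :=
  1 + mulOp m ∘L invLap α ∘L mulOp m

/-- The nonnegative square root of a nonnegative bounded operator on a complex Hilbert space. -/
def opSqrt {E : Type*} [NormedAddCommGroup E] [InnerProductSpace ℂ E] [CompleteSpace E]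
    (T : E →L[ℂ] E) : E →L[ℂ] E := CFC.sqrt T

/-- `S = Σ^{1/2}`. -/
def S (m : ℝ → ℝ) (α : ℤ) : L2 →L[ℂ] L2 := opSqrt (Sigma m α)

/-- `S⁻¹`, the inverse bounded operator. -/
def Sinv (m : ℝ → ℝ) (α : ℤ) : L2 →L[ℂ] L2 := Ring.inverse (S m α)

/-- `H = S U S`. -/
def H (U m : ℝ → ℝ) (α : ℤ) : L2 →L[ℂ] L2 := S m α ∘L mulOp U ∘L S m α

/-- `g(H)`, through the continuous functional calculus of the self-adjoint operator `H`, for a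
complex-valued function `g` on the real line. -/
def funcH (U m : ℝ → ℝ) (α : ℤ) (g : ℝ → ℂ) : L2 →L[ℂ] L2 :=
  cfc (fun z : ℂ => g z.re) (H U m α)

/-! ### The assumptions on the shear flow -/

/-- The shear flow `U` is smooth and increasing with limits `Um` and `Up` at `-∞` and `+∞`,
`U''/U` is bounded and negative, and `m = (-U''/U)^{1/2}`. At the zero of `U` the quotient is
understood through its continuous extension: `m` is the continuous positive function with
`U'' = -m² U`. -/
structure IsMixingLayer (U m : ℝ → ℝ) (Um Up : ℝ) : Prop where
  smooth : ContDiff ℝ ∞ U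
  deriv_pos : ∀ y, 0 < deriv U y
  tendsto_atBot : Tendsto U atBot (𝓝 Um)
  tendsto_atTop : Tendsto U atTop (𝓝 Up)
  bounded_quotient : MemLp (fun y => iteratedDeriv 2 U y / U y) ∞ (volume : Measure ℝ)
  continuous_m : Continuous m
  m_pos : ∀ y, 0 < m y
  iteratedDeriv_two : ∀ y, iteratedDeriv 2 U y = -(m y) ^ 2 * U y

/-- The regularity and decay assumptions on `m` and `U''`. -/
structure HasDecay (U m : ℝ → ℝ) (Um Up : ℝ) : Prop where
  iteratedDeriv_le : ∀ k : ℕ, ∃ C : ℝ, 0 < C ∧ ∀ y, |iteratedDeriv k m y| ≤ C * m y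
  tendsto_m : Tendsto m (cocompact ℝ) (𝓝 0)
  memLp_m : MemLp m 2 (volume : Measure ℝ)
  bounded_minus : MemLp (fun y => iteratedDeriv 2 U y / (U y - Um)) ∞ (volume : Measure ℝ)
  memLp_minus : MemLp (fun y => iteratedDeriv 2 U y / (U y - Um)) 2 (volume : Measure ℝ)
  bounded_plus : MemLp (fun y => iteratedDeriv 2 U y / (U y - Up)) ∞ (volume : Measure ℝ)
  memLp_plus : MemLp (fun y => iteratedDeriv 2 U y / (U y - Up)) 2 (volume : Measure ℝ)

/-- The graph of the Schrödinger operator `-∂_y² - m²` with domain `H²(ℝ)`. -/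
def IsSchrodinger (m : ℝ → ℝ) (f h : L2) : Prop :=
  ∃ f2 : L2, HasWeakDeriv2 f f2 ∧ h = -f2 - mulOp (fun y => m y ^ 2) f

/-- The spectrum of the unbounded operator `-∂_y² - m²` with domain `H²(ℝ)`: the complement of the
set of `z` for which `-∂_y² - m² - z` is a bijection from `H²(ℝ)` onto `L²(ℝ)` whose inverse is
bounded on `L²(ℝ)`. -/
def schrodingerSpectrum (m : ℝ → ℝ) : Set ℂ :=
  {z | ¬ ((∀ h : L2, ∃! f : L2, IsSchrodinger m f (h + z • f)) ∧
    ∃ C : ℝ, ∀ f h : L2, IsSchrodinger m f (h + z • f) → ‖f‖ ≤ C * ‖h‖)}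

/-- The infimum of the (real) spectrum of `-∂_y² - m²` is larger than `-1`. -/
def IsSpectrallyStable (m : ℝ → ℝ) : Prop :=
  ∃ l : ℝ, IsGLB {x : ℝ | (x : ℂ) ∈ schrodingerSpectrum m} l ∧ -1 < l

/-! ### The equation -/

/-- `r = R f`, where `R = S (1/m) ∂_y² m S⁻¹ - ∂_y²`: here `h = ∂_y² (m S⁻¹ f)`, `k = (1/m) h` and
`f2 = ∂_y² f`. -/
def IsRemainder (m : ℝ → ℝ) (α : ℤ) (f r : L2) : Prop :=
  ∃ h k f2 : L2, HasWeakDeriv2 (mulOp m (Sinv m α f)) h ∧ mulOp m k = h ∧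
    HasWeakDeriv2 f f2 ∧ r = S m α k - f2

/-- `ψ` is the (classical) solution of
`∂_t ψ + i α H ψ - ν Δ_α ψ = ν R ψ`, `Δ_α = ∂_y² - α²`, with initial value `ψ₀`: it is continuous on
`[0, ∞)` with values in `L²`, and for `t > 0` it takes values in `H²`, is differentiable in `L²`,
and satisfies the equation. -/
structure IsSolution (U m : ℝ → ℝ) (α : ℤ) (ν : ℝ) (ψ₀ : L2) (ψ : ℝ → L2) : Prop where
  continuousOn : ContinuousOn ψ (Set.Ici 0)
  initial : ψ 0 = ψ₀
  equation : ∀ t : ℝ, 0 < t → ∃ dψ ψ2 r : L2, HasDerivAt ψ dψ t ∧ HasWeakDeriv2 (ψ t) ψ2 ∧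
    IsRemainder m α (ψ t) r ∧
    dψ + (Complex.I * (α : ℂ)) • H U m α (ψ t) - (ν : ℂ) • (ψ2 - ((α : ℂ) ^ 2) • ψ t) =
      (ν : ℂ) • r

/-- `‖g(H) f‖ + ‖α g(H) f‖ + ν^{1/3} ‖∂_y g(H) f‖`. -/
def localNorm (U m : ℝ → ℝ) (α : ℤ) (ν : ℝ) (g : ℝ → ℂ) (f : L2) : ℝ :=
  ‖funcH U m α g f‖ + ‖(α : ℂ) • funcH U m α g f‖ +
    ν ^ (1 / 3 : ℝ) * ‖weakDeriv (funcH U m α g f)‖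

end

end ShearFlow

open ShearFlow

/-!
# Semiclassical hypocoercivity for the linearized flow near a mixing layer

Write `∂` for the derivative on the line, `δ = ν^{1/3}`, `K = m (α² - ∂²)⁻¹ m`, so that
`S² = 1 - K`.

*Operators that almost commute with the derivative.* Everything is measured by the commutators
`[∂, A]` and `[∂, [∂, A]]` of bounded operators `A` (`HasComm`, `HasComm2`). A smooth functional
calculus, obtained by expanding a compactly supported function in a Fourier series, preserves
bounds on them (`exists_hasComm2_cfc`). Spectral stability gives `‖K‖ < 1` (`norm_birman_one_lt`):
otherwise some `m (μ - ∂²)⁻¹ m`, `μ ≥ 1`, has norm `1`, and, being compact, the eigenvalue `1`, so that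
`-μ` is an eigenvalue of `-∂² - m²`. Hence `S`, `S⁻¹`, `H` and `g(H)` all have two bounded commutators
with `∂`, uniformly in `α` (`exists_sqrtBounds`, `exists_hasComm2_H`), and the remainder `R` is of
first order (`exists_remainder_le`).

*The Mourre estimate* `Re ⟨[∂, H] f, f⟩ ≥ θ ‖f‖² - C ‖(H - E) f‖²` (`exists_mourre`). The main part of
`[∂, H]` is `S U' S`, which is positive near the energy `E` because `U' > 0`. What remains is controlled
by the compact operators `K` and `m (α² - ∂²)⁻¹ m'`, which are small compared with `‖f‖` and
`‖(H - E) f‖` because `E` is not an eigenvalue of `H` (`exists_bound_mulOp_comp`, `H_injective`). An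
eigenfunction would solve the Rayleigh equation, and an energy identity with the regularized weight
`U' (U - E) / ((U - E)² + d²)`, `d → 0`, excludes this (`rayleigh_eq_zero`). For large `α` the
compact operators are small in norm, which makes the estimate uniform in `α`.

*The energy.* Let `g` be supported near `E` and `w` be a mollification of `g(H) ψ`. In the time
derivative of `α² ‖w‖² + a δ² ‖∂w‖² + b δ α Im ⟨w, ∂w⟩` the last term produces
`-b δ α² Re ⟨[∂, H] w, w⟩`, and the Mourre estimate makes it a damping of rate `δ`; viscosity
provides the damping of `∂w`, and weights `a = l⁴`, `b = l³` with `l` small absorb the errors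
(`energy_absorb`, `energy_le`). The forcing `ν [g(H), ∂²] ψ + ν g(H) R ψ` is controlled by the `L²`
energy identity for `ψ`, whose growth rate is of order `ν`. Since the solution need not be
continuous in `H¹` at time `0`, the energy is computed for the mollified function and the mollification
is removed afterwards (`norm_sq_localized_le`). A smooth partition of the energy interval removes
the restriction on the support of `g` (`exists_decay`).
-/

namespace ShearFlow

noncomputable section

open scoped FourierTransform

/-! ### The distributional derivative and Fourier multipliers -/

/-- Multiplication by a complex-valued function `a ∈ L^∞(ℝ)` as a bounded operator on `L²`
(and `0` if `a ∉ L^∞(ℝ)`). -/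
def cmulOp (a : ℝ → ℂ) : L2 →L[ℂ] L2 :=
  open Classical in
  if h : MemLp a ∞ (volume : Measure ℝ) then
    (ContinuousLinearMap.mul ℂ ℂ).holderL volume ∞ 2 2 (h.toLp a)
  else 0

theorem coeFn_cmulOp {a : ℝ → ℂ} (h : MemLp a ∞ (volume : Measure ℝ)) (f : L2) :
    cmulOp a f =ᵐ[volume] fun y => a y * f y := by
  rw [cmulOp, dif_pos h, ContinuousLinearMap.holderL_apply_apply]
  filter_upwards [(ContinuousLinearMap.mul ℂ ℂ).coeFn_holder (r := 2) (h.toLp a) f,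
    h.coeFn_toLp] with y h1 h2
  rw [h1, h2]; rfl

theorem norm_le_of_ae_le {f g : L2} {C : ℝ} (h : ∀ᵐ y, ‖f y‖ ≤ C * ‖g y‖) : ‖f‖ ≤ C * ‖g‖ :=
  Lp.norm_le_mul_norm_of_ae_le_mul h

theorem norm_cmulOp_apply_le {a : ℝ → ℂ} (h : MemLp a ∞ (volume : Measure ℝ)) {C : ℝ}
    (hC : ∀ y, ‖a y‖ ≤ C) (f : L2) : ‖cmulOp a f‖ ≤ C * ‖f‖ := by
  apply norm_le_of_ae_le
  filter_upwards [coeFn_cmulOp h f] with y hy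
  rw [hy, norm_mul]
  gcongr
  exact hC y

theorem inner_cmulOp {a : ℝ → ℂ} (h : MemLp a ∞ (volume : Measure ℝ)) (f g : L2) :
    inner ℂ (cmulOp a f) g = inner ℂ f (cmulOp (fun y => star (a y)) g) := by
  have h' : MemLp (fun y => star (a y)) ∞ (volume : Measure ℝ) := h.star
  rw [L2.inner_def, L2.inner_def]
  apply integral_congr_ae
  filter_upwards [coeFn_cmulOp h f, coeFn_cmulOp h' g] with y h1 h2
  rw [h1, h2]
  simp [mul_comm, mul_left_comm]

theorem fourier_derivCLM (f : 𝓢'(ℝ, ℂ)) :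
    𝓕 (TemperedDistribution.derivCLM ℂ f) =
      (2 * Real.pi * Complex.I) • TemperedDistribution.smulLeftCLM ℂ (inner ℝ · (1 : ℝ)) (𝓕 f) := by
  rw [← TemperedDistribution.fourier_lineDerivOp_eq]
  congr 1

/-- On the Fourier side, differentiation is multiplication by `2πiξ`. -/
theorem hasWeakDeriv_iff {f g : L2} : HasWeakDeriv f g ↔
    (𝓕 g : L2) =ᵐ[volume] fun ξ => 2 * Real.pi * Complex.I * ξ * (𝓕 f : L2) ξ := by
  have h1 : HasWeakDeriv f g ↔ 𝓕 (TemperedDistribution.derivCLM ℂ (f : 𝓢'(ℝ, ℂ))) =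
      𝓕 (g : 𝓢'(ℝ, ℂ)) := by
    constructor
    · intro h
      exact congrArg _ h
    · intro h
      exact (FourierTransform.fourierEquiv ℂ 𝓢'(ℝ, ℂ)).injective h
  rw [h1, fourier_derivCLM, Lp.fourier_toTemperedDistribution_eq,
    Lp.fourier_toTemperedDistribution_eq]
  set F := (𝓕 f : L2)
  set G := (𝓕 g : L2)
  have hg : (fun x : ℝ => ((inner ℝ x (1 : ℝ) : ℝ) : ℂ)).HasTemperateGrowth := by fun_prop
  have key : ∀ u : 𝓢(ℝ, ℂ), ((2 * Real.pi * Complex.I) • TemperedDistribution.smulLeftCLM ℂ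
      (fun x : ℝ => ((inner ℝ x (1 : ℝ) : ℝ) : ℂ)) (F : 𝓢'(ℝ, ℂ))) u =
      ∫ x, u x * (2 * Real.pi * Complex.I * x * F x) := by
    intro u
    change (2 * Real.pi * Complex.I) • (F : 𝓢'(ℝ, ℂ)) (SchwartzMap.smulLeftCLM ℂ _ u) = _
    rw [Lp.toTemperedDistribution_apply, ← integral_smul]
    congr 1
    ext x
    rw [SchwartzMap.smulLeftCLM_apply_apply hg]
    simp
    ring
  have key2 : ∀ u : 𝓢(ℝ, ℂ), (G : 𝓢'(ℝ, ℂ)) u = ∫ x, u x * G x := by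
    intro u
    rw [Lp.toTemperedDistribution_apply]
    rfl
  constructor
  · intro h
    have hF : LocallyIntegrable F volume := (Lp.memLp F).locallyIntegrable (by norm_num)
    have hG : LocallyIntegrable G volume := (Lp.memLp G).locallyIntegrable (by norm_num)
    have hF' : LocallyIntegrable (fun ξ : ℝ => 2 * Real.pi * Complex.I * ξ * F ξ) volume := by
      have := hF.locallyIntegrableOn Set.univ
      have hc : Continuous (fun ξ : ℝ => 2 * Real.pi * Complex.I * (ξ : ℂ)) := by fun_prop
      rw [← locallyIntegrableOn_univ] at hF ⊢
      exact hF.continuousOn_mul hc.continuousOn isOpen_univ.isLocallyClosed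
    have := ae_eq_of_integral_contDiff_smul_eq hG hF' ?_
    · exact this
    intro φ hφ hφ'
    have hg₁ : HasCompactSupport (Complex.ofRealCLM ∘ φ) := hφ'.comp_left rfl
    have hg₂ : ContDiff ℝ ∞ (Complex.ofRealCLM ∘ φ) := by fun_prop
    have e := congrArg (fun T : 𝓢'(ℝ, ℂ) => T (hg₁.toSchwartzMap hg₂)) h
    simp only [key, key2] at e
    rw [← key2 (hg₁.toSchwartzMap hg₂)] at e
    have e2 := key2 (hg₁.toSchwartzMap hg₂)
    simpa using e2.symm.trans e.symm
  · intro h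
    ext u
    rw [key, key2]
    apply integral_congr_ae
    filter_upwards [h] with x hx
    rw [hx]

theorem HasWeakDeriv.add {f f' g g' : L2} (hf : HasWeakDeriv f f') (hg : HasWeakDeriv g g') :
    HasWeakDeriv (f + g) (f' + g') := by
  have := congrArg₂ (· + ·) hf hg
  simp only [HasWeakDeriv, ← Lp.toTemperedDistributionCLM_apply, map_add] at *
  exact this

theorem HasWeakDeriv.smul {f f' : L2} (c : ℂ) (hf : HasWeakDeriv f f') :
    HasWeakDeriv (c • f) (c • f') := by
  have := congrArg (c • ·) hf
  simp only [HasWeakDeriv, ← Lp.toTemperedDistributionCLM_apply, map_smul] at *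
  exact this

theorem hasWeakDeriv_zero : HasWeakDeriv 0 0 := by
  simp [HasWeakDeriv, ← Lp.toTemperedDistributionCLM_apply]

theorem hasWeakDeriv_toLp (f : 𝓢(ℝ, ℂ)) :
    HasWeakDeriv (f.toLp 2) ((SchwartzMap.derivCLM ℂ ℂ f).toLp 2) := by
  simp only [HasWeakDeriv, Lp.toTemperedDistribution_toLp_eq]
  exact TemperedDistribution.derivCLM_toTemperedDistributionCLM_eq ℂ f

theorem dense_toLp : DenseRange fun f : 𝓢(ℝ, ℂ) => (f.toLp 2 : L2) :=
  SchwartzMap.denseRange_toLpCLM (p := 2) ENNReal.ofNat_ne_top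

/-- The derivative is skew-symmetric. -/
theorem HasWeakDeriv.inner_eq {f f' g g' : L2} (hf : HasWeakDeriv f f') (hg : HasWeakDeriv g g') :
    inner ℂ f' g = -inner ℂ f g' := by
  rw [← Lp.inner_fourier_eq f' g, ← Lp.inner_fourier_eq f g', L2.inner_def, L2.inner_def,
    ← integral_neg]
  apply integral_congr_ae
  filter_upwards [hasWeakDeriv_iff.1 hf, hasWeakDeriv_iff.1 hg] with y h1 h2
  rw [h1, h2]
  have h2 : (starRingEnd ℂ) 2 = 2 := Complex.conj_ofNat 2
  simp [h2]
  ring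

/-- The Fourier multiplier with symbol `σ`. -/
def fmul (σ : ℝ → ℂ) : L2 →L[ℂ] L2 :=
  ((Lp.fourierTransformₗᵢ ℝ ℂ).toContinuousLinearEquiv.symm : L2 →L[ℂ] L2) ∘L cmulOp σ ∘L
    ((Lp.fourierTransformₗᵢ ℝ ℂ).toContinuousLinearEquiv : L2 →L[ℂ] L2)

theorem fourier_fmul (σ : ℝ → ℂ) (f : L2) : (𝓕 (fmul σ f) : L2) = cmulOp σ (𝓕 f : L2) :=
  (Lp.fourierTransformₗᵢ ℝ ℂ).apply_symm_apply _

theorem coeFn_fourier_fmul {σ : ℝ → ℂ} (h : MemLp σ ∞ (volume : Measure ℝ)) (f : L2) :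
    (𝓕 (fmul σ f) : L2) =ᵐ[volume] fun ξ => σ ξ * (𝓕 f : L2) ξ := by
  rw [fourier_fmul]
  exact coeFn_cmulOp h _

theorem ext_fourier {f g : L2} (h : (𝓕 f : L2) =ᵐ[volume] (𝓕 g : L2)) : f = g :=
  (Lp.fourierTransformₗᵢ ℝ ℂ).injective (Lp.ext h)

theorem norm_fmul_apply_le {σ : ℝ → ℂ} (h : MemLp σ ∞ (volume : Measure ℝ)) {C : ℝ}
    (hC : ∀ y, ‖σ y‖ ≤ C) (f : L2) : ‖fmul σ f‖ ≤ C * ‖f‖ := by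
  rw [← Lp.norm_fourier_eq (fmul σ f), fourier_fmul, ← Lp.norm_fourier_eq f]
  exact norm_cmulOp_apply_le h hC _

theorem inner_fmul {σ : ℝ → ℂ} (h : MemLp σ ∞ (volume : Measure ℝ)) (f g : L2) :
    inner ℂ (fmul σ f) g = inner ℂ f (fmul (fun y => star (σ y)) g) := by
  rw [← Lp.inner_fourier_eq, fourier_fmul, inner_cmulOp h, ← fourier_fmul, Lp.inner_fourier_eq]

theorem HasWeakDeriv.fmul {σ : ℝ → ℂ} (h : MemLp σ ∞ (volume : Measure ℝ)) {f g : L2}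
    (hf : HasWeakDeriv f g) : HasWeakDeriv (fmul σ f) (fmul σ g) := by
  rw [hasWeakDeriv_iff] at hf ⊢
  filter_upwards [hf, coeFn_fourier_fmul h f, coeFn_fourier_fmul h g] with ξ h1 h2 h3
  rw [h3, h2, h1]; ring

theorem hasWeakDeriv_fmul {σ : ℝ → ℂ} (h : MemLp σ ∞ (volume : Measure ℝ))
    (h' : MemLp (fun ξ : ℝ => 2 * Real.pi * Complex.I * ξ * σ ξ) ∞ (volume : Measure ℝ)) (f : L2) :
    HasWeakDeriv (ShearFlow.fmul σ f)
      (ShearFlow.fmul (fun ξ : ℝ => 2 * Real.pi * Complex.I * ξ * σ ξ) f) := by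
  rw [hasWeakDeriv_iff]
  filter_upwards [coeFn_fourier_fmul h f, coeFn_fourier_fmul h' f] with ξ h2 h3
  rw [h3, h2]; ring

theorem memLp_top_of_continuous {σ : ℝ → ℂ} (h : Continuous σ) {C : ℝ} (hC : ∀ ξ, ‖σ ξ‖ ≤ C) :
    MemLp σ ∞ (volume : Measure ℝ) :=
  memLp_top_of_bound h.aestronglyMeasurable C (Eventually.of_forall hC)

/-! ### The resolvent of the derivative -/

/-- The symbol `1 / (1 - 2πiεξ)` of the resolvent `(1 - ε∂_y)⁻¹`. -/
def resSymbol (ε ξ : ℝ) : ℂ := 1 / (1 - 2 * Real.pi * Complex.I * ε * ξ)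

theorem resSymbol_den_ne (ε ξ : ℝ) : (1 - 2 * Real.pi * Complex.I * ε * ξ : ℂ) ≠ 0 := by
  intro h
  have := congrArg Complex.re h
  simp at this

theorem norm_resSymbol_le (ε ξ : ℝ) : ‖resSymbol ε ξ‖ ≤ 1 := by
  rw [resSymbol, norm_div, norm_one]
  apply div_le_one_of_le₀ _ (norm_nonneg _)
  have := Complex.abs_re_le_norm (1 - 2 * Real.pi * Complex.I * ε * ξ : ℂ)
  simpa using this

theorem memLp_resSymbol (ε : ℝ) : MemLp (resSymbol ε) ∞ (volume : Measure ℝ) := by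
  refine memLp_top_of_continuous ?_ (norm_resSymbol_le ε)
  unfold resSymbol
  exact continuous_const.div (by fun_prop) (resSymbol_den_ne ε)

/-- The resolvent `J_ε = (1 - ε∂_y)⁻¹`, used as a mollifier. -/
def J (ε : ℝ) : L2 →L[ℂ] L2 := fmul (resSymbol ε)

theorem norm_J_apply_le (ε : ℝ) (f : L2) : ‖J ε f‖ ≤ ‖f‖ := by
  simpa [J] using norm_fmul_apply_le (memLp_resSymbol ε) (norm_resSymbol_le ε) f

theorem hasWeakDeriv_J {ε : ℝ} (hε : ε ≠ 0) (f : L2) :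
    HasWeakDeriv (J ε f) ((ε : ℂ)⁻¹ • (J ε f - f)) := by
  rw [hasWeakDeriv_iff]
  have e : (𝓕 ((ε : ℂ)⁻¹ • (J ε f - f)) : L2) = (ε : ℂ)⁻¹ • ((𝓕 (J ε f) : L2) - (𝓕 f : L2)) := by
    change Lp.fourierTransformₗᵢ ℝ ℂ _ = _
    rw [map_smul, map_sub]; rfl
  rw [e]
  have hε' : (ε : ℂ) ≠ 0 := by exact_mod_cast hε
  filter_upwards [coeFn_fourier_fmul (memLp_resSymbol ε) f,
    Lp.coeFn_smul (ε : ℂ)⁻¹ ((𝓕 (J ε f) : L2) - (𝓕 f : L2)),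
    Lp.coeFn_sub (𝓕 (J ε f) : L2) (𝓕 f : L2)] with ξ h1 h2 h3
  rw [h2, Pi.smul_apply, h3, Pi.sub_apply, J, h1, resSymbol, smul_eq_mul]
  have key := one_div_mul_cancel (resSymbol_den_ne ε ξ)
  rw [inv_mul_eq_iff_eq_mul₀ hε']
  linear_combination ((𝓕 f : L2) ξ) * key

theorem HasWeakDeriv.J {f g : L2} (hf : HasWeakDeriv f g) (ε : ℝ) :
    HasWeakDeriv (J ε f) (J ε g) := hf.fmul (memLp_resSymbol ε)

theorem J_sub {f g : L2} (hf : HasWeakDeriv f g) (ε : ℝ) : J ε (f - (ε : ℂ) • g) = f := by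
  apply ext_fourier
  have e : (𝓕 (f - (ε : ℂ) • g) : L2) = (𝓕 f : L2) - (ε : ℂ) • (𝓕 g : L2) := by
    change Lp.fourierTransformₗᵢ ℝ ℂ _ = _
    rw [map_sub, map_smul]; rfl
  filter_upwards [coeFn_fourier_fmul (memLp_resSymbol ε) (f - (ε : ℂ) • g),
    hasWeakDeriv_iff.1 hf, e ▸ Lp.coeFn_sub (𝓕 f : L2) ((ε : ℂ) • (𝓕 g : L2)),
    Lp.coeFn_smul (ε : ℂ) (𝓕 g : L2)] with ξ h1 h2 h3 h4
  rw [ShearFlow.J, h1, h3, Pi.sub_apply, h4, Pi.smul_apply, h2, resSymbol, smul_eq_mul]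
  have := resSymbol_den_ne ε ξ
  field_simp

theorem J_sub_self {f g : L2} (hf : HasWeakDeriv f g) (ε : ℝ) :
    J ε f - f = (ε : ℂ) • J ε g := by
  have := J_sub hf ε
  rw [map_sub, map_smul] at this
  rw [sub_eq_iff_eq_add, ← sub_eq_iff_eq_add', this]

/-- A pair is in the graph of the derivative iff it satisfies the resolvent identity. -/
theorem hasWeakDeriv_iff_J {f g : L2} : HasWeakDeriv f g ↔ J 1 (f - g) = f := by
  constructor
  · intro h
    simpa using J_sub h 1
  · intro h
    have := hasWeakDeriv_J one_ne_zero (f - g)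
    rw [h] at this
    simpa using this

theorem HasWeakDeriv.of_tendsto {ι : Type*} {l : Filter ι} [l.NeBot] {f g : ι → L2} {f₀ g₀ : L2}
    (h : ∀ i, HasWeakDeriv (f i) (g i)) (hf : Tendsto f l (𝓝 f₀)) (hg : Tendsto g l (𝓝 g₀)) :
    HasWeakDeriv f₀ g₀ := by
  simp only [hasWeakDeriv_iff_J] at h ⊢
  refine tendsto_nhds_unique ?_ hf
  have := ((ShearFlow.J 1).continuous.tendsto _).comp (hf.sub hg)
  refine this.congr fun i => h i

theorem dense_memH1 : Dense {f : L2 | MemH1 f} := by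
  refine dense_toLp.mono ?_
  rintro _ ⟨f, rfl⟩
  exact ⟨_, hasWeakDeriv_toLp f⟩

/-- The mollifiers converge strongly to the identity. -/
theorem tendsto_J (f : L2) : Tendsto (fun ε => J ε f) (𝓝[>] 0) (𝓝 f) := by
  rw [Metric.tendsto_nhds]
  intro η hη
  obtain ⟨f₁, hf₁, ⟨g, hg⟩⟩ := Metric.dense_iff.1 dense_memH1 f (η / 3) (by positivity)
  have hlim : Tendsto (fun ε : ℝ => ε * ‖g‖) (𝓝[>] 0) (𝓝 0) := by
    have : Tendsto (fun ε : ℝ => ε * ‖g‖) (𝓝 0) (𝓝 (0 * ‖g‖)) := by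
      exact (continuous_id.mul continuous_const).tendsto _
    rw [zero_mul] at this
    exact this.mono_left nhdsWithin_le_nhds
  filter_upwards [hlim.eventually (gt_mem_nhds (show 0 < η / 3 by positivity)),
    self_mem_nhdsWithin] with ε h1 h2
  have h3 : ‖J ε f₁ - f₁‖ ≤ ε * ‖g‖ := by
    rw [J_sub_self hg, norm_smul]
    simp only [Complex.norm_real, Real.norm_eq_abs, abs_of_pos (show 0 < ε from h2)]
    gcongr
    · exact le_of_lt h2
    · exact norm_J_apply_le ε g
  have h4 : ‖J ε (f - f₁)‖ ≤ ‖f - f₁‖ := norm_J_apply_le _ _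
  rw [dist_eq_norm]
  rw [Metric.mem_ball, dist_eq_norm, norm_sub_rev] at hf₁
  have h5 : J ε f - f = J ε (f - f₁) + (J ε f₁ - f₁) - (f - f₁) := by
    rw [map_sub]; abel
  rw [h5]
  calc _ ≤ ‖J ε (f - f₁)‖ + ‖J ε f₁ - f₁‖ + ‖f - f₁‖ :=
        (norm_sub_le _ _).trans (by gcongr; exact norm_add_le _ _)
    _ < η := by linarith

/-! ### Operators with bounded commutator with the derivative -/

/-- `B` is the bounded extension of the commutator `[∂_y, A] = ∂_y A - A ∂_y`. -/
def HasComm (A B : L2 →L[ℂ] L2) : Prop :=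
  ∀ f f' : L2, HasWeakDeriv f f' → HasWeakDeriv (A f) (A f' + B f)

namespace HasComm

variable {A A' B B' : L2 →L[ℂ] L2}

theorem memH1 (h : HasComm A B) {f : L2} (hf : MemH1 f) : MemH1 (A f) := by
  obtain ⟨f', hf'⟩ := hf
  exact ⟨_, h f f' hf'⟩

protected theorem add (h : HasComm A B) (h' : HasComm A' B') : HasComm (A + A') (B + B') := by
  intro f f' hf
  have := (h f f' hf).add (h' f f' hf)
  simp only [_root_.add_apply]
  convert! this using 1
  abel

protected theorem smul (c : ℂ) (h : HasComm A B) : HasComm (c • A) (c • B) := by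
  intro f f' hf
  have := (h f f' hf).smul c
  simpa using this

protected theorem neg (h : HasComm A B) : HasComm (-A) (-B) := by
  simpa using h.smul (-1)

protected theorem sub (h : HasComm A B) (h' : HasComm A' B') : HasComm (A - A') (B - B') := by
  simpa [sub_eq_add_neg] using h.add h'.neg

protected theorem zero : HasComm 0 0 := by
  intro f f' _
  simpa using hasWeakDeriv_zero

protected theorem one : HasComm 1 0 := by
  intro f f' hf
  simpa using hf

/-- The Leibniz rule for commutators. -/
protected theorem mul (h : HasComm A B) (h' : HasComm A' B') :
    HasComm (A * A') (A * B' + B * A') := by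
  intro f f' hf
  have := h _ _ (h' f f' hf)
  simp only [_root_.add_apply, map_add] at this ⊢
  rw [← add_assoc]
  exact this

protected theorem sum {ι : Type*} {s : Finset ι} {A B : ι → L2 →L[ℂ] L2}
    (h : ∀ i ∈ s, HasComm (A i) (B i)) : HasComm (∑ i ∈ s, A i) (∑ i ∈ s, B i) := by
  classical
  induction s using Finset.induction_on with
  | empty => simpa using HasComm.zero
  | insert i s hi ih =>
    rw [Finset.sum_insert hi, Finset.sum_insert hi]
    exact (h i (Finset.mem_insert_self i s)).add
      (ih fun j hj => h j (Finset.mem_insert_of_mem hj))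

protected theorem of_tendsto {ι : Type*} {l : Filter ι} [l.NeBot] {A B : ι → L2 →L[ℂ] L2}
    {A₀ B₀ : L2 →L[ℂ] L2} (h : ∀ i, HasComm (A i) (B i)) (hA : Tendsto A l (𝓝 A₀))
    (hB : Tendsto B l (𝓝 B₀)) : HasComm A₀ B₀ := by
  intro f f' hf
  have e : ∀ (g : L2) {C : ι → L2 →L[ℂ] L2} {C₀ : L2 →L[ℂ] L2}, Tendsto C l (𝓝 C₀) →
      Tendsto (fun i => C i g) l (𝓝 (C₀ g)) := fun g C C₀ hC =>
    ((ContinuousLinearMap.apply ℂ L2 g).continuous.tendsto _).comp hC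
  exact HasWeakDeriv.of_tendsto (fun i => h i f f' hf) (e f hA) ((e f' hA).add (e f hB))

protected theorem hasSum {ι : Type*} {A B : ι → L2 →L[ℂ] L2}
    {A₀ B₀ : L2 →L[ℂ] L2} (h : ∀ i, HasComm (A i) (B i)) (hA : HasSum A A₀)
    (hB : HasSum B B₀) : HasComm A₀ B₀ :=
  HasComm.of_tendsto (fun _ : Finset ι => HasComm.sum fun i _ => h i) hA hB

protected theorem unique (h : HasComm A B) (h' : HasComm A B') : B = B' := by
  refine ContinuousLinearMap.ext_on (s := {f : L2 | MemH1 f}) ?_ ?_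
  · have : Dense (Submodule.span ℂ {f : L2 | MemH1 f} : Set L2) :=
      dense_memH1.mono Submodule.subset_span
    exact this
  · rintro f ⟨f', hf⟩
    exact add_left_cancel ((h f f' hf).unique (h' f f' hf))

/-- The commutator with a mollifier. -/
theorem J_apply (h : HasComm A B) {ε : ℝ} (hε : ε ≠ 0) (f : L2) :
    J ε (A f) = A (J ε f) + (ε : ℂ) • J ε (B (J ε f)) := by
  have hε' : (ε : ℂ) ≠ 0 := by exact_mod_cast hε
  have h1 := J_sub (h _ _ (hasWeakDeriv_J hε f)) ε
  have h2 : A (J ε f) - (ε : ℂ) • (A ((ε : ℂ)⁻¹ • (J ε f - f)) + B (J ε f)) =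
      A f - (ε : ℂ) • B (J ε f) := by
    rw [map_smul, smul_add, smul_inv_smul₀ hε', map_sub]
    abel
  rw [h2, map_sub, map_smul] at h1
  rw [← h1]
  abel

/-- The commutator of a symmetric operator is symmetric. -/
theorem isSymmetric (h : HasComm A B) (hA : (A : L2 →ₗ[ℂ] L2).IsSymmetric) :
    (B : L2 →ₗ[ℂ] L2).IsSymmetric := by
  have key : ∀ f ∈ {f : L2 | MemH1 f}, ∀ g ∈ {f : L2 | MemH1 f},
      inner ℂ (B f) g = inner ℂ f (B g) := by
    rintro f ⟨f', hf⟩ g ⟨g', hg⟩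
    have e1 := (h f f' hf).inner_eq hg
    have e2 := hf.inner_eq (h g g' hg)
    have e3 : inner ℂ (A f') g = inner ℂ f' (A g) := hA f' g
    have e4 : inner ℂ (A f) g' = inner ℂ f (A g') := hA f g'
    rw [inner_add_left] at e1
    rw [inner_add_right] at e2
    linear_combination e1 - e2 - e3 - e4
  have key2 : ∀ f ∈ {f : L2 | MemH1 f}, ∀ g : L2, inner ℂ (B f) g = inner ℂ f (B g) := by
    intro f hf
    have := Continuous.ext_on (f := fun g => inner ℂ (B f) g) (g := fun g => inner ℂ f (B g))
      dense_memH1 (by fun_prop) (by fun_prop) (fun g hg => key f hf g hg)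
    exact fun g => congrFun this g
  intro f g
  have := Continuous.ext_on (f := fun f => inner ℂ (B f) g) (g := fun f => inner ℂ f (B g))
    dense_memH1 (by fun_prop) (by fun_prop) (fun f hf => key2 f hf g)
  exact congrFun this f

/-- The second derivative of `A f`, for an operator `A` with two bounded commutators. -/
theorem hasWeakDeriv2 {A₂ : L2 →L[ℂ] L2} (h : HasComm A B) (h₂ : HasComm B A₂) {f f₁ f₂ : L2}
    (hf : HasWeakDeriv f f₁) (hf₁ : HasWeakDeriv f₁ f₂) :
    HasWeakDeriv (A f) (A f₁ + B f) ∧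
      HasWeakDeriv (A f₁ + B f) (A f₂ + (2 : ℂ) • B f₁ + A₂ f) := by
  refine ⟨h _ _ hf, ?_⟩
  convert! (h _ _ hf₁).add (h₂ _ _ hf) using 1
  rw [two_smul]; abel

end HasComm

/-! ### Classical derivatives and multiplication operators -/

theorem hasWeakDeriv_of_hasDerivAt {F F' : ℝ → ℂ} (h : ∀ y, HasDerivAt F (F' y) y)
    (hF : MemLp F 2 (volume : Measure ℝ)) (hF' : MemLp F' 2 (volume : Measure ℝ)) :
    HasWeakDeriv (hF.toLp F) (hF'.toLp F') := by
  rw [HasWeakDeriv]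
  ext φ
  rw [TemperedDistribution.derivCLM_apply_apply, Lp.toTemperedDistribution_apply,
    Lp.toTemperedDistribution_apply]
  have hφ : MemLp φ 2 (volume : Measure ℝ) := φ.memLp 2
  have hφ' : MemLp (SchwartzMap.derivCLM ℂ ℂ φ) 2 (volume : Measure ℝ) := (SchwartzMap.derivCLM ℂ ℂ φ).memLp 2
  have e := integral_mul_deriv_eq_deriv_mul_of_integrable (u := φ) (v := F)
    (u' := SchwartzMap.derivCLM ℂ ℂ φ) (v' := F')
    (fun y _ => by simpa using φ.differentiableAt.hasDerivAt) (fun y _ => h y) (hφ.integrable_mul hF')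
    (hφ'.integrable_mul hF) (hφ.integrable_mul hF)
  calc _ = ∫ x, -(SchwartzMap.derivCLM ℂ ℂ φ x * F x) := by
        apply integral_congr_ae
        filter_upwards [hF.coeFn_toLp] with x hx
        rw [hx, smul_eq_mul, ← neg_mul]; rfl
    _ = ∫ x, φ x * F' x := by rw [integral_neg, ← e]
    _ = _ := by
        apply integral_congr_ae
        filter_upwards [hF'.coeFn_toLp] with x hx
        rw [hx, smul_eq_mul]

theorem memLp_top_ofReal {a : ℝ → ℝ} (h : Continuous a) {C : ℝ} (hC : ∀ y, |a y| ≤ C) :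
    MemLp (fun y => (a y : ℂ)) ∞ (volume : Measure ℝ) :=
  memLp_top_of_continuous (by fun_prop) (C := C) (fun y => by simpa using hC y)

theorem coeFn_mulOp {a : ℝ → ℝ} (h : Continuous a) {C : ℝ} (hC : ∀ y, |a y| ≤ C) (f : L2) :
    mulOp a f =ᵐ[volume] fun y => (a y : ℂ) * f y :=
  coeFn_cmulOp (memLp_top_ofReal h hC) f

theorem norm_mulOp_apply_le {a : ℝ → ℝ} (h : Continuous a) {C : ℝ} (hC : ∀ y, |a y| ≤ C) (f : L2) :
    ‖mulOp a f‖ ≤ C * ‖f‖ :=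
  norm_cmulOp_apply_le (memLp_top_ofReal h hC) (fun y => by simpa using hC y) f

theorem norm_mulOp_le {a : ℝ → ℝ} (h : Continuous a) {C : ℝ} (hC : ∀ y, |a y| ≤ C) :
    ‖mulOp a‖ ≤ C :=
  ContinuousLinearMap.opNorm_le_bound _ ((abs_nonneg _).trans (hC 0)) (norm_mulOp_apply_le h hC)

theorem mulOp_isSymmetric (a : ℝ → ℝ) : (mulOp a : L2 →ₗ[ℂ] L2).IsSymmetric := by
  intro f g
  by_cases h : MemLp (fun y => (a y : ℂ)) ∞ (volume : Measure ℝ)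
  · change inner ℂ (cmulOp (fun y => (a y : ℂ)) f) g = inner ℂ f (cmulOp (fun y => (a y : ℂ)) g)
    rw [inner_cmulOp h]
    simp
  · simp [mulOp, h]

theorem mulOp_mulOp {a b : ℝ → ℝ} (ha : Continuous a) {C : ℝ} (hC : ∀ y, |a y| ≤ C)
    (hb : Continuous b) {C' : ℝ} (hC' : ∀ y, |b y| ≤ C') (f : L2) :
    mulOp a (mulOp b f) = mulOp (fun y => a y * b y) f := by
  apply Lp.ext
  have hab : ∀ y, |a y * b y| ≤ C * C' := fun y => by
    rw [abs_mul]
    exact mul_le_mul (hC y) (hC' y) (abs_nonneg _) ((abs_nonneg _).trans (hC y))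
  filter_upwards [coeFn_mulOp ha hC (mulOp b f), coeFn_mulOp hb hC' f,
    coeFn_mulOp (a := fun y => a y * b y) (ha.mul hb) hab f] with y h1 h2 h3
  rw [h1, h2, h3]
  push_cast
  ring

/-- The product rule for weak derivatives. -/
theorem hasComm_mulOp {a a' : ℝ → ℝ} (ha : ∀ y, HasDerivAt a (a' y) y) (ha' : Continuous a')
    {C C' : ℝ} (hC : ∀ y, |a y| ≤ C) (hC' : ∀ y, |a' y| ≤ C') :
    HasComm (mulOp a) (mulOp a') := by
  have hac : Continuous a := continuous_iff_continuousAt.2 fun y => (ha y).continuousAt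
  intro f f' hf
  rw [HasWeakDeriv]
  ext φ
  rw [TemperedDistribution.derivCLM_apply_apply, Lp.toTemperedDistribution_apply,
    Lp.toTemperedDistribution_apply]
  have hφ : MemLp φ 2 (volume : Measure ℝ) := φ.memLp 2
  have hφ' : MemLp (SchwartzMap.derivCLM ℂ ℂ φ) 2 (volume : Measure ℝ) := (SchwartzMap.derivCLM ℂ ℂ φ).memLp 2
  have h1 : MemLp (fun y => (a y : ℂ) * star (φ y)) 2 (volume : Measure ℝ) :=
    hφ.star.mul (memLp_top_ofReal hac hC)
  have h2 : MemLp (fun y => (a' y : ℂ) * star (φ y) +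
      (a y : ℂ) * star (SchwartzMap.derivCLM ℂ ℂ φ y)) 2 (volume : Measure ℝ) :=
    (hφ.star.mul (memLp_top_ofReal ha' hC') (r := 2)).add
      (hφ'.star.mul (memLp_top_ofReal hac hC) (r := 2))
  have h3 := hasWeakDeriv_of_hasDerivAt (F := fun y => (a y : ℂ) * star (φ y)) (F' := fun y =>
    (a' y : ℂ) * star (φ y) + (a y : ℂ) * star (SchwartzMap.derivCLM ℂ ℂ φ y)) (fun y => by
      have e : HasDerivAt φ (SchwartzMap.derivCLM ℂ ℂ φ y) y := by
        simpa using φ.differentiableAt.hasDerivAt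
      exact (ha y).ofReal_comp.mul e.star) h1 h2
  have e := h3.inner_eq hf
  rw [L2.inner_def, L2.inner_def] at e
  have i1 : Integrable (fun y => φ y * ((a' y : ℂ) * f y)) volume :=
    hφ.integrable_mul (q := 2) ((Lp.memLp f).mul (memLp_top_ofReal ha' hC'))
  have i2 : Integrable (fun y => φ y * ((a y : ℂ) * f' y)) volume :=
    hφ.integrable_mul (q := 2) ((Lp.memLp f').mul (memLp_top_ofReal hac hC))
  have i3 : Integrable (fun y => SchwartzMap.derivCLM ℂ ℂ φ y * ((a y : ℂ) * f y)) volume :=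
    hφ'.integrable_mul (q := 2) ((Lp.memLp f).mul (memLp_top_ofReal hac hC))
  have e1 : ∫ y, (φ y * ((a' y : ℂ) * f y) + SchwartzMap.derivCLM ℂ ℂ φ y * ((a y : ℂ) * f y)) =
      -∫ y, φ y * ((a y : ℂ) * f' y) := by
    convert! e using 1
    · apply integral_congr_ae
      filter_upwards [h2.coeFn_toLp] with y hy
      rw [hy]
      simp
      ring
    · congr 1
      apply integral_congr_ae
      filter_upwards [h1.coeFn_toLp] with y hy
      rw [hy]
      simp
      ring
  rw [integral_add i1 i3] at e1
  calc _ = ∫ y, -(SchwartzMap.derivCLM ℂ ℂ φ y * ((a y : ℂ) * f y)) := by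
        apply integral_congr_ae
        filter_upwards [coeFn_mulOp hac hC f] with y hy
        rw [hy, smul_eq_mul, ← neg_mul]; rfl
    _ = ∫ y, (φ y * ((a y : ℂ) * f' y) + φ y * ((a' y : ℂ) * f y)) := by
        rw [integral_neg, integral_add i2 i1]
        linear_combination -e1
    _ = _ := by
        apply integral_congr_ae
        filter_upwards [coeFn_mulOp hac hC f', coeFn_mulOp ha' hC' f,
          Lp.coeFn_add (mulOp a f') (mulOp a' f)] with y h1 h2 h3
        rw [h3, Pi.add_apply, h1, h2, smul_eq_mul]
        ring

/-! ### The smooth functional calculus -/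

/-- `A` has two successive bounded commutators with `∂_y`, of norm at most `c`. -/
def HasComm2 (A : L2 →L[ℂ] L2) (c : ℝ) : Prop :=
  ∃ A₁ A₂ : L2 →L[ℂ] L2, HasComm A A₁ ∧ HasComm A₁ A₂ ∧ ‖A₁‖ ≤ c ∧ ‖A₂‖ ≤ c

namespace HasComm2

variable {A B : L2 →L[ℂ] L2} {c d : ℝ}

theorem nonneg (h : HasComm2 A c) : 0 ≤ c := by
  obtain ⟨A₁, _, _, _, h1, _⟩ := h
  exact (norm_nonneg _).trans h1

theorem mono (h : HasComm2 A c) (hcd : c ≤ d) : HasComm2 A d := by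
  obtain ⟨A₁, A₂, h1, h2, h3, h4⟩ := h
  exact ⟨A₁, A₂, h1, h2, h3.trans hcd, h4.trans hcd⟩

protected theorem one : HasComm2 1 0 := ⟨0, 0, HasComm.one, HasComm.zero, by simp, by simp⟩

protected theorem smul (h : HasComm2 A c) (a : ℂ) : HasComm2 (a • A) (‖a‖ * c) := by
  obtain ⟨A₁, A₂, h1, h2, h3, h4⟩ := h
  refine ⟨_, _, h1.smul a, h2.smul a, ?_, ?_⟩ <;> rw [norm_smul] <;> gcongr

protected theorem add (hA : HasComm2 A c) (hB : HasComm2 B d) : HasComm2 (A + B) (c + d) := by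
  obtain ⟨A₁, A₂, h1, h2, h3, h4⟩ := hA
  obtain ⟨B₁, B₂, k1, k2, k3, k4⟩ := hB
  exact ⟨_, _, h1.add k1, h2.add k2, norm_add_le_of_le h3 k3, norm_add_le_of_le h4 k4⟩

protected theorem mul {r : ℝ} (hA : HasComm2 A c) (hB : HasComm2 B c) (hAr : ‖A‖ ≤ r)
    (hBr : ‖B‖ ≤ r) : HasComm2 (A * B) (2 * c * (c + r)) := by
  have hc := hA.nonneg
  have hr : 0 ≤ r := (norm_nonneg _).trans hAr
  obtain ⟨A₁, A₂, h1, h2, h3, h4⟩ := hA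
  obtain ⟨B₁, B₂, k1, k2, k3, k4⟩ := hB
  have e : ∀ {X Y : L2 →L[ℂ] L2} {x y : ℝ}, ‖X‖ ≤ x → ‖Y‖ ≤ y → ‖X * Y‖ ≤ x * y :=
    fun {X Y x y} hX hY => (norm_mul_le _ _).trans
      (mul_le_mul hX hY (norm_nonneg _) ((norm_nonneg _).trans hX))
  refine ⟨_, _, h1.mul k1, (h1.mul k2).add (h2.mul k1), ?_, ?_⟩
  · calc _ ≤ r * c + c * r := norm_add_le_of_le (e hAr k3) (e h3 hBr)
      _ ≤ _ := by nlinarith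
  · calc _ ≤ r * c + c * c + (c * c + c * r) :=
        norm_add_le_of_le (norm_add_le_of_le (e hAr k4) (e h3 k3))
          (norm_add_le_of_le (e h3 k3) (e h4 hBr))
      _ ≤ _ := by nlinarith

/-- Powers: the two commutators grow like `n` and `n²`. -/
protected theorem pow {r : ℝ} (hr : 1 ≤ r) (hc : 1 ≤ c) (hA : HasComm2 A c) (hAr : ‖A‖ ≤ r)
    (n : ℕ) : HasComm2 (A ^ n) (n ^ 2 * c ^ 2 * r ^ n) := by
  obtain ⟨A₁, A₂, h1, h2, h3, h4⟩ := hA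
  have e : ∀ {X Y : L2 →L[ℂ] L2} {x y : ℝ}, ‖X‖ ≤ x → ‖Y‖ ≤ y → ‖X * Y‖ ≤ x * y :=
    fun {X Y x y} hX hY => (norm_mul_le _ _).trans
      (mul_le_mul hX hY (norm_nonneg _) ((norm_nonneg _).trans hX))
  have hpow : ∀ n : ℕ, ‖A ^ n‖ ≤ r ^ n := fun n => by
    induction n with
    | zero => rw [pow_zero, pow_zero]; exact ContinuousLinearMap.norm_id_le
    | succ n ih => rw [pow_succ, pow_succ]; exact e ih hAr
  have key : ∃ B₁ B₂, HasComm (A ^ n) B₁ ∧ HasComm B₁ B₂ ∧ ‖B₁‖ ≤ n * c * r ^ n ∧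
      ‖B₂‖ ≤ n ^ 2 * c ^ 2 * r ^ n := by
    induction n with
    | zero => exact ⟨0, 0, by simpa using HasComm.one, HasComm.zero, by simp, by simp⟩
    | succ n ih =>
      obtain ⟨B₁, B₂, k1, k2, k3, k4⟩ := ih
      have hrn : 1 ≤ r ^ n := one_le_pow₀ hr
      refine ⟨_, _, by rw [pow_succ]; exact k1.mul h1, (k1.mul h2).add (k2.mul h1), ?_, ?_⟩
      · refine (norm_add_le_of_le (e (hpow n) h3) (e k3 hAr)).trans ?_
        push_cast
        have : r ^ n * c ≤ r ^ n * c * r := le_mul_of_one_le_right (by positivity) hr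
        rw [pow_succ]
        nlinarith
      · refine (norm_add_le_of_le (norm_add_le_of_le (e (hpow n) h4) (e k3 h3))
          (norm_add_le_of_le (e k3 h3) (e k4 hAr))).trans ?_
        push_cast
        have i1 : r ^ n * c ≤ r ^ n * c ^ 2 * r := by
          have : c ≤ c ^ 2 := by nlinarith
          calc r ^ n * c ≤ r ^ n * c ^ 2 := by gcongr
            _ ≤ _ := le_mul_of_one_le_right (by positivity) hr
        have i2 : n * c * r ^ n * c ≤ n * c ^ 2 * r ^ n * r := by
          calc n * c * r ^ n * c = n * c ^ 2 * r ^ n := by ring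
            _ ≤ _ := le_mul_of_one_le_right (by positivity) hr
        rw [pow_succ r n]
        nlinarith
  obtain ⟨B₁, B₂, k1, k2, k3, k4⟩ := key
  refine ⟨B₁, B₂, k1, k2, k3.trans ?_, k4⟩
  have i1 : (n : ℝ) ≤ n ^ 2 := by exact_mod_cast Nat.le_self_pow two_ne_zero n
  have i2 : c ≤ c ^ 2 := by nlinarith
  gcongr

protected theorem hasSum {ι : Type*} {A : ι → L2 →L[ℂ] L2} {b : ι → ℝ} {A₀ : L2 →L[ℂ] L2}
    (h : ∀ i, HasComm2 (A i) (b i)) (hb : Summable b) (hA : HasSum A A₀) :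
    HasComm2 A₀ (∑' i, b i) := by
  choose B₁ B₂ h1 h2 h3 h4 using h
  have s1 : Summable B₁ := Summable.of_norm_bounded hb h3
  have s2 : Summable B₂ := Summable.of_norm_bounded hb h4
  exact ⟨∑' i, B₁ i, ∑' i, B₂ i, HasComm.hasSum h1 hA s1.hasSum,
    HasComm.hasSum h2 s1.hasSum s2.hasSum, tsum_of_norm_bounded hb.hasSum h3,
    tsum_of_norm_bounded hb.hasSum h4⟩

/-- Exponentials, through the power series. -/
protected theorem exp {r : ℝ} (hr : 1 ≤ r) (hc : 1 ≤ c) (hA : HasComm2 A c) (hAr : ‖A‖ ≤ r) :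
    HasComm2 (NormedSpace.exp A) (c ^ 2 * Real.exp (4 * r)) := by
  have hs : HasSum (fun n : ℕ => c ^ 2 * ((4 * r) ^ n / n.factorial))
      (c ^ 2 * Real.exp (4 * r)) := by
    have := NormedSpace.expSeries_div_hasSum_exp (𝔸 := ℝ) (4 * r)
    rw [← Real.exp_eq_exp_ℝ] at this
    exact this.mul_left _
  have hA' := NormedSpace.exp_series_hasSum_exp' (𝕂 := ℂ) A
  rw [← hs.tsum_eq]
  refine HasComm2.hasSum (fun n => ?_) hs.summable hA'
  refine ((hA.pow hr hc hAr n).smul _).mono ?_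
  rw [norm_inv, Complex.norm_natCast]
  have h4 : (n : ℝ) ^ 2 ≤ 4 ^ n := by
    have : (n : ℝ) ≤ 2 ^ n := by exact_mod_cast n.lt_two_pow_self.le
    calc (n : ℝ) ^ 2 ≤ (2 ^ n) ^ 2 := by gcongr
      _ = 4 ^ n := by rw [← pow_mul, mul_comm, pow_mul]; norm_num
  calc ((n.factorial : ℝ))⁻¹ * (n ^ 2 * c ^ 2 * r ^ n)
      ≤ ((n.factorial : ℝ))⁻¹ * (4 ^ n * c ^ 2 * r ^ n) := by gcongr
    _ = c ^ 2 * ((4 * r) ^ n / n.factorial) := by rw [mul_pow]; ring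

end HasComm2

/-- A smooth compactly supported function is, on an interval `[-L, L]` containing its support, the
sum of a rapidly converging Fourier series, by Poisson summation. -/
theorem exists_fourier_series {g : ℝ → ℂ} (hg : ContDiff ℝ ∞ g) {L : ℝ} (hL : 0 < L)
    (hgL : tsupport g ⊆ Set.Icc (-L) L) :
    ∃ c : ℤ → ℂ, Summable (fun n : ℤ => ((n : ℝ) ^ 2 + 1) * ‖c n‖) ∧
      ∀ x ∈ Set.Icc (-L) L,
        g x = ∑' n : ℤ, c n * Complex.exp (Complex.I * ((Real.pi / (2 * L) * n * x : ℝ) : ℂ)) := by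
  have hL' : (4 * L) ≠ 0 := by positivity
  have hzero : ∀ y, y ∉ Set.Icc (-L) L → g y = 0 := fun y hy =>
    image_eq_zero_of_notMem_tsupport fun h => hy (hgL h)
  have hf : ContDiff ℝ ∞ fun x => g (4 * L * x) := by fun_prop
  have hfc : HasCompactSupport fun x => g (4 * L * x) := by
    refine HasCompactSupport.intro (K := Set.Icc (-1) 1) isCompact_Icc fun x hx => hzero _ ?_
    contrapose! hx
    constructor <;> nlinarith [hx.1, hx.2]
  set f : 𝓢(ℝ, ℂ) := hfc.toSchwartzMap hf with hfdef
  have hfx : ∀ x, f x = g (4 * L * x) := fun x => rfl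
  refine ⟨fun n => 𝓕 f (n : ℝ), ?_, ?_⟩
  · obtain ⟨C, hC⟩ := (𝓕 f).decay' 4 0
    have hs : Summable fun n : ℤ => 2 * C * (1 / (n : ℝ) ^ 2) :=
      (Real.summable_one_div_int_pow.2 one_lt_two).mul_left _
    refine Summable.of_norm_bounded_eventually hs ?_
    have : ({0} : Set ℤ).Finite := Set.finite_singleton 0
    filter_upwards [this.compl_mem_cofinite] with n hn
    have hn' : (1 : ℝ) ≤ (n : ℝ) ^ 2 := by
      have h1 : n ≠ 0 := by simpa using hn
      have : (1 : ℤ) ≤ n ^ 2 := by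
        have := sq_nonneg n
        have : n ^ 2 ≠ 0 := pow_ne_zero 2 h1
        omega
      exact_mod_cast this
    have h1 := hC (n : ℝ)
    rw [norm_iteratedFDeriv_zero, Real.norm_eq_abs] at h1
    change |(n : ℝ)| ^ 4 * ‖𝓕 f (n : ℝ)‖ ≤ C at h1
    have e4 : |(n : ℝ)| ^ 4 = (n : ℝ) ^ 2 * (n : ℝ) ^ 2 := by
      rw [← sq_abs (n : ℝ)]; ring
    rw [e4] at h1
    rw [Real.norm_eq_abs, abs_of_nonneg (by positivity), mul_one_div, le_div_iff₀ (by positivity)]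
    have := norm_nonneg (𝓕 f (n : ℝ))
    nlinarith [mul_nonneg this (show (0 : ℝ) ≤ (n : ℝ) ^ 2 by positivity)]
  · intro x hx
    have h := SchwartzMap.tsum_eq_tsum_fourier f (x / (4 * L))
    rw [tsum_eq_single 0] at h
    · rw [hfx] at h
      have e : 4 * L * (x / (4 * L) + ((0 : ℤ) : ℝ)) = x := by
        push_cast; field_simp; simp
      rw [e] at h
      rw [h]
      congr 1
      ext n
      rw [fourier_coe_apply]
      congr 2
      push_cast
      field_simp
      ring
    · intro n hn
      rw [hfx]
      apply hzero
      have e : 4 * L * (x / (4 * L) + (n : ℝ)) = x + 4 * L * n := by field_simp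
      rw [e]
      rintro ⟨h1, h2⟩
      obtain ⟨h3, h4⟩ := hx
      rcases lt_or_gt_of_ne hn with h5 | h5
      · have : (n : ℝ) ≤ -1 := by exact_mod_cast (by omega : n ≤ -1)
        nlinarith
      · have : (1 : ℝ) ≤ n := by exact_mod_cast (by omega : 1 ≤ n)
        nlinarith

/-- The unitary group of a self-adjoint operator. -/
theorem hasComm2_cfc_exp (s L c : ℝ) : ∃ C : ℝ, ∀ A : L2 →L[ℂ] L2, IsSelfAdjoint A → ‖A‖ ≤ L →
    HasComm2 A c → HasComm2 (cfc (fun z : ℂ => Complex.exp (Complex.I * ((s * z.re : ℝ) : ℂ))) A)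
      C := by
  refine ⟨(max 1 (|s| * c)) ^ 2 * Real.exp (4 * max 1 (|s| * L)), fun A hA hAL hAc => ?_⟩
  have hn : IsStarNormal A := hA.isStarNormal
  have hn' : IsStarNormal ((Complex.I * s) • A) := inferInstance
  have e : cfc (fun z : ℂ => Complex.exp (Complex.I * ((s * z.re : ℝ) : ℂ))) A =
      NormedSpace.exp ((Complex.I * s) • A) := by
    rw [← CFC.exp_eq_normedSpace_exp (𝕜 := ℂ) hn', ← Complex.exp_eq_exp_ℂ,
      ← cfc_comp_smul (Complex.I * (s : ℂ)) Complex.exp A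
        Complex.continuous_exp.continuousOn hn]
    apply cfc_congr
    intro z hz
    have := hA.mem_spectrum_eq_re hz
    simp only [smul_eq_mul]
    rw [this]
    push_cast
    simp [mul_assoc]
  rw [e]
  have hnorm : ‖Complex.I * (s : ℂ)‖ = |s| := by simp
  refine HasComm2.exp (le_max_left _ _) (le_max_left _ _) ((hAc.smul _).mono ?_) ?_
  · rw [hnorm]; exact le_max_right _ _
  · rw [norm_smul, hnorm]
    exact le_trans (by gcongr) (le_max_right _ _)

theorem cfc_exp_int (s L c : ℝ) : ∃ C : ℝ, 0 ≤ C ∧ ∀ A : L2 →L[ℂ] L2, IsSelfAdjoint A → ‖A‖ ≤ L →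
    HasComm2 A c → ∀ n : ℤ,
      HasComm2 (cfc (fun z : ℂ => Complex.exp (Complex.I * ((s * n * z.re : ℝ) : ℂ))) A)
      ((n : ℝ) ^ 2 * C) := by
  obtain ⟨C₁, h₁⟩ := hasComm2_cfc_exp s L c
  obtain ⟨C₂, h₂⟩ := hasComm2_cfc_exp (-s) L c
  refine ⟨(max 1 (max C₁ C₂)) ^ 2, by positivity, fun A hA hAL hAc n => ?_⟩
  have hn : IsStarNormal A := hA.isStarNormal
  have key : ∀ s' : ℝ, (HasComm2
      (cfc (fun z : ℂ => Complex.exp (Complex.I * ((s' * z.re : ℝ) : ℂ))) A) (max C₁ C₂)) →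
      ∀ k : ℕ, HasComm2 (cfc (fun z : ℂ => Complex.exp (Complex.I * ((s' * k * z.re : ℝ) : ℂ))) A)
        ((k : ℝ) ^ 2 * (max 1 (max C₁ C₂)) ^ 2) := by
    intro s' hs' k
    have e : cfc (fun z : ℂ => Complex.exp (Complex.I * ((s' * k * z.re : ℝ) : ℂ))) A =
        (cfc (fun z : ℂ => Complex.exp (Complex.I * ((s' * z.re : ℝ) : ℂ))) A) ^ k := by
      rw [← cfc_pow _ k A (by fun_prop) hn]
      congr 1
      ext z
      rw [← Complex.exp_nat_mul]
      congr 1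
      push_cast
      ring
    rw [e]
    have hnorm : ‖cfc (fun z : ℂ => Complex.exp (Complex.I * ((s' * z.re : ℝ) : ℂ))) A‖ ≤ 1 := by
      apply norm_cfc_le zero_le_one
      intro z _
      rw [mul_comm, Complex.norm_exp_ofReal_mul_I]
    simpa using (hs'.mono (le_max_right 1 _)).pow le_rfl (le_max_left _ _) hnorm k
  rcases Int.eq_nat_or_neg n with ⟨k, rfl | rfl⟩
  · have := key s ((h₁ A hA hAL hAc).mono (le_max_left _ _)) k
    simpa using this
  · have := key (-s) ((h₂ A hA hAL hAc).mono (le_max_right _ _)) k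
    simpa using this

/-- Smooth functions of a self-adjoint operator with two bounded commutators with `∂_y` have two
bounded commutators with `∂_y`, with bounds that are uniform in the operator. -/
theorem exists_hasComm2_cfc {g : ℝ → ℂ} (hg : ContDiff ℝ ∞ g) (hgc : HasCompactSupport g)
    (L c : ℝ) : ∃ C : ℝ, 0 ≤ C ∧ ∀ A : L2 →L[ℂ] L2, IsSelfAdjoint A → ‖A‖ ≤ L →
    HasComm2 A c → HasComm2 (cfc (fun z : ℂ => g z.re) A) C := by
  obtain ⟨L', hL', hgL', hLL'⟩ : ∃ L' : ℝ, 0 < L' ∧ tsupport g ⊆ Set.Icc (-L') L' ∧ L ≤ L' := by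
    obtain ⟨R, hR⟩ := hgc.isBounded.subset_closedBall 0
    refine ⟨max 1 (max R L), by positivity, hR.trans ?_, (le_max_right _ _).trans (le_max_right _ _)⟩
    rw [Real.closedBall_eq_Icc]
    have : R ≤ max 1 (max R L) := (le_max_left _ _).trans (le_max_right _ _)
    apply Set.Icc_subset_Icc <;> linarith
  obtain ⟨a, ha, hga⟩ := exists_fourier_series hg hL' hgL'
  obtain ⟨C, hC, hexp⟩ := cfc_exp_int (Real.pi / (2 * L')) L c
  have hs : Summable fun n : ℤ => ‖a n‖ * ((n : ℝ) ^ 2 * C) := by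
    refine Summable.of_nonneg_of_le (fun n => by positivity) (fun n => ?_) (ha.mul_right C)
    have := norm_nonneg (a n)
    nlinarith [mul_nonneg this hC]
  have hs' : Summable fun n : ℤ => ‖a n‖ := by
    refine Summable.of_nonneg_of_le (fun n => by positivity) (fun n => ?_) ha
    nlinarith [mul_nonneg (norm_nonneg (a n)) (sq_nonneg (n : ℝ))]
  refine ⟨_, tsum_nonneg fun n => by positivity, fun A hA hAL hAc => HasComm2.hasSum
    (A := fun n : ℤ => a n •
      cfc (fun z : ℂ => Complex.exp (Complex.I * ((Real.pi / (2 * L') * n * z.re : ℝ) : ℂ))) A)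
    (fun n => (hexp A hA hAL hAc n).smul (a n)) hs ?_⟩
  have hsp : ∀ z ∈ spectrum ℂ A, z.re ∈ Set.Icc (-L') L' := fun z hz => by
    have h1 := (Complex.abs_re_le_norm z).trans ((spectrum.norm_le_norm_mul_of_mem hz).trans
      ((mul_le_of_le_one_right (norm_nonneg _) ContinuousLinearMap.norm_id_le).trans
        (hAL.trans hLL')))
    exact abs_le.1 h1
  have e : cfc (fun z : ℂ => g z.re) A = cfc (fun z : ℂ => ∑' n : ℤ, a n *
      Complex.exp (Complex.I * ((Real.pi / (2 * L') * n * z.re : ℝ) : ℂ))) A :=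
    cfc_congr fun z hz => hga _ (hsp z hz)
  rw [e]
  have hu := tendstoUniformlyOn_tsum (f := fun (n : ℤ) (z : ℂ) => a n *
      Complex.exp (Complex.I * ((Real.pi / (2 * L') * n * z.re : ℝ) : ℂ))) hs'
      (s := spectrum ℂ A) (fun n z _ => by
        rw [norm_mul, mul_comm Complex.I, Complex.norm_exp_ofReal_mul_I, mul_one])
  have ht := tendsto_cfc_fun hu (Eventually.of_forall fun s => by fun_prop)
  refine ht.congr fun s => ?_
  have e2 : (fun z : ℂ => ∑ n ∈ s, a n *
      Complex.exp (Complex.I * ((Real.pi / (2 * L') * n * z.re : ℝ) : ℂ))) = ∑ n ∈ s,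
      fun z : ℂ => a n *
        Complex.exp (Complex.I * ((Real.pi / (2 * L') * n * z.re : ℝ) : ℂ)) := by
    ext z; simp
  rw [e2, cfc_sum _ A s (fun n _ => by fun_prop)]
  refine Finset.sum_congr rfl fun n _ => ?_
  rw [cfc_const_mul _ _ A (by fun_prop)]

/-! ### Compactness -/

/-- The exponential kernel `e^{-x} 1_{x > 0}`. -/
def expKernel (x : ℝ) : ℂ := (Set.Ioi 0).indicator (fun x : ℝ => (Real.exp (-x) : ℂ)) x

theorem memLp_expKernel : MemLp expKernel 2 (volume : Measure ℝ) := by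
  have hm : Measurable expKernel := by
    refine Measurable.indicator ?_ measurableSet_Ioi
    fun_prop
  rw [memLp_two_iff_integrable_sq_norm hm.aestronglyMeasurable]
  have h : Integrable (fun x : ℝ => (Set.Ioi (0 : ℝ)).indicator (fun x => Real.exp (-2 * x)) x)
      volume := by
    rw [integrable_indicator_iff measurableSet_Ioi]
    exact integrableOn_exp_mul_Ioi (by norm_num) 0
  refine h.congr (Eventually.of_forall fun x => ?_)
  by_cases hx : x ∈ Set.Ioi (0 : ℝ)
  · simp only [expKernel, Set.indicator_of_mem hx]
    rw [Complex.norm_real, Real.norm_eq_abs, abs_of_pos (Real.exp_pos _), ← Real.exp_nat_mul]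
    congr 1; push_cast; ring
  · simp [expKernel, Set.indicator_of_notMem hx]

/-- The kernel of the resolvent `J_1` at the point `y`, the function `e^{y-x} 1_{x > y}` of `x`. -/
def kernelAt (y : ℝ) : L2 :=
  Lp.compMeasurePreserving (· - y) (measurePreserving_sub_right volume y)
    (memLp_expKernel.toLp expKernel)

theorem coeFn_kernelAt (y : ℝ) : kernelAt y =ᵐ[volume] fun x => expKernel (x - y) := by
  have h1 := Lp.coeFn_compMeasurePreserving (memLp_expKernel.toLp expKernel)
    (measurePreserving_sub_right (volume : Measure ℝ) y)
  have h2 := (measurePreserving_sub_right (volume : Measure ℝ) y).quasiMeasurePreserving.ae_eq_comp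
    memLp_expKernel.coeFn_toLp
  exact h1.trans h2

theorem continuous_kernelAt : Continuous kernelAt := by
  have := Continuous.compMeasurePreservingLp (p := 2) (μ := (volume : Measure ℝ))
    (ν := (volume : Measure ℝ))
    (f := fun _ : ℝ => memLp_expKernel.toLp expKernel)
    (g := fun y : ℝ => (⟨fun x => x - y, by fun_prop⟩ : C(ℝ, ℝ)))
    continuous_const (ContinuousMap.continuous_of_continuous_uncurry _ (by
      simp only [Function.uncurry_def, ContinuousMap.coe_mk]; fun_prop))
    (fun y => measurePreserving_sub_right volume y) ENNReal.ofNat_ne_top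
  exact this

theorem inner_kernelAt (y : ℝ) (f : L2) :
    inner ℂ (kernelAt y) f = ∫ x in Set.Ioi y, (Real.exp (y - x) : ℂ) * f x := by
  rw [L2.inner_def, ← integral_indicator measurableSet_Ioi]
  apply integral_congr_ae
  filter_upwards [coeFn_kernelAt y] with x hx
  rw [hx, expKernel]
  by_cases h : y < x
  · have h' : x - y ∈ Set.Ioi (0 : ℝ) := by simpa using h
    rw [Set.indicator_of_mem (show x ∈ Set.Ioi y from h), Set.indicator_of_mem h']
    simp only [RCLike.inner_apply, Complex.conj_ofReal]
    rw [neg_sub, mul_comm]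
  · have h' : x - y ∉ Set.Ioi (0 : ℝ) := by simpa using h
    rw [Set.indicator_of_notMem (show x ∉ Set.Ioi y from h), Set.indicator_of_notMem h']
    simp

theorem hasTemperateGrowth_resSymbol : (resSymbol 1).HasTemperateGrowth := by
  have h : resSymbol 1 = fun ξ : ℝ => (1 + 2 * Real.pi * Complex.I * ξ) *
      (((1 + ‖(2 * Real.pi) • ξ‖ ^ 2) ^ (-1 : ℝ) : ℝ) : ℂ) := by
    ext ξ
    have h1 := resSymbol_den_ne 1 ξ
    have h2 : (1 + ((2 * Real.pi * ξ : ℝ) : ℂ) ^ 2) ≠ 0 := by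
      have : (0 : ℝ) < 1 + (2 * Real.pi * ξ) ^ 2 := by positivity
      exact_mod_cast this.ne'
    rw [resSymbol, Real.rpow_neg_one, Real.norm_eq_abs, sq_abs, smul_eq_mul]
    rw [div_eq_iff h1]
    push_cast at h2 ⊢
    rw [mul_right_comm, eq_mul_inv_iff_mul_eq₀ h2]
    linear_combination (4 * (Real.pi : ℂ) ^ 2 * ξ ^ 2) * Complex.I_sq
  rw [h]
  have h3 : (fun ξ : ℝ => ((1 + ‖ξ‖ ^ 2) ^ (-1 : ℝ) : ℝ)).HasTemperateGrowth := by fun_prop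
  have h4 : (fun ξ : ℝ => (2 * Real.pi) • ξ).HasTemperateGrowth := by fun_prop
  have h5 := h3.comp h4
  have h6 : (fun ξ : ℝ => (((1 + ‖(2 * Real.pi) • ξ‖ ^ 2) ^ (-1 : ℝ) : ℝ) : ℂ)).HasTemperateGrowth :=
    Function.HasTemperateGrowth.comp (g := fun x : ℝ => (x : ℂ)) (by fun_prop) h5
  refine Function.HasTemperateGrowth.mul ?_ h6
  fun_prop

/-- The resolvent preserves Schwartz functions. -/
theorem exists_schwartz_J (f : 𝓢(ℝ, ℂ)) : ∃ φ : 𝓢(ℝ, ℂ), J 1 (f.toLp 2) = φ.toLp 2 := by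
  refine ⟨SchwartzMap.fourierMultiplierCLM ℂ (resSymbol 1) f, ext_fourier ?_⟩
  rw [SchwartzMap.toLp_fourier_eq, SchwartzMap.fourierMultiplierCLM_apply,
    FourierTransform.fourier_fourierInv_eq]
  filter_upwards [coeFn_fourier_fmul (memLp_resSymbol 1) (f.toLp 2),
    (SchwartzMap.smulLeftCLM ℂ (resSymbol 1) (𝓕 f)).coeFn_toLp 2, (𝓕 f).coeFn_toLp 2]
    with ξ h1 h2 h3
  rw [J, h1, SchwartzMap.toLp_fourier_eq, h2, h3,
    SchwartzMap.smulLeftCLM_apply_apply hasTemperateGrowth_resSymbol, smul_eq_mul]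

theorem coeFn_J_schwartz (f : 𝓢(ℝ, ℂ)) :
    J 1 (f.toLp 2) =ᵐ[volume] fun y => inner ℂ (kernelAt y) (f.toLp 2 : L2) := by
  obtain ⟨φ, hφ⟩ := exists_schwartz_J f
  have e1 : (f.toLp 2 : L2) =
      (φ.toLp 2 : L2) - ((SchwartzMap.derivCLM ℂ ℂ φ).toLp 2 : L2) := by
    have := (hasWeakDeriv_J one_ne_zero (f.toLp 2 : L2))
    rw [hφ] at this
    rw [(hasWeakDeriv_toLp φ).unique this]
    simp
  have e2 : ∀ y, inner ℂ (kernelAt y) (f.toLp 2 : L2) = φ y := by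
    intro y
    have hd : ∀ x : ℝ, HasDerivAt φ (SchwartzMap.derivCLM ℂ ℂ φ x) x := fun x => by
      simpa using φ.differentiableAt.hasDerivAt
    have hexp : ∀ x : ℝ, HasDerivAt (fun x => (Real.exp (y - x) : ℂ)) (-Real.exp (y - x) : ℂ) x := by
      intro x
      have := (((hasDerivAt_id x).const_sub y).exp).ofReal_comp
      simpa using this
    have hint : IntegrableOn (fun x => (Real.exp (y - x) : ℂ) *
        (φ x - SchwartzMap.derivCLM ℂ ℂ φ x)) (Set.Ioi y) := by
      have h1 : Integrable (fun x => φ x - SchwartzMap.derivCLM ℂ ℂ φ x) volume :=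
        φ.integrable.sub (SchwartzMap.derivCLM ℂ ℂ φ).integrable
      refine h1.integrableOn.bdd_mul (c := 1) (by fun_prop) ?_
      refine (ae_restrict_iff' measurableSet_Ioi).2 (Eventually.of_forall fun x hx => ?_)
      rw [Complex.norm_real, Real.norm_eq_abs, abs_of_pos (Real.exp_pos _)]
      exact Real.exp_le_one_iff.2 (by linarith [show y < x from hx])
    have hlim : Tendsto (fun x => -((Real.exp (y - x) : ℂ) * φ x)) atTop (𝓝 0) := by
      have h1 : Tendsto φ atTop (𝓝 0) := φ.toZeroAtInfty.zero_at_infty'.mono_left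
        atTop_le_cocompact
      have h2 : Tendsto (fun x : ℝ => (Real.exp (y - x) : ℂ)) atTop (𝓝 0) := by
        rw [← Complex.ofReal_zero]
        refine (Complex.continuous_ofReal.tendsto 0).comp (Real.tendsto_exp_atBot.comp ?_)
        exact tendsto_atBot_add_const_left _ y tendsto_neg_atTop_atBot
      simpa using (h2.mul h1).neg
    have := integral_Ioi_of_hasDerivAt_of_tendsto' (a := y)
      (f := fun x => -((Real.exp (y - x) : ℂ) * φ x)) (f' := fun x => (Real.exp (y - x) : ℂ) *
        (φ x - SchwartzMap.derivCLM ℂ ℂ φ x)) (fun x _ => by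
          have := ((hexp x).mul (hd x)).neg
          convert! this using 1
          ring) hint hlim
    rw [inner_kernelAt]
    simp only [sub_self, Real.exp_zero, Complex.ofReal_one, one_mul, sub_neg_eq_add,
      zero_add] at this
    rw [← this]
    apply integral_congr_ae
    refine ae_restrict_of_ae ?_
    rw [e1]
    filter_upwards [Lp.coeFn_sub (φ.toLp 2 : L2) ((SchwartzMap.derivCLM ℂ ℂ φ).toLp 2 : L2),
      φ.coeFn_toLp 2, (SchwartzMap.derivCLM ℂ ℂ φ).coeFn_toLp 2] with x h1 h2 h3
    rw [h1, Pi.sub_apply, h2, h3]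
  rw [hφ]
  filter_upwards [φ.coeFn_toLp 2] with y hy
  rw [hy, e2]

/-- Pointwise representation of the resolvent. -/
theorem coeFn_J (f : L2) : J 1 f =ᵐ[volume] fun y => inner ℂ (kernelAt y) f := by
  obtain ⟨u, hu, hlim⟩ := mem_closure_iff_seq_limit.1 (dense_toLp f)
  choose φ hφ using hu
  have h1 : Tendsto (fun n => J 1 (u n)) atTop (𝓝 (J 1 f)) :=
    ((J 1).continuous.tendsto _).comp hlim
  obtain ⟨ns, hns, hae⟩ := (tendstoInMeasure_of_tendsto_Lp h1).exists_seq_tendsto_ae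
  have h2 : ∀ᵐ y, ∀ n, J 1 (u n) y = inner ℂ (kernelAt y) (u n) := by
    rw [ae_all_iff]
    intro n
    rw [← hφ n]
    exact coeFn_J_schwartz (φ n)
  filter_upwards [hae, h2] with y h3 h4
  refine tendsto_nhds_unique h3 ?_
  simp only [h4]
  exact (Filter.Tendsto.inner tendsto_const_nhds hlim).comp hns.tendsto_atTop

/-- An injective symmetric operator controls uniformly all the functionals in a compact set, up to
an arbitrarily small multiple of the norm, since its range is dense. -/
theorem exists_bound_of_isCompact {X : L2 →L[ℂ] L2} (hX : (X : L2 →ₗ[ℂ] L2).IsSymmetric)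
    (hinj : ∀ f, X f = 0 → f = 0) {C : Set L2} (hC : IsCompact C) {η : ℝ} (hη : 0 < η) :
    ∃ M : ℝ, 0 ≤ M ∧ ∀ x ∈ C, ∀ f : L2, ‖(inner ℂ x f : ℂ)‖ ≤ η * ‖f‖ + M * ‖X f‖ := by
  have hdense : DenseRange X := by
    have h1 : X.adjoint = X := (ContinuousLinearMap.isSelfAdjoint_iff_isSymmetric.2 hX).adjoint_eq
    have h2 := X.orthogonal_range
    rw [h1, LinearMap.ker_eq_bot'.2 (fun f hf => hinj f hf),
      ← Submodule.topologicalClosure_eq_top_iff] at h2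
    have := Submodule.dense_iff_topologicalClosure_eq_top.2 h2
    exact this
  refine hC.induction_on (p := fun C => ∃ M : ℝ, 0 ≤ M ∧
    ∀ x ∈ C, ∀ f : L2, ‖(inner ℂ x f : ℂ)‖ ≤ η * ‖f‖ + M * ‖X f‖) ?_ ?_ ?_ ?_
  · exact ⟨0, le_rfl, by simp⟩
  · intro s t hst ht
    obtain ⟨M, hM, h⟩ := ht
    exact ⟨M, hM, fun x hx => h x (hst hx)⟩
  · intro s t hs ht
    obtain ⟨M, hM, h⟩ := hs
    obtain ⟨M', hM', h'⟩ := ht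
    refine ⟨max M M', by positivity, fun x hx f => ?_⟩
    rcases hx with hx | hx
    · exact (h x hx f).trans (by gcongr; exact le_max_left _ _)
    · exact (h' x hx f).trans (by gcongr; exact le_max_right _ _)
  · intro x hx
    obtain ⟨z, hz⟩ := Metric.denseRange_iff.1 hdense x (η / 2) (by positivity)
    refine ⟨Metric.ball x (η / 2), mem_nhdsWithin_of_mem_nhds (Metric.ball_mem_nhds x
      (by positivity)), ‖z‖, norm_nonneg _, fun y hy f => ?_⟩
    have e : inner ℂ y f = inner ℂ (y - X z) f + inner ℂ z (X f) := by
      rw [show inner ℂ z (X f) = inner ℂ (X z) f from (hX z f).symm, ← inner_add_left]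
      simp
    have hy' : ‖y - X z‖ ≤ η := by
      rw [← dist_eq_norm]
      have := dist_triangle y x (X z)
      rw [Metric.mem_ball] at hy
      linarith
    rw [e]
    calc _ ≤ ‖inner ℂ (y - X z) f‖ + ‖inner ℂ z (X f)‖ := norm_add_le _ _
      _ ≤ ‖y - X z‖ * ‖f‖ + ‖z‖ * ‖X f‖ := by gcongr <;> exact norm_inner_le_norm _ _
      _ ≤ _ := by gcongr

/-- Quantitative compactness of `m B`, for a function `m` vanishing at infinity and an operator `B`
with values in `H¹`: the norm of `m B f` is controlled by that of `X f`, for an arbitrary injective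
symmetric operator `X`, up to an arbitrarily small multiple of `‖f‖`. -/
theorem exists_bound_mulOp_comp {m : ℝ → ℝ} (hm : Continuous m) {κ : ℝ} (hκ : ∀ y, |m y| ≤ κ)
    (hlim : Tendsto m (cocompact ℝ) (𝓝 0)) {B B' : L2 →L[ℂ] L2}
    (hB : ∀ f, HasWeakDeriv (B f) (B' f)) {X : L2 →L[ℂ] L2} (hX : (X : L2 →ₗ[ℂ] L2).IsSymmetric)
    (hinj : ∀ f, X f = 0 → f = 0) {η : ℝ} (hη : 0 < η) :
    ∃ M : ℝ, 0 ≤ M ∧ ∀ f, ‖mulOp m (B f)‖ ≤ η * ‖f‖ + M * ‖X f‖ := by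
  have hκ0 : 0 ≤ κ := (abs_nonneg _).trans (hκ 0)
  -- outside a compact interval, `m` is small
  obtain ⟨R, hR, hmR⟩ : ∃ R : ℝ, 0 < R ∧ ∀ y, y ∉ Set.Icc (-R) R →
      |m y| ≤ η / (2 * (‖B‖ + 1)) := by
    have h1 : ∀ᶠ y in cocompact ℝ, |m y| < η / (2 * (‖B‖ + 1)) := by
      have := hlim.abs
      rw [abs_zero] at this
      exact this.eventually (gt_mem_nhds (by positivity))
    obtain ⟨K, hK, hK'⟩ := mem_cocompact.1 h1
    obtain ⟨R, hR⟩ := hK.isBounded.subset_closedBall 0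
    refine ⟨max R 1, by positivity, fun y hy => le_of_lt (hK' fun hyK => hy ?_)⟩
    have := hR hyK
    rw [Real.closedBall_eq_Icc] at this
    have h2 : R ≤ max R 1 := le_max_left _ _
    constructor <;> linarith [this.1, this.2]
  set I : Set ℝ := Set.Icc (-R) R with hI
  have hIm : MeasurableSet I := measurableSet_Icc
  have hIvol : volume I ≠ ⊤ := by simp [hI]
  set s : ℝ := (volume I).toReal ^ (1 / 2 : ℝ) with hs
  have hs0 : 0 ≤ s := by positivity
  -- the kernels of `B` at the points of the interval form a compact set
  have hcomp : IsCompact ((fun y => (B - B').adjoint (kernelAt y)) '' I) :=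
    isCompact_Icc.image ((B - B').adjoint.continuous.comp continuous_kernelAt)
  obtain ⟨M, hM0, hM⟩ := exists_bound_of_isCompact hX hinj hcomp
    (η := η / (2 * (κ * s + 1))) (by positivity)
  refine ⟨κ * s * M, by positivity, fun f => ?_⟩
  have hpt : ∀ᵐ y, B f y = inner ℂ ((B - B').adjoint (kernelAt y)) f := by
    have h1 := coeFn_J (B f - B' f)
    rw [hasWeakDeriv_iff_J.1 (hB f)] at h1
    filter_upwards [h1] with y hy
    rw [hy, ContinuousLinearMap.adjoint_inner_left]
    rfl
  have hmeas : Measurable fun y => (m y : ℂ) := by fun_prop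
  set t : ℝ := κ * (η / (2 * (κ * s + 1)) * ‖f‖ + M * ‖X f‖) with ht
  have ht0 : 0 ≤ t := by positivity
  have h1 : ∀ᵐ y, ‖(mulOp m (B f)) y‖ ≤
      ‖(η / (2 * (‖B‖ + 1))) * ‖B f y‖ + I.indicator (fun _ => t) y‖ := by
    filter_upwards [hpt, coeFn_mulOp hm hκ (B f)] with y h2 h3
    rw [h3, norm_mul, Complex.norm_real, Real.norm_eq_abs]
    rw [Real.norm_eq_abs, abs_of_nonneg (add_nonneg (by positivity)
      (Set.indicator_nonneg (fun _ _ => ht0) y))]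
    by_cases hy : y ∈ I
    · rw [Set.indicator_of_mem hy]
      have h4 : |m y| * ‖B f y‖ ≤ t := by
        rw [h2, ht]
        exact mul_le_mul (hκ y) (hM _ (Set.mem_image_of_mem _ hy) f) (norm_nonneg _) hκ0
      have : 0 ≤ η / (2 * (‖B‖ + 1)) * ‖B f y‖ := by positivity
      linarith
    · rw [Set.indicator_of_notMem hy, add_zero]
      gcongr
      exact hmR y hy
  set g : Lp ℝ 2 (volume : Measure ℝ) := (η / (2 * (‖B‖ + 1))) • (Lp.memLp (B f)).norm.toLp _ +
    indicatorConstLp 2 hIm hIvol t with hg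
  have h2 : ‖mulOp m (B f)‖ ≤ ‖g‖ := by
    apply Lp.norm_le_norm_of_ae_le
    filter_upwards [h1, Lp.coeFn_add ((η / (2 * (‖B‖ + 1))) • (Lp.memLp (B f)).norm.toLp _)
      (indicatorConstLp 2 hIm hIvol t), Lp.coeFn_smul (η / (2 * (‖B‖ + 1)))
      ((Lp.memLp (B f)).norm.toLp _), (Lp.memLp (B f)).norm.coeFn_toLp,
      indicatorConstLp_coeFn (p := 2) (hs := hIm) (hμs := hIvol) (c := t)] with y k1 k2 k3 k4 k5
    rw [hg, k2, Pi.add_apply, k3, Pi.smul_apply, k4, k5]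
    exact k1
  have h3 : ‖(Lp.memLp (B f)).norm.toLp _‖ = ‖B f‖ := by
    rw [Lp.norm_toLp, eLpNorm_norm, Lp.norm_def]
  have h4 : ‖indicatorConstLp 2 hIm hIvol t‖ = t * s := by
    rw [norm_indicatorConstLp (by norm_num) (by norm_num), Real.norm_eq_abs, abs_of_nonneg ht0]
    simp [hs, Measure.real]
  have h5 : η / (2 * (‖B‖ + 1)) * ‖B f‖ ≤ η / 2 * ‖f‖ := by
    have : ‖B f‖ ≤ (‖B‖ + 1) * ‖f‖ := (B.le_opNorm f).trans (by gcongr; linarith)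
    calc _ ≤ η / (2 * (‖B‖ + 1)) * ((‖B‖ + 1) * ‖f‖) := by gcongr
      _ = _ := by field_simp
  have h6 : κ * s * (η / (2 * (κ * s + 1))) ≤ η / 2 := by
    have : 0 ≤ κ * s := by positivity
    rw [mul_div_assoc', div_le_div_iff₀ (by positivity) (by positivity)]
    nlinarith
  calc _ ≤ ‖g‖ := h2
    _ ≤ η / (2 * (‖B‖ + 1)) * ‖B f‖ + t * s := by
      refine (norm_add_le _ _).trans ?_
      rw [norm_smul, h3, h4, Real.norm_eq_abs, abs_of_pos (by positivity)]
    _ ≤ η / 2 * ‖f‖ + (κ * s * (η / (2 * (κ * s + 1))) * ‖f‖ + κ * s * M * ‖X f‖) := by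
      rw [ht]
      refine add_le_add h5 (le_of_eq ?_)
      ring
    _ ≤ η / 2 * ‖f‖ + (η / 2 * ‖f‖ + κ * s * M * ‖X f‖) := by gcongr
    _ = _ := by ring

/-! ### Regularity of the flow -/

theorem hasDerivAt_integral_pow_mul {f : ℝ → ℝ} (hf : ContDiff ℝ ∞ f) (y₀ : ℝ) (k : ℕ) (y : ℝ) :
    HasDerivAt (fun y => ∫ s in (0 : ℝ)..1, s ^ k * f (y₀ + s * (y - y₀)))
      (∫ s in (0 : ℝ)..1, s ^ (k + 1) * deriv f (y₀ + s * (y - y₀))) y := by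
  have hf' : Continuous (deriv f) := hf.continuous_deriv (by norm_num)
  obtain ⟨C, hC⟩ : ∃ C, ∀ x ∈ Metric.closedBall y 1, ∀ s ∈ Set.Icc (0 : ℝ) 1,
      ‖s ^ (k + 1) * deriv f (y₀ + s * (x - y₀))‖ ≤ C := by
    have hK : IsCompact (Metric.closedBall y 1 ×ˢ Set.Icc (0 : ℝ) 1) :=
      (isCompact_closedBall y 1).prod isCompact_Icc
    obtain ⟨C, hC⟩ := hK.exists_bound_of_continuousOn
      (f := fun p : ℝ × ℝ => p.2 ^ (k + 1) * deriv f (y₀ + p.2 * (p.1 - y₀))) (by fun_prop)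
    exact ⟨C, fun x hx s hs => hC (x, s) ⟨hx, hs⟩⟩
  refine (intervalIntegral.hasDerivAt_integral_of_dominated_loc_of_deriv_le (bound := fun _ => C)
    (F' := fun x s => s ^ (k + 1) * deriv f (y₀ + s * (x - y₀)))
    (Metric.ball_mem_nhds y one_pos) (Eventually.of_forall fun x => ?_) ?_ ?_ ?_ ?_ ?_).2
  · exact Continuous.aestronglyMeasurable (by have := hf.continuous; fun_prop)
  · exact Continuous.intervalIntegrable (by have := hf.continuous; fun_prop) _ _
  · exact Continuous.aestronglyMeasurable (by fun_prop)
  · refine Eventually.of_forall fun s hs x hx => hC x (Metric.ball_subset_closedBall hx) s ?_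
    rw [Set.uIoc_of_le zero_le_one] at hs
    exact ⟨hs.1.le, hs.2⟩
  · exact intervalIntegrable_const
  · refine Eventually.of_forall fun s _ x _ => ?_
    have h1 : HasDerivAt (fun x => y₀ + s * (x - y₀)) s x := by
      simpa using (((hasDerivAt_id x).sub_const y₀).const_mul s).const_add y₀
    have h2 : HasDerivAt f (deriv f (y₀ + s * (x - y₀))) (y₀ + s * (x - y₀)) :=
      (hf.differentiable (by norm_num) _).hasDerivAt
    have := (h2.comp x h1).const_mul (s ^ k)
    convert! this using 1
    ring

theorem contDiff_integral_pow_mul {f : ℝ → ℝ} (hf : ContDiff ℝ ∞ f) (y₀ : ℝ) (k : ℕ) :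
    ContDiff ℝ ∞ fun y => ∫ s in (0 : ℝ)..1, s ^ k * f (y₀ + s * (y - y₀)) := by
  rw [contDiff_infty]
  intro n
  induction n generalizing k f with
  | zero =>
    have : Differentiable ℝ fun y => ∫ s in (0 : ℝ)..1, s ^ k * f (y₀ + s * (y - y₀)) :=
      fun y => (hasDerivAt_integral_pow_mul hf y₀ k y).differentiableAt
    exact contDiff_zero.2 this.continuous
  | succ n ih =>
    push_cast
    rw [contDiff_succ_iff_deriv]
    refine ⟨fun y => (hasDerivAt_integral_pow_mul hf y₀ k y).differentiableAt, by simp, ?_⟩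
    have e : deriv (fun y => ∫ s in (0 : ℝ)..1, s ^ k * f (y₀ + s * (y - y₀))) =
        fun y => ∫ s in (0 : ℝ)..1, s ^ (k + 1) * deriv f (y₀ + s * (y - y₀)) :=
      funext fun y => (hasDerivAt_integral_pow_mul hf y₀ k y).deriv
    rw [e]
    exact ih (hf.deriv' ) (k + 1)

/-- Hadamard's lemma: a smooth function vanishing at `y₀` is divisible by `y - y₀`. -/
theorem exists_contDiff_eq_sub_mul {f : ℝ → ℝ} (hf : ContDiff ℝ ∞ f) {y₀ : ℝ} (h₀ : f y₀ = 0) :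
    ∃ q : ℝ → ℝ, ContDiff ℝ ∞ q ∧ (∀ y, f y = (y - y₀) * q y) ∧ q y₀ = deriv f y₀ := by
  refine ⟨_, contDiff_integral_pow_mul (hf.deriv') y₀ 0, fun y => ?_, by simp⟩
  have hd : ∀ s ∈ Set.uIcc (0 : ℝ) 1, HasDerivAt (fun s => f (y₀ + s * (y - y₀)))
      (deriv f (y₀ + s * (y - y₀)) * (y - y₀)) s := fun s _ => by
    have h1 : HasDerivAt (fun s => y₀ + s * (y - y₀)) (y - y₀) s := by
      simpa using ((hasDerivAt_id s).mul_const (y - y₀)).const_add y₀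
    exact (hf.differentiable (by norm_num) _).hasDerivAt.comp s h1
  have hf' : Continuous (deriv f) := hf.continuous_deriv (by norm_num)
  have := intervalIntegral.integral_eq_sub_of_hasDerivAt hd
    (Continuous.intervalIntegrable (by fun_prop) _ _)
  rw [intervalIntegral.integral_mul_const] at this
  simp only [pow_zero, one_mul]
  rw [mul_comm, this]
  simp [h₀]

/-- `m` is smooth, also at the zero of `U`. -/
theorem IsMixingLayer.contDiff_m {U m : ℝ → ℝ} {Um Up : ℝ} (h : IsMixingLayer U m Um Up) :
    ContDiff ℝ ∞ m := by
  have hU2 : ContDiff ℝ ∞ (iteratedDeriv 2 U) := by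
    rw [iteratedDeriv_succ, iteratedDeriv_one]
    exact h.smooth.deriv'.deriv'
  rw [contDiff_iff_contDiffAt]
  intro y₀
  -- near every point, `m ^ 2` is a quotient of smooth functions
  have key : ∃ p q : ℝ → ℝ, ContDiff ℝ ∞ p ∧ ContDiff ℝ ∞ q ∧ q y₀ ≠ 0 ∧
      ∀ y, p y = m y ^ 2 * q y := by
    by_cases h0 : U y₀ = 0
    · obtain ⟨q, hq, hqU, hq0⟩ := exists_contDiff_eq_sub_mul h.smooth h0
      obtain ⟨p, hp, hpU, -⟩ := exists_contDiff_eq_sub_mul hU2 (y₀ := y₀) (by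
        rw [h.iteratedDeriv_two, h0, mul_zero])
      refine ⟨fun y => -p y, q, hp.neg, hq, by rw [hq0]; exact (h.deriv_pos y₀).ne', ?_⟩
      have hne : ∀ y ∈ ({y₀}ᶜ : Set ℝ), -p y = m y ^ 2 * q y := by
        intro y hy
        have e := h.iteratedDeriv_two y
        rw [hpU, hqU] at e
        have hy' : y - y₀ ≠ 0 := sub_ne_zero.2 hy
        apply mul_left_cancel₀ hy'
        linear_combination -e
      have := Continuous.ext_on (dense_compl_singleton y₀) hp.continuous.neg
        ((h.continuous_m.pow 2).mul hq.continuous) hne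
      exact fun y => congrFun this y
    · exact ⟨fun y => -iteratedDeriv 2 U y, U, hU2.neg, h.smooth, h0, fun y => by
        simp only [h.iteratedDeriv_two]; ring⟩
  obtain ⟨p, q, hp, hq, hq0, hpq⟩ := key
  have h1 : ContDiffAt ℝ ∞ (fun y => p y / q y) y₀ := hp.contDiffAt.div hq.contDiffAt hq0
  have h2 : (fun y => p y / q y) y₀ ≠ 0 := by
    simp only [hpq, mul_div_assoc, div_self hq0]
    have := h.m_pos y₀
    positivity
  refine (h1.sqrt h2).congr_of_eventuallyEq ?_
  filter_upwards [hq.continuous.continuousAt.eventually_ne hq0] with y hy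
  rw [hpq, mul_div_assoc, div_self hy, mul_one, Real.sqrt_sq (h.m_pos y).le]

/-- The properties of the flow used below: the derivatives `U₁`, `U₂` of `U` and `m₁`, `m₂` of `m`,
with a common bound `κ`. -/
structure Flow (U U₁ U₂ m m₁ m₂ : ℝ → ℝ) (κ : ℝ) : Prop where
  one_le : 1 ≤ κ
  hasDerivAt_U : ∀ y, HasDerivAt U (U₁ y) y
  hasDerivAt_U₁ : ∀ y, HasDerivAt U₁ (U₂ y) y
  hasDerivAt_m : ∀ y, HasDerivAt m (m₁ y) y
  hasDerivAt_m₁ : ∀ y, HasDerivAt m₁ (m₂ y) y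
  cont_U₂ : Continuous U₂
  cont_m₂ : Continuous m₂
  U_le : ∀ y, |U y| ≤ κ
  U₁_le : ∀ y, |U₁ y| ≤ κ
  U₂_le : ∀ y, |U₂ y| ≤ κ
  m_le : ∀ y, |m y| ≤ κ
  m₁_le : ∀ y, |m₁ y| ≤ κ * m y
  m₂_le : ∀ y, |m₂ y| ≤ κ * m y
  U₁_pos : ∀ y, 0 < U₁ y
  m_pos : ∀ y, 0 < m y
  U₂_eq : ∀ y, U₂ y = -(m y) ^ 2 * U y
  tendsto_m : Tendsto m (cocompact ℝ) (𝓝 0)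

namespace Flow

variable {U U₁ U₂ m m₁ m₂ : ℝ → ℝ} {κ : ℝ} (h : Flow U U₁ U₂ m m₁ m₂ κ)

theorem cont_U (h : Flow U U₁ U₂ m m₁ m₂ κ) : Continuous U :=
  continuous_iff_continuousAt.2 fun y => (h.hasDerivAt_U y).continuousAt

theorem cont_U₁ (h : Flow U U₁ U₂ m m₁ m₂ κ) : Continuous U₁ :=
  continuous_iff_continuousAt.2 fun y => (h.hasDerivAt_U₁ y).continuousAt

theorem cont_m (h : Flow U U₁ U₂ m m₁ m₂ κ) : Continuous m :=
  continuous_iff_continuousAt.2 fun y => (h.hasDerivAt_m y).continuousAt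

theorem cont_m₁ (h : Flow U U₁ U₂ m m₁ m₂ κ) : Continuous m₁ :=
  continuous_iff_continuousAt.2 fun y => (h.hasDerivAt_m₁ y).continuousAt

theorem m_le_self (h : Flow U U₁ U₂ m m₁ m₂ κ) (y : ℝ) : m y ≤ κ :=
  (le_abs_self _).trans (h.m_le y)

theorem m₁_le_sq (h : Flow U U₁ U₂ m m₁ m₂ κ) (y : ℝ) : |m₁ y| ≤ κ * κ :=
  (h.m₁_le y).trans (mul_le_mul_of_nonneg_left (h.m_le_self y) (by linarith [h.one_le]))

theorem m₂_le_sq (h : Flow U U₁ U₂ m m₁ m₂ κ) (y : ℝ) : |m₂ y| ≤ κ * κ :=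
  (h.m₂_le y).trans (mul_le_mul_of_nonneg_left (h.m_le_self y) (by linarith [h.one_le]))

theorem strictMono (h : Flow U U₁ U₂ m m₁ m₂ κ) : StrictMono U :=
  strictMono_of_hasDerivAt_pos h.hasDerivAt_U h.U₁_pos

end Flow

theorem IsMixingLayer.mem_Ioo {U m : ℝ → ℝ} {Um Up : ℝ} (h : IsMixingLayer U m Um Up) (y : ℝ) :
    U y ∈ Set.Ioo Um Up := by
  have hmono : StrictMono U := strictMono_of_deriv_pos h.deriv_pos
  constructor
  · exact (hmono.monotone.le_of_tendsto h.tendsto_atBot (y - 1)).trans_lt (hmono (by linarith))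
  · exact (hmono (by linarith : y < y + 1)).trans_le (hmono.monotone.ge_of_tendsto h.tendsto_atTop _)

/-- Since `U` is bounded and `U'' = -m² U`, so is `U''`, and the mean value theorem on intervals of
length one bounds `U'`. -/
theorem exists_flow {U m : ℝ → ℝ} {Um Up : ℝ} (hU : IsMixingLayer U m Um Up)
    (hm : HasDecay U m Um Up) :
    ∃ κ : ℝ, Flow U (deriv U) (deriv (deriv U)) m (deriv m) (deriv (deriv m)) κ := by
  have hms := hU.contDiff_m
  obtain ⟨C₁, hC₁, h₁⟩ := hm.iteratedDeriv_le 1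
  obtain ⟨C₂, hC₂, h₂⟩ := hm.iteratedDeriv_le 2
  rw [iteratedDeriv_one] at h₁
  have e2 : ∀ f : ℝ → ℝ, iteratedDeriv 2 f = deriv (deriv f) := fun f => by
    rw [iteratedDeriv_succ, iteratedDeriv_one]
  rw [e2] at h₂
  have hU2 := hU.iteratedDeriv_two
  rw [e2] at hU2
  obtain ⟨C₃, h₃⟩ : ∃ C, ∀ y, |m y| ≤ C := by
    let f : ZeroAtInftyContinuousMap ℝ ℝ := ⟨⟨m, hU.continuous_m⟩, hm.tendsto_m⟩
    exact ⟨‖f.toBCF‖, fun y => f.toBCF.norm_coe_le_norm y⟩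
  obtain ⟨C₄, h₄⟩ : ∃ C, ∀ y, |U y| ≤ C := ⟨max |Um| |Up|, fun y =>
    abs_le_max_abs_abs (hU.mem_Ioo y).1.le (hU.mem_Ioo y).2.le⟩
  have h₅ : ∀ y, |deriv (deriv U) y| ≤ C₃ ^ 2 * C₄ := fun y => by
    rw [hU2, abs_mul, abs_neg, abs_pow]
    have := abs_nonneg (m y)
    have := abs_nonneg (U y)
    exact mul_le_mul (by gcongr; exact h₃ y) (h₄ y) this (by positivity)
  have hd1 : ∀ y, HasDerivAt U (deriv U y) y := fun y =>
    (hU.smooth.differentiable (by norm_num) y).hasDerivAt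
  have hU1s : ContDiff ℝ ∞ (deriv U) := hU.smooth.deriv'
  have hm1s : ContDiff ℝ ∞ (deriv m) := hms.deriv'
  have hd2 : ∀ y, HasDerivAt (deriv U) (deriv (deriv U) y) y := fun y =>
    (hU1s.differentiable (by norm_num) y).hasDerivAt
  have h₆ : ∀ y, |deriv U y| ≤ 2 * C₄ + C₃ ^ 2 * C₄ := fun y => by
    obtain ⟨z, hz, hz'⟩ := exists_hasDerivAt_eq_slope U (deriv U) (show y < y + 1 by linarith)
      hU.smooth.continuous.continuousOn (fun x _ => hd1 x)
    have h7 : |deriv U z| ≤ 2 * C₄ := by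
      rw [hz', add_sub_cancel_left, div_one]
      calc _ ≤ |U (y + 1)| + |U y| := abs_sub _ _
        _ ≤ _ := by linarith [h₄ y, h₄ (y + 1)]
    have h8 := Convex.norm_image_sub_le_of_norm_hasDerivWithin_le (f := deriv U)
      (f' := deriv (deriv U)) (s := Set.univ) (C := C₃ ^ 2 * C₄)
      (fun x _ => (hd2 x).hasDerivWithinAt) (fun x _ => h₅ x) convex_univ (Set.mem_univ z)
      (Set.mem_univ y)
    have h9 : ‖y - z‖ ≤ 1 := by
      rw [Real.norm_eq_abs, abs_le]
      constructor <;> linarith [hz.1, hz.2]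
    have h10 : 0 ≤ C₃ ^ 2 * C₄ := (abs_nonneg _).trans (h₅ y)
    have h11 : |deriv U y - deriv U z| ≤ C₃ ^ 2 * C₄ :=
      h8.trans (mul_le_of_le_one_right h10 h9)
    have := abs_sub_abs_le_abs_sub (deriv U y) (deriv U z)
    linarith
  have hC₄ : 0 ≤ C₄ := (abs_nonneg _).trans (h₄ 0)
  have hC₃ : 0 ≤ C₃ := (abs_nonneg _).trans (h₃ 0)
  have hp : 0 ≤ C₃ ^ 2 * C₄ := by positivity
  refine ⟨1 + C₁ + C₂ + C₃ + 2 * C₄ + C₃ ^ 2 * C₄, ?_⟩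
  constructor
  · linarith
  · exact hd1
  · exact hd2
  · exact fun y => (hms.differentiable (by norm_num) y).hasDerivAt
  · exact fun y => (hm1s.differentiable (by norm_num) y).hasDerivAt
  · exact hU1s.continuous_deriv (by norm_num)
  · exact hm1s.continuous_deriv (by norm_num)
  · exact fun y => (h₄ y).trans (by linarith)
  · exact fun y => (h₆ y).trans (by linarith)
  · exact fun y => (h₅ y).trans (by linarith)
  · exact fun y => (h₃ y).trans (by linarith)
  · exact fun y => (h₁ y).trans (mul_le_mul_of_nonneg_right (by linarith) (hU.m_pos y).le)
  · exact fun y => (h₂ y).trans (mul_le_mul_of_nonneg_right (by linarith) (hU.m_pos y).le)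
  · exact hU.deriv_pos
  · exact hU.m_pos
  · exact hU2
  · exact hm.tendsto_m

/-! ### The resolvent of the Laplacian -/

/-- The symbol `1 / ((2πξ)² + μ)` of `(μ - ∂_y²)⁻¹`. -/
def greenSymbol (μ ξ : ℝ) : ℝ := 1 / ((2 * Real.pi * ξ) ^ 2 + μ)

/-- The operator `G_μ = (μ - ∂_y²)⁻¹` for `μ > 0`, as a Fourier multiplier. -/
def green (μ : ℝ) : L2 →L[ℂ] L2 := fmul fun ξ => (greenSymbol μ ξ : ℂ)

/-- The operator `∂_y (μ - ∂_y²)⁻¹`. -/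
def greenDeriv (μ : ℝ) : L2 →L[ℂ] L2 :=
  fmul fun ξ : ℝ => 2 * Real.pi * Complex.I * ξ * (greenSymbol μ ξ : ℂ)

section Green

variable {μ : ℝ}

theorem green_den_pos (hμ : 0 < μ) (ξ : ℝ) : 0 < (2 * Real.pi * ξ) ^ 2 + μ := by positivity

theorem continuous_greenSymbol (hμ : 0 < μ) : Continuous (greenSymbol μ) := by
  unfold greenSymbol
  exact continuous_const.div (by fun_prop) fun ξ => (green_den_pos hμ ξ).ne'

theorem greenSymbol_nonneg (hμ : 0 < μ) (ξ : ℝ) : 0 ≤ greenSymbol μ ξ :=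
  one_div_nonneg.2 (green_den_pos hμ ξ).le

theorem greenSymbol_le (hμ : 0 < μ) (ξ : ℝ) : greenSymbol μ ξ ≤ 1 / μ :=
  one_div_le_one_div_of_le hμ (by nlinarith [sq_nonneg (2 * Real.pi * ξ)])

theorem norm_greenSymbol_le (hμ : 0 < μ) (ξ : ℝ) : ‖(greenSymbol μ ξ : ℂ)‖ ≤ 1 / μ := by
  rw [Complex.norm_real, Real.norm_eq_abs, abs_of_nonneg (greenSymbol_nonneg hμ ξ)]
  exact greenSymbol_le hμ ξ

theorem memLp_greenSymbol (hμ : 0 < μ) :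
    MemLp (fun ξ => (greenSymbol μ ξ : ℂ)) ∞ (volume : Measure ℝ) :=
  memLp_top_of_continuous (Complex.continuous_ofReal.comp (continuous_greenSymbol hμ))
    (norm_greenSymbol_le hμ)

theorem norm_greenDerivSymbol_le (hμ : 1 ≤ μ) (ξ : ℝ) :
    ‖(2 * Real.pi * Complex.I * ξ * (greenSymbol μ ξ : ℂ) : ℂ)‖ ≤ 1 := by
  have h0 : 0 < (2 * Real.pi * ξ) ^ 2 + μ := by positivity
  have e : ‖(2 * Real.pi * Complex.I * ξ * (greenSymbol μ ξ : ℂ) : ℂ)‖ =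
      |2 * Real.pi * ξ| / ((2 * Real.pi * ξ) ^ 2 + μ) := by
    have : (2 * Real.pi * Complex.I * ξ * (greenSymbol μ ξ : ℂ) : ℂ) =
        ((2 * Real.pi * ξ * greenSymbol μ ξ : ℝ) : ℂ) * Complex.I := by push_cast; ring
    rw [this, norm_mul, Complex.norm_I, mul_one, Complex.norm_real, Real.norm_eq_abs, abs_mul,
      abs_of_nonneg (greenSymbol_nonneg (by linarith) ξ), greenSymbol, mul_one_div]
  rw [e, div_le_one h0, ← sq_abs]
  nlinarith [sq_nonneg (|2 * Real.pi * ξ| - 1)]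

theorem memLp_greenDerivSymbol (hμ : 1 ≤ μ) :
    MemLp (fun ξ : ℝ => 2 * Real.pi * Complex.I * ξ * (greenSymbol μ ξ : ℂ)) ∞
      (volume : Measure ℝ) := by
  refine memLp_top_of_continuous ?_ (norm_greenDerivSymbol_le hμ)
  have := continuous_greenSymbol (show 0 < μ by linarith)
  fun_prop

theorem hasWeakDeriv_green (hμ : 1 ≤ μ) (f : L2) : HasWeakDeriv (green μ f) (greenDeriv μ f) :=
  hasWeakDeriv_fmul (memLp_greenSymbol (by linarith)) (memLp_greenDerivSymbol hμ) f

/-- `G_μ` inverts `μ - ∂_y²`. -/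
theorem hasWeakDeriv_greenDeriv (hμ : 1 ≤ μ) (f : L2) :
    HasWeakDeriv (greenDeriv μ f) ((μ : ℂ) • green μ f - f) := by
  rw [hasWeakDeriv_iff]
  have e : (𝓕 ((μ : ℂ) • green μ f - f) : L2) = (μ : ℂ) • (𝓕 (green μ f) : L2) - (𝓕 f : L2) := by
    change Lp.fourierTransformₗᵢ ℝ ℂ _ = _
    rw [map_sub, map_smul]; rfl
  rw [e]
  filter_upwards [coeFn_fourier_fmul (memLp_greenSymbol (show 0 < μ by linarith)) f,
    coeFn_fourier_fmul (memLp_greenDerivSymbol hμ) f,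
    Lp.coeFn_sub ((μ : ℂ) • (𝓕 (green μ f) : L2)) (𝓕 f : L2),
    Lp.coeFn_smul (μ : ℂ) (𝓕 (green μ f) : L2)] with ξ h1 h2 h3 h4
  rw [h3, Pi.sub_apply, h4, Pi.smul_apply, green, h1, greenDeriv, h2, smul_eq_mul]
  have h5 : ((2 * Real.pi * ξ) ^ 2 + μ : ℂ) * (greenSymbol μ ξ : ℂ) = 1 := by
    have := (green_den_pos (show 0 < μ by linarith) ξ).ne'
    have h6 : ((2 * Real.pi * ξ) ^ 2 + μ) * greenSymbol μ ξ = 1 := by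
      rw [greenSymbol]; field_simp
    exact_mod_cast h6
  linear_combination ((𝓕 f : L2) ξ) * h5 -
    (2 * Real.pi * ξ) ^ 2 * (greenSymbol μ ξ) * ((𝓕 f : L2) ξ) * Complex.I_sq

theorem norm_green_apply_le (hμ : 0 < μ) (f : L2) : ‖green μ f‖ ≤ 1 / μ * ‖f‖ :=
  norm_fmul_apply_le (memLp_greenSymbol hμ) (norm_greenSymbol_le hμ) f

theorem green_isSymmetric (hμ : 0 < μ) : (green μ : L2 →ₗ[ℂ] L2).IsSymmetric := by
  intro f g
  have := inner_fmul (memLp_greenSymbol hμ) f g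
  simpa [green] using this

theorem hasComm_green (hμ : 0 < μ) : HasComm (green μ) 0 := by
  intro f f' hf
  simpa [green] using hf.fmul (memLp_greenSymbol hμ)

theorem re_inner_fmul_nonneg {τ : ℝ → ℝ} (hτ : MemLp (fun ξ => (τ ξ : ℂ)) ∞ (volume : Measure ℝ))
    (h0 : ∀ ξ, 0 ≤ τ ξ) (f : L2) : 0 ≤ (inner ℂ (fmul (fun ξ => (τ ξ : ℂ)) f) f).re := by
  rw [← Lp.inner_fourier_eq, fourier_fmul, L2.inner_def, ← RCLike.re_eq_complex_re,
    ← integral_re (L2.integrable_inner _ _)]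
  apply integral_nonneg_of_ae
  filter_upwards [coeFn_cmulOp hτ (𝓕 f : L2)] with ξ h1
  rw [h1]
  have e : inner ℂ ((τ ξ : ℂ) * (𝓕 f : L2) ξ) ((𝓕 f : L2) ξ) =
      ((τ ξ * ‖(𝓕 f : L2) ξ‖ ^ 2 : ℝ) : ℂ) := by
    simp only [RCLike.inner_apply, map_mul, Complex.conj_ofReal]
    rw [mul_comm, mul_assoc, Complex.conj_mul']
    push_cast; ring
  rw [e]
  simp only [Pi.zero_apply, RCLike.re_eq_complex_re, Complex.ofReal_re]
  exact mul_nonneg (h0 ξ) (sq_nonneg _)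

theorem re_inner_green_nonneg (hμ : 0 < μ) (f : L2) : 0 ≤ (inner ℂ (green μ f) f).re :=
  re_inner_fmul_nonneg (memLp_greenSymbol hμ) (greenSymbol_nonneg hμ) f

theorem fourier_sub (f g : L2) : (𝓕 (f - g) : L2) = (𝓕 f : L2) - (𝓕 g : L2) :=
  (Lp.fourierTransformₗᵢ ℝ ℂ).map_sub f g

theorem memLp_greenSymbol_sub {μ' : ℝ} (hμ : 0 < μ) (hμ' : 0 < μ') :
    MemLp (fun ξ => ((greenSymbol μ ξ - greenSymbol μ' ξ : ℝ) : ℂ)) ∞ (volume : Measure ℝ) :=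
  ((memLp_greenSymbol hμ).sub (memLp_greenSymbol hμ')).ae_eq
    (Eventually.of_forall fun ξ => by simp)

theorem green_sub_green {μ' : ℝ} (hμ : 0 < μ) (hμ' : 0 < μ') (f : L2) :
    green μ f - green μ' f = fmul (fun ξ => ((greenSymbol μ ξ - greenSymbol μ' ξ : ℝ) : ℂ)) f := by
  have hm := memLp_greenSymbol_sub hμ hμ'
  apply ext_fourier
  rw [fourier_sub]
  filter_upwards [coeFn_fourier_fmul hm f, coeFn_fourier_fmul (memLp_greenSymbol hμ) f,
    coeFn_fourier_fmul (memLp_greenSymbol hμ') f,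
    Lp.coeFn_sub (𝓕 (green μ f) : L2) (𝓕 (green μ' f) : L2)] with ξ h1 h2 h3 h4
  rw [h4, Pi.sub_apply, green, green, h1, h2, h3]
  push_cast; ring

/-- `G_μ` is decreasing in `μ`. -/
theorem re_inner_green_anti {μ' : ℝ} (hμ : 0 < μ) (hμμ' : μ ≤ μ') (f : L2) :
    (inner ℂ (green μ' f) f).re ≤ (inner ℂ (green μ f) f).re := by
  have hμ' : 0 < μ' := hμ.trans_le hμμ'
  have hm := memLp_greenSymbol_sub hμ hμ'
  have := re_inner_fmul_nonneg hm (fun ξ => sub_nonneg.2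
    (one_div_le_one_div_of_le (green_den_pos hμ ξ) (by linarith))) f
  rw [← green_sub_green hμ hμ', inner_sub_left, Complex.sub_re] at this
  linarith

theorem norm_green_sub_le {μ' : ℝ} (hμ : 1 ≤ μ) (hμ' : 1 ≤ μ') (f : L2) :
    ‖green μ f - green μ' f‖ ≤ |μ - μ'| * ‖f‖ := by
  have h0 : 0 < μ := by linarith
  have h0' : 0 < μ' := by linarith
  rw [green_sub_green h0 h0']
  refine norm_fmul_apply_le ?_ (fun ξ => ?_) f
  · exact memLp_greenSymbol_sub h0 h0'
  · rw [Complex.norm_real, Real.norm_eq_abs]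
    have e : greenSymbol μ ξ - greenSymbol μ' ξ =
        (μ' - μ) * (greenSymbol μ ξ * greenSymbol μ' ξ) := by
      have h1 := (green_den_pos h0 ξ).ne'
      have h2 := (green_den_pos h0' ξ).ne'
      rw [greenSymbol, greenSymbol]
      field_simp
      ring
    rw [e, abs_mul, abs_sub_comm]
    have h1 : greenSymbol μ ξ ≤ 1 := (greenSymbol_le h0 ξ).trans ((div_le_one h0).2 hμ)
    have h2 : greenSymbol μ' ξ ≤ 1 := (greenSymbol_le h0' ξ).trans ((div_le_one h0').2 hμ')
    have h3 := greenSymbol_nonneg h0 ξ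
    have h4 := greenSymbol_nonneg h0' ξ
    rw [abs_of_nonneg (mul_nonneg h3 h4)]
    exact mul_le_of_le_one_right (abs_nonneg _) (mul_le_one₀ h1 h4 h2)

theorem invLap_eq (α : ℤ) (hα : α ≠ 0) : invLap α = -green ((α : ℝ) ^ 2) := by
  have hα' : (0 : ℝ) < (α : ℝ) ^ 2 := by positivity
  ext1 f
  have h1 : invLap α f =
      fmul (fun ξ => ((-1 / ((2 * Real.pi * ξ) ^ 2 + (α : ℝ) ^ 2) : ℝ) : ℂ)) f := rfl
  have hm : MemLp (fun ξ : ℝ => ((-1 / ((2 * Real.pi * ξ) ^ 2 + (α : ℝ) ^ 2) : ℝ) : ℂ)) ∞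
      (volume : Measure ℝ) := by
    refine (memLp_greenSymbol hα').neg.ae_eq (Eventually.of_forall fun ξ => ?_)
    simp only [Pi.neg_apply, greenSymbol]
    push_cast; ring
  rw [h1]
  apply ext_fourier
  have e : (𝓕 ((-green ((α : ℝ) ^ 2)) f) : L2) = -(𝓕 (green ((α : ℝ) ^ 2) f) : L2) :=
    (Lp.fourierTransformₗᵢ ℝ ℂ).map_neg _
  rw [e]
  filter_upwards [coeFn_fourier_fmul hm f, coeFn_fourier_fmul (memLp_greenSymbol hα') f,
    Lp.coeFn_neg (𝓕 (green ((α : ℝ) ^ 2) f) : L2)] with ξ h2 h3 h4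
  rw [h4, Pi.neg_apply, h2, green, h3, greenSymbol]
  push_cast; ring

end Green

/-! ### The Birman–Schwinger operator -/

/-- The Birman–Schwinger operator `K_μ = m (μ - ∂_y²)⁻¹ m`. -/
def birman (m : ℝ → ℝ) (μ : ℝ) : L2 →L[ℂ] L2 := mulOp m * green μ * mulOp m

theorem birman_apply (m : ℝ → ℝ) (μ : ℝ) (f : L2) :
    birman m μ f = mulOp m (green μ (mulOp m f)) := rfl

theorem sigma_eq (m : ℝ → ℝ) (α : ℤ) (hα : α ≠ 0) : Sigma m α = 1 - birman m ((α : ℝ) ^ 2) := by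
  ext1 f
  simp [Sigma, invLap_eq α hα, birman_apply, sub_eq_add_neg]

theorem birman_isSymmetric (m : ℝ → ℝ) {μ : ℝ} (hμ : 0 < μ) :
    (birman m μ : L2 →ₗ[ℂ] L2).IsSymmetric := by
  intro f g
  change inner ℂ (mulOp m (green μ (mulOp m f))) g = inner ℂ f (mulOp m (green μ (mulOp m g)))
  have h1 : ∀ f g, inner ℂ (mulOp m f) g = inner ℂ f (mulOp m g) := mulOp_isSymmetric m
  have h2 : ∀ f g, inner ℂ (green μ f) g = inner ℂ f (green μ g) := green_isSymmetric hμ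
  rw [h1, h2, h1]

theorem inner_birman (m : ℝ → ℝ) (μ : ℝ) (f : L2) :
    inner ℂ (birman m μ f) f = inner ℂ (green μ (mulOp m f)) (mulOp m f) :=
  mulOp_isSymmetric m _ _

theorem birman_nonneg (m : ℝ → ℝ) {μ : ℝ} (hμ : 0 < μ) : 0 ≤ birman m μ := by
  rw [ContinuousLinearMap.nonneg_iff_isPositive, ContinuousLinearMap.isPositive_def]
  refine ⟨birman_isSymmetric m hμ, fun f => ?_⟩
  rw [ContinuousLinearMap.reApplyInnerSelf_apply, inner_birman]
  exact re_inner_green_nonneg hμ _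

namespace Flow

variable {U U₁ U₂ m m₁ m₂ : ℝ → ℝ} {κ : ℝ}

theorem norm_birman_le (h : Flow U U₁ U₂ m m₁ m₂ κ) {μ : ℝ} (hμ : 0 < μ) :
    ‖birman m μ‖ ≤ κ ^ 2 / μ := by
  have hκ : 0 ≤ κ := by linarith [h.one_le]
  refine ContinuousLinearMap.opNorm_le_bound _ (by positivity) fun f => ?_
  calc ‖mulOp m (green μ (mulOp m f))‖ ≤ κ * (1 / μ * (κ * ‖f‖)) :=
        (norm_mulOp_apply_le h.cont_m h.m_le _).trans (by
          gcongr
          exact (norm_green_apply_le hμ _).trans (by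
            gcongr; exact norm_mulOp_apply_le h.cont_m h.m_le f))
    _ = _ := by ring

theorem norm_birman_sub_le (h : Flow U U₁ U₂ m m₁ m₂ κ) {μ μ' : ℝ} (hμ : 1 ≤ μ) (hμ' : 1 ≤ μ') :
    ‖birman m μ - birman m μ'‖ ≤ κ ^ 2 * |μ - μ'| := by
  have hκ : 0 ≤ κ := by linarith [h.one_le]
  refine ContinuousLinearMap.opNorm_le_bound _ (by positivity) fun f => ?_
  have e : (birman m μ - birman m μ') f =
      mulOp m (green μ (mulOp m f) - green μ' (mulOp m f)) := by
    rw [map_sub]; rfl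
  rw [e]
  calc _ ≤ κ * (|μ - μ'| * (κ * ‖f‖)) :=
        (norm_mulOp_apply_le h.cont_m h.m_le _).trans (by
          gcongr
          exact (norm_green_sub_le hμ hμ' _).trans (by
            gcongr; exact norm_mulOp_apply_le h.cont_m h.m_le f))
    _ = _ := by ring

/-- By the Birman–Schwinger principle, `1` is not an eigenvalue of `K_μ` for `μ ≥ 1`. -/
theorem birman_injective (h : Flow U U₁ U₂ m m₁ m₂ κ) (hS : IsSpectrallyStable m) {μ : ℝ}
    (hμ : 1 ≤ μ) (f : L2) (hf : (1 - birman m μ) f = 0) : f = 0 := by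
  have hf' : f = mulOp m (green μ (mulOp m f)) := by
    have : f - birman m μ f = 0 := hf
    exact sub_eq_zero.1 this
  set φ := green μ (mulOp m f) with hφ
  by_contra hne
  obtain ⟨l, hl, hl1⟩ := hS
  have hφ0 : φ ≠ 0 := fun h0 => hne (by rw [hf', h0, map_zero])
  have hmm : mulOp (fun y => m y ^ 2) φ = mulOp m f := by
    rw [hf', mulOp_mulOp h.cont_m h.m_le h.cont_m h.m_le]
    simp only [sq]
  have hsch : IsSchrodinger m φ (0 + ((-μ : ℝ) : ℂ) • φ) := by
    refine ⟨_, ⟨_, hasWeakDeriv_green hμ (mulOp m f), hasWeakDeriv_greenDeriv hμ (mulOp m f)⟩, ?_⟩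
    rw [hmm, ← hφ]
    push_cast
    rw [zero_add, neg_smul]
    abel
  have hsch0 : IsSchrodinger m 0 (0 + ((-μ : ℝ) : ℂ) • (0 : L2)) :=
    ⟨0, ⟨0, hasWeakDeriv_zero, hasWeakDeriv_zero⟩, by simp⟩
  have hmem : ((-μ : ℝ) : ℂ) ∈ schrodingerSpectrum m := by
    rintro ⟨hu, -⟩
    obtain ⟨g, -, hg⟩ := hu 0
    exact hφ0 ((hg φ hsch).trans (hg 0 hsch0).symm)
  have := hl.1 (show (-μ) ∈ {x : ℝ | (x : ℂ) ∈ schrodingerSpectrum m} from hmem)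
  linarith

instance : Nontrivial L2 := by
  refine ⟨kernelAt 0, 0, fun h0 => ?_⟩
  have h1 : kernelAt 0 =ᵐ[volume] (0 : ℝ → ℂ) := by rw [h0]; exact Lp.coeFn_zero _ _ _
  have h2 : ∀ᵐ x : ℝ, x ∉ Set.Ioi (0 : ℝ) := by
    filter_upwards [coeFn_kernelAt 0, h1] with x hx hx' hx0
    rw [hx'] at hx
    rw [expKernel, sub_zero, Set.indicator_of_mem hx0] at hx
    exact (Complex.ofReal_ne_zero.2 (Real.exp_pos (-x)).ne') hx.symm
  have h3 : volume (Set.Ioi (0 : ℝ)) = 0 := by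
    rw [← compl_mem_ae_iff]
    exact h2
  simp at h3

/-- Spectral stability bounds the Birman–Schwinger operator away from `1`. -/
theorem norm_birman_one_lt (h : Flow U U₁ U₂ m m₁ m₂ κ) (hS : IsSpectrallyStable m) :
    ‖birman m 1‖ < 1 := by
  by_contra! hge
  have hκ := h.one_le
  -- the norm decreases continuously to `0` as `μ → ∞`, hence equals `1` somewhere
  have hcont : ContinuousOn (fun μ => ‖birman m μ‖) (Set.Icc 1 (κ ^ 2 + 1)) := by
    refine ContinuousOn.norm fun μ hμ => ?_
    rw [ContinuousWithinAt, tendsto_iff_norm_sub_tendsto_zero]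
    refine squeeze_zero' (Eventually.of_forall fun _ => norm_nonneg _)
      (g := fun x => κ ^ 2 * |x - μ|) ?_ ?_
    · filter_upwards [self_mem_nhdsWithin] with x hx
      exact h.norm_birman_sub_le hx.1 hμ.1
    · have : Tendsto (fun x => κ ^ 2 * |x - μ|) (𝓝 μ) (𝓝 (κ ^ 2 * |μ - μ|)) :=
        (Continuous.tendsto (by fun_prop) μ)
      simp only [sub_self, abs_zero, mul_zero] at this
      exact this.mono_left nhdsWithin_le_nhds
  have hend : ‖birman m (κ ^ 2 + 1)‖ ≤ 1 :=
    (h.norm_birman_le (by positivity)).trans ((div_le_one (by positivity)).2 (by linarith))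
  obtain ⟨μ, hμ, hμ1⟩ := intermediate_value_Icc' (by nlinarith : (1 : ℝ) ≤ κ ^ 2 + 1) hcont
    ⟨hend, hge⟩
  have hμ0 : (0 : ℝ) < μ := by linarith [hμ.1]
  set X : L2 →L[ℂ] L2 := 1 - birman m μ with hX
  have hXsymm : (X : L2 →ₗ[ℂ] L2).IsSymmetric := by
    intro f g
    have := birman_isSymmetric m hμ0 f g
    change inner ℂ (f - birman m μ f) g = inner ℂ f (g - birman m μ g)
    rw [inner_sub_left, inner_sub_right]
    exact congrArg _ this
  have hinj := h.birman_injective hS hμ.1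
  obtain ⟨M, hM0, hM⟩ := exists_bound_mulOp_comp h.cont_m h.m_le h.tendsto_m
    (B := green μ * mulOp m) (B' := greenDeriv μ * mulOp m)
    (fun f => hasWeakDeriv_green hμ.1 (mulOp m f)) hXsymm hinj (η := 1 / 2) (by norm_num)
  have hbelow : ∀ f : L2, ‖f‖ ≤ 2 * (M + 1) * ‖X f‖ := fun f => by
    have e : f = birman m μ f + X f := by simp [hX]
    have h1 : ‖f‖ ≤ ‖birman m μ f‖ + ‖X f‖ := by
      conv_lhs => rw [e]
      exact norm_add_le _ _
    have h2 : ‖birman m μ f‖ ≤ 1 / 2 * ‖f‖ + M * ‖X f‖ := hM f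
    linarith
  -- so `1 - K_μ` is invertible, while the norm of `K_μ ≥ 0` belongs to its spectrum
  have hbij : Function.Bijective X := by
    have hanti : AntilipschitzWith (Real.toNNReal (2 * (M + 1))) X :=
      X.antilipschitz_of_bound fun f => by
        rw [Real.coe_toNNReal _ (by positivity)]; exact hbelow f
    refine ⟨hanti.injective, ?_⟩
    have h1 : X.adjoint = X := (ContinuousLinearMap.isSelfAdjoint_iff_isSymmetric.2 hXsymm).adjoint_eq
    have h2 := X.orthogonal_range
    rw [h1, LinearMap.ker_eq_bot'.2 (fun f hf => hinj f hf)] at h2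
    have hcl : IsClosed (X.range : Set L2) := hanti.isClosed_range X.uniformContinuous
    have : X.range = ⊤ := by
      have h3 := Submodule.topologicalClosure_eq_top_iff.2 h2
      rwa [hcl.submodule_topologicalClosure_eq] at h3
    exact LinearMap.range_eq_top.1 this
  have hunit : IsUnit X := ContinuousLinearMap.isUnit_iff_bijective.2 hbij
  have hspec := CStarAlgebra.norm_mem_spectrum_of_nonneg (birman_nonneg m hμ0)
  simp only at hμ1
  rw [hμ1, spectrum.mem_iff, map_one] at hspec
  exact hspec hunit

end Flow

section Order

open scoped ComplexOrder

/-! ### The square root -/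

theorem contDiff_bump_mul {f : ℝ → ℝ} (hf : ∀ x, 0 < x → ContDiffAt ℝ ∞ f x) {c : ℝ}
    (χ : ContDiffBump c) (hχ : χ.rOut < c) : ContDiff ℝ ∞ fun x => χ x * f x := by
  rw [contDiff_iff_contDiffAt]
  intro x
  by_cases hx : 0 < x
  · exact χ.contDiff.contDiffAt.mul (hf x hx)
  · have h1 : x ∉ tsupport χ := by
      rw [χ.tsupport_eq, Metric.mem_closedBall, Real.dist_eq, abs_le]
      intro h
      linarith [h.1]
    have h2 := notMem_tsupport_iff_eventuallyEq.1 h1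
    refine contDiffAt_const (c := (0 : ℝ)) |>.congr_of_eventuallyEq ?_
    filter_upwards [h2] with y hy
    rw [hy]; simp

/-- Smooth compactly supported functions that agree with `√x` and `1 / √x` on `[1 - r, 1]`. -/
theorem exists_cutoff_sqrt {r : ℝ} (h0 : 0 ≤ r) (hr : r < 1) : ∃ p q : ℝ → ℝ,
    ContDiff ℝ ∞ p ∧ HasCompactSupport p ∧ ContDiff ℝ ∞ q ∧ HasCompactSupport q ∧
    ∀ x ∈ Set.Icc (1 - r) 1, p x = √x ∧ q x = 1 / √x := by
  let χ : ContDiffBump (1 : ℝ) := ⟨(1 + r) / 2, (3 + r) / 4, by linarith, by linarith⟩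
  have hχ : χ.rOut < 1 := by change (3 + r) / 4 < 1; linarith
  refine ⟨fun x => χ x * √x, fun x => χ x * (1 / √x), ?_, χ.hasCompactSupport.mul_right, ?_,
    χ.hasCompactSupport.mul_right, fun x hx => ?_⟩
  · exact contDiff_bump_mul (fun x hx => Real.contDiffAt_sqrt hx.ne') χ hχ
  · exact contDiff_bump_mul (fun x hx => contDiffAt_const.div (Real.contDiffAt_sqrt hx.ne')
      (Real.sqrt_ne_zero'.2 hx)) χ hχ
  · have : χ x = 1 := by
      apply χ.one_of_mem_closedBall
      rw [Metric.mem_closedBall, Real.dist_eq, abs_le]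
      change -((1 + r) / 2) ≤ x - 1 ∧ x - 1 ≤ (1 + r) / 2
      constructor <;> linarith [hx.1, hx.2]
    simp [this]

theorem re_mem_Icc_of_mem_spectrum {E : Type*} [CStarAlgebra E] [PartialOrder E]
    [StarOrderedRing E] {A : E} {r : ℝ} (hA : IsSelfAdjoint A) (h1 : ((1 - r : ℝ) : ℂ) • 1 ≤ A)
    (h2 : A ≤ 1) {z : ℂ} (hz : z ∈ spectrum ℂ A) : z.re ∈ Set.Icc (1 - r) 1 := by
  rw [← hA.spectrumRestricts.algebraMap_image] at hz
  obtain ⟨x, hx, rfl⟩ := hz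
  simp only [Complex.coe_algebraMap, Complex.ofReal_re]
  rw [Complex.coe_smul, ← Algebra.algebraMap_eq_smul_one] at h1
  rw [← map_one (algebraMap ℝ E)] at h2
  exact ⟨(algebraMap_le_iff_le_spectrum (R := ℝ) hA).1 h1 x hx,
    (le_algebraMap_iff_spectrum_le (R := ℝ) hA).1 h2 x hx⟩

theorem nonneg_of_smul_one_le {E : Type*} [CStarAlgebra E] [PartialOrder E]
    [StarOrderedRing E] {A : E} {r : ℝ} (hr : 0 ≤ r) (h1 : (r : ℂ) • 1 ≤ A) : 0 ≤ A := by
  rw [Complex.coe_smul] at h1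
  exact (smul_nonneg hr zero_le_one).trans h1

/-- The square root of a self-adjoint operator `1 - r ≤ A ≤ 1` and its inverse have bounded
commutators with `∂_y` if `A` has. -/
theorem exists_hasComm2_sqrt {r : ℝ} (h0 : 0 ≤ r) (hr : r < 1) (c : ℝ) :
    ∃ C : ℝ, ∀ A : L2 →L[ℂ] L2, IsSelfAdjoint A → ((1 - r : ℝ) : ℂ) • 1 ≤ A →
      A ≤ 1 → HasComm2 A c →
      0 ≤ opSqrt A ∧ ‖opSqrt A‖ ≤ 1 ∧ opSqrt A * opSqrt A = A ∧ HasComm2 (opSqrt A) C ∧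
      opSqrt A * Ring.inverse (opSqrt A) = 1 ∧ Ring.inverse (opSqrt A) * opSqrt A = 1 ∧
      ‖Ring.inverse (opSqrt A)‖ ≤ C ∧ HasComm2 (Ring.inverse (opSqrt A)) C := by
  obtain ⟨p, q, hp, hpc, hq, hqc, hpq⟩ := exists_cutoff_sqrt h0 hr
  have hp' : ContDiff ℝ ∞ fun x => (p x : ℂ) := Complex.ofRealCLM.contDiff.comp hp
  have hq' : ContDiff ℝ ∞ fun x => (q x : ℂ) := Complex.ofRealCLM.contDiff.comp hq
  obtain ⟨C₁, -, hC₁⟩ := exists_hasComm2_cfc hp' (hpc.comp_left (g := fun x : ℝ => (x : ℂ)) rfl) 1 c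
  obtain ⟨C₂, -, hC₂⟩ := exists_hasComm2_cfc hq' (hqc.comp_left (g := fun x : ℝ => (x : ℂ)) rfl) 1 c
  refine ⟨max (max C₁ C₂) (1 / √(1 - r)), fun A hA h1 h2 hAc => ?_⟩
  have hn : IsStarNormal A := hA.isStarNormal
  have hA0 : 0 ≤ A := nonneg_of_smul_one_le (by linarith) h1
  have hsp : ∀ z ∈ spectrum ℂ A, z.re ∈ Set.Icc (1 - r) 1 := fun z hz =>
    re_mem_Icc_of_mem_spectrum hA h1 h2 hz
  have hre : ∀ z ∈ spectrum ℂ A, z = (z.re : ℂ) := fun z hz => hA.mem_spectrum_eq_re hz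
  have hnorm : ‖A‖ ≤ 1 := (CStarAlgebra.norm_le_one_iff_of_nonneg A hA0).2 h2
  have cp : Continuous fun z : ℂ => (p z.re : ℂ) := by have := hp.continuous; fun_prop
  have cq : Continuous fun z : ℂ => (q z.re : ℂ) := by have := hq.continuous; fun_prop
  set T := cfc (fun z : ℂ => (p z.re : ℂ)) A with hT
  set I := cfc (fun z : ℂ => (q z.re : ℂ)) A with hI
  have hTT : T * T = A := by
    rw [hT, ← cfc_mul _ _ A cp.continuousOn cp.continuousOn]
    conv_rhs => rw [← cfc_id ℂ A]
    refine cfc_congr fun z hz => ?_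
    have h3 := hsp z hz
    have h4 : (0 : ℝ) ≤ z.re := by linarith [h3.1]
    simp only [(hpq _ h3).1, id]
    rw [← Complex.ofReal_mul, Real.mul_self_sqrt h4]
    exact (hre z hz).symm
  have hT0 : 0 ≤ T := cfc_nonneg fun z hz => by
    rw [(hpq _ (hsp z hz)).1]
    exact_mod_cast Real.sqrt_nonneg _
  have hsq : opSqrt A = T := CFC.sqrt_unique hTT hT0
  have hone : ∀ z ∈ spectrum ℂ A, (p z.re : ℂ) * (q z.re : ℂ) = 1 := fun z hz => by
    have h3 := hsp z hz
    have h4 : 0 < √z.re := Real.sqrt_pos.2 (by linarith [h3.1])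
    rw [(hpq _ h3).1, (hpq _ h3).2, ← Complex.ofReal_mul, mul_one_div_cancel h4.ne',
      Complex.ofReal_one]
  have hTI : T * I = 1 := by
    rw [hT, hI, ← cfc_mul _ _ A cp.continuousOn cq.continuousOn, ← cfc_one ℂ A]
    exact cfc_congr fun z hz => hone z hz
  have hIT : I * T = 1 := by
    rw [hT, hI, ← cfc_mul _ _ A cq.continuousOn cp.continuousOn, ← cfc_one ℂ A]
    exact cfc_congr fun z hz => (mul_comm _ _).trans (hone z hz)
  have hinv : Ring.inverse T = I := Ring.inverse_unit (⟨T, I, hTI, hIT⟩ : (L2 →L[ℂ] L2)ˣ)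
  rw [hsq, hinv]
  refine ⟨hT0, ?_, hTT, ?_, hTI, hIT, ?_, ?_⟩
  · refine norm_cfc_le zero_le_one fun z hz => ?_
    rw [(hpq _ (hsp z hz)).1, Complex.norm_real, Real.norm_eq_abs, abs_of_nonneg (Real.sqrt_nonneg _)]
    exact Real.sqrt_le_one.2 (hsp z hz).2
  · exact (hC₁ A hA hnorm hAc).mono ((le_max_left _ _).trans (le_max_left _ _))
  · refine (norm_cfc_le (by positivity) fun z hz => ?_).trans (le_max_right _ _)
    rw [(hpq _ (hsp z hz)).2, Complex.norm_real, Real.norm_eq_abs, abs_of_nonneg (by positivity)]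
    exact one_div_le_one_div_of_le (Real.sqrt_pos.2 (by linarith))
      (Real.sqrt_le_sqrt (hsp z hz).1)
  · exact (hC₂ A hA hnorm hAc).mono ((le_max_right _ _).trans (le_max_left _ _))

theorem isSymmetric_of_nonneg {A : L2 →L[ℂ] L2} (hA : 0 ≤ A) :
    (A : L2 →ₗ[ℂ] L2).IsSymmetric :=
  (ContinuousLinearMap.isPositive_def.1 (ContinuousLinearMap.nonneg_iff_isPositive A |>.1 hA)).1

theorem re_inner_nonneg_of_nonneg {A : L2 →L[ℂ] L2} (hA : 0 ≤ A) (f : L2) :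
    0 ≤ (inner ℂ (A f) f).re :=
  (ContinuousLinearMap.isPositive_def.1 (ContinuousLinearMap.nonneg_iff_isPositive A |>.1 hA)).2 f

theorem norm_le_norm_add_of_nonneg {A : L2 →L[ℂ] L2} (hA : 0 ≤ A) (f : L2) : ‖f‖ ≤ ‖f + A f‖ := by
  have h1 : ‖f‖ * ‖f‖ ≤ ‖f + A f‖ * ‖f‖ := by
    calc ‖f‖ * ‖f‖ ≤ (inner ℂ (f + A f) f).re := by
          rw [inner_add_left, Complex.add_re]
          have := re_inner_nonneg_of_nonneg hA f
          have h2 : (inner ℂ f f : ℂ).re = ‖f‖ * ‖f‖ := (inner_self_eq_norm_mul_norm (𝕜 := ℂ) f)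
          linarith
      _ ≤ ‖inner ℂ (f + A f) f‖ := Complex.re_le_norm _
      _ ≤ _ := norm_inner_le_norm _ _
  rcases eq_or_lt_of_le (norm_nonneg f) with h | h
  · rw [← h]; exact norm_nonneg _
  · exact le_of_mul_le_mul_right h1 h

/-- The commutator `[∂_y, K_μ]`. -/
def birmanDeriv (m m₁ : ℝ → ℝ) (μ : ℝ) : L2 →L[ℂ] L2 :=
  mulOp m * green μ * mulOp m₁ + mulOp m₁ * green μ * mulOp m

namespace Flow

variable {U U₁ U₂ m m₁ m₂ : ℝ → ℝ} {κ : ℝ}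

theorem hasComm_m (h : Flow U U₁ U₂ m m₁ m₂ κ) : HasComm (mulOp m) (mulOp m₁) :=
  hasComm_mulOp h.hasDerivAt_m h.cont_m₁ h.m_le h.m₁_le_sq

theorem hasComm_m₁ (h : Flow U U₁ U₂ m m₁ m₂ κ) : HasComm (mulOp m₁) (mulOp m₂) :=
  hasComm_mulOp h.hasDerivAt_m₁ h.cont_m₂ h.m₁_le_sq h.m₂_le_sq

theorem hasComm_birman (h : Flow U U₁ U₂ m m₁ m₂ κ) {μ : ℝ} (hμ : 0 < μ) :
    HasComm (birman m μ) (birmanDeriv m m₁ μ) := by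
  have := (h.hasComm_m.mul (hasComm_green hμ)).mul h.hasComm_m
  simpa [birman, birmanDeriv] using this

theorem hasComm2_birman (h : Flow U U₁ U₂ m m₁ m₂ κ) {μ : ℝ} (hμ : 1 ≤ μ) :
    HasComm2 (birman m μ) (4 * κ ^ 4) := by
  have hμ0 : 0 < μ := by linarith
  have hκ := h.one_le
  have e : ∀ {a b : ℝ → ℝ} {x y : ℝ}, (∀ f, ‖mulOp a f‖ ≤ x * ‖f‖) → (∀ f, ‖mulOp b f‖ ≤ y * ‖f‖) →
      0 ≤ x → 0 ≤ y → ‖mulOp a * green μ * mulOp b‖ ≤ x * y := by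
    intro a b x y ha hb hx hy
    refine ContinuousLinearMap.opNorm_le_bound _ (by positivity) fun f => ?_
    have h1 : ‖green μ (mulOp b f)‖ ≤ ‖mulOp b f‖ :=
      (norm_green_apply_le hμ0 _).trans (mul_le_of_le_one_left (norm_nonneg _)
        ((div_le_one hμ0).2 hμ))
    calc ‖mulOp a (green μ (mulOp b f))‖ ≤ x * ‖green μ (mulOp b f)‖ := ha _
      _ ≤ x * (y * ‖f‖) := by gcongr; exact h1.trans (hb f)
      _ = x * y * ‖f‖ := by ring
  have b0 := norm_mulOp_apply_le h.cont_m h.m_le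
  have b1 := norm_mulOp_apply_le h.cont_m₁ h.m₁_le_sq
  have b2 := norm_mulOp_apply_le h.cont_m₂ h.m₂_le_sq
  have k34 : κ ^ 3 ≤ κ ^ 4 := pow_le_pow_right₀ hκ (by norm_num)
  have k0 : 0 ≤ κ ^ 4 := by positivity
  have hK2 := ((h.hasComm_m.mul (hasComm_green hμ0)).mul h.hasComm_m₁).add
    ((h.hasComm_m₁.mul (hasComm_green hμ0)).mul h.hasComm_m)
  refine ⟨_, _, h.hasComm_birman hμ0, hK2, ?_, ?_⟩
  · refine (norm_add_le_of_le (e b0 b1 (by positivity) (by positivity))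
      (e b1 b0 (by positivity) (by positivity))).trans ?_
    nlinarith
  · simp only [mul_zero, zero_add]
    refine (norm_add_le_of_le (norm_add_le_of_le (e b0 b2 (by positivity) (by positivity))
      (e b1 b1 (by positivity) (by positivity)))
      (norm_add_le_of_le (e b1 b1 (by positivity) (by positivity))
      (e b2 b0 (by positivity) (by positivity)))).trans ?_
    nlinarith

end Flow

/-- The properties of `S` and `S⁻¹`, with a bound `C`. -/
structure SqrtBounds (m m₁ : ℝ → ℝ) (α : ℤ) (C : ℝ) : Prop where
  isSymmetric : (S m α : L2 →ₗ[ℂ] L2).IsSymmetric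
  norm_le : ‖S m α‖ ≤ 1
  mul_self : S m α * S m α = 1 - birman m ((α : ℝ) ^ 2)
  hasComm2 : HasComm2 (S m α) C
  mul_inv : S m α * Sinv m α = 1
  inv_mul : Sinv m α * S m α = 1
  norm_inv_le : ‖Sinv m α‖ ≤ C
  hasComm2_inv : HasComm2 (Sinv m α) C
  norm_sub_le : ∀ f, ‖f - S m α f‖ ≤ ‖birman m ((α : ℝ) ^ 2) f‖
  norm_comm_le : ∀ S₁, HasComm (S m α) S₁ → ∀ f,
    ‖S₁ f‖ ≤ ‖birmanDeriv m m₁ ((α : ℝ) ^ 2) f‖ + ‖S₁‖ * ‖f - S m α f‖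

theorem one_le_sq_int {α : ℤ} (hα : α ≠ 0) : (1 : ℝ) ≤ (α : ℝ) ^ 2 := by
  have : (1 : ℤ) ≤ α ^ 2 := by
    have h1 := sq_nonneg α
    have h2 : α ^ 2 ≠ 0 := pow_ne_zero 2 hα
    omega
  exact_mod_cast this

namespace Flow

variable {U U₁ U₂ m m₁ m₂ : ℝ → ℝ} {κ : ℝ}

theorem re_inner_birman_le (h : Flow U U₁ U₂ m m₁ m₂ κ) {μ : ℝ} (hμ : 1 ≤ μ) (f : L2) :
    (inner ℂ (birman m μ f) f).re ≤ ‖birman m 1‖ * ‖f‖ ^ 2 := by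
  have _ := h.one_le
  calc (inner ℂ (birman m μ f) f).re ≤ (inner ℂ (birman m 1 f) f).re := by
        rw [inner_birman, inner_birman]
        exact re_inner_green_anti one_pos hμ _
    _ ≤ ‖inner ℂ (birman m 1 f) f‖ := Complex.re_le_norm _
    _ ≤ ‖birman m 1 f‖ * ‖f‖ := norm_inner_le_norm _ _
    _ ≤ ‖birman m 1‖ * ‖f‖ * ‖f‖ := by gcongr; exact ContinuousLinearMap.le_opNorm _ _
    _ = _ := by ring

/-- The bounds on `S`, `S⁻¹` and their commutators with `∂` are uniform in `α` because `K` is largest at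
`α² = 1`, where its norm is below `1` by spectral stability. -/
theorem exists_sqrtBounds (h : Flow U U₁ U₂ m m₁ m₂ κ) (hS : IsSpectrallyStable m) :
    ∃ C : ℝ, ∀ α : ℤ, α ≠ 0 → SqrtBounds m m₁ α C := by
  obtain ⟨C, hC⟩ := exists_hasComm2_sqrt (norm_nonneg (birman m 1)) (h.norm_birman_one_lt hS)
    (0 + 1 * (4 * κ ^ 4))
  refine ⟨C, fun α hα => ?_⟩
  have hμ := one_le_sq_int hα
  have hμ0 : (0 : ℝ) < (α : ℝ) ^ 2 := by linarith
  set K := birman m ((α : ℝ) ^ 2) with hK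
  have hK0 : 0 ≤ K := birman_nonneg m hμ0
  have hsig : Sigma m α = 1 - K := sigma_eq m α hα
  have hKsa : IsSelfAdjoint K := .of_nonneg hK0
  have hsa : IsSelfAdjoint (1 - K) := (IsSelfAdjoint.one _).sub hKsa
  have hle : K ≤ ((‖birman m 1‖ : ℝ) : ℂ) • 1 := by
    rw [ContinuousLinearMap.le_def, ContinuousLinearMap.isPositive_def]
    have hs : IsSelfAdjoint (((‖birman m 1‖ : ℝ) : ℂ) • (1 : L2 →L[ℂ] L2) - K) :=
      (IsSelfAdjoint.smul (Complex.conj_ofReal _) (.one _)).sub hKsa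
    refine ⟨ContinuousLinearMap.isSelfAdjoint_iff_isSymmetric.1 hs, fun f => ?_⟩
    rw [ContinuousLinearMap.reApplyInnerSelf_apply]
    change 0 ≤ RCLike.re (inner ℂ (((‖birman m 1‖ : ℝ) : ℂ) • f - K f) f)
    rw [inner_sub_left, inner_smul_left, map_sub]
    have h2 : (inner ℂ f f : ℂ) = ((‖f‖ ^ 2 : ℝ) : ℂ) := by
      rw [inner_self_eq_norm_sq_to_K]; norm_cast
    rw [h2, Complex.conj_ofReal, ← Complex.ofReal_mul]
    have h3 := h.re_inner_birman_le hμ f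
    simp only [RCLike.re_eq_complex_re, Complex.ofReal_re]
    linarith
  have h1 : ((1 - ‖birman m 1‖ : ℝ) : ℂ) • 1 ≤ 1 - K := by
    rw [Complex.ofReal_sub, Complex.ofReal_one, sub_smul, one_smul]
    exact sub_le_sub_left hle 1
  have h2 : 1 - K ≤ 1 := sub_le_self 1 hK0
  have hcomm : HasComm2 (1 - K) (0 + 1 * (4 * κ ^ 4)) := by
    have := HasComm2.one.add ((h.hasComm2_birman hμ).smul (-1))
    simpa [sub_eq_add_neg] using this
  obtain ⟨s0, s1, s2, s3, s4, s5, s6, s7⟩ := hC _ hsa h1 h2 hcomm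
  have eS : S m α = opSqrt (1 - K) := by rw [S, hsig]
  have hS0 : 0 ≤ S m α := eS ▸ s0
  have hmul : S m α * S m α = 1 - K := by rw [eS]; exact s2
  have hsub : ∀ f, ‖f - S m α f‖ ≤ ‖K f‖ := fun f => by
    refine (norm_le_norm_add_of_nonneg hS0 _).trans (le_of_eq (congrArg _ ?_))
    have e2 : S m α (S m α f) = f - K f := congrArg (fun T : L2 →L[ℂ] L2 => T f) hmul
    rw [map_sub, e2]
    abel
  refine ⟨isSymmetric_of_nonneg hS0, eS ▸ s1, hmul, eS ▸ s3, ?_, ?_, ?_, ?_, hsub, ?_⟩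
  · rw [Sinv, eS]; exact s4
  · rw [Sinv, eS]; exact s5
  · rw [Sinv, eS]; exact s6
  · rw [Sinv, eS]; exact s7
  · intro S₁ hS₁ f
    -- differentiating `S² = 1 - K` gives `S S₁ + S₁ S = -K₁`, which is solved for `S₁`
    have e1 := hS₁.mul hS₁
    rw [hmul] at e1
    have e2 := (HasComm.one.sub (h.hasComm_birman hμ0)).unique e1
    have e3 : S m α (S₁ f) + S₁ (S m α f) = -birmanDeriv m m₁ ((α : ℝ) ^ 2) f := by
      have := congrArg (fun T : L2 →L[ℂ] L2 => T f) e2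
      simpa using this.symm
    have e4 : S₁ f + S m α (S₁ f) = -birmanDeriv m m₁ ((α : ℝ) ^ 2) f + S₁ (f - S m α f) := by
      rw [map_sub, ← e3]; abel
    calc ‖S₁ f‖ ≤ ‖S₁ f + S m α (S₁ f)‖ := norm_le_norm_add_of_nonneg hS0 _
      _ ≤ _ := by
        rw [e4]
        refine (norm_add_le _ _).trans ?_
        rw [norm_neg]
        gcongr
        exact ContinuousLinearMap.le_opNorm _ _

end Flow

end Order

/-! ### The operator `H` has no eigenvalue in the range of `U` -/

theorem L2.norm_sq_eq_integral (f : L2) : ‖f‖ ^ 2 = ∫ y, ‖f y‖ ^ 2 := by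
  have h : (inner ℂ f f : ℂ).re = ‖f‖ ^ 2 := by
    rw [inner_self_eq_norm_sq_to_K]; norm_cast
  rw [← h, L2.inner_def, ← RCLike.re_eq_complex_re, ← integral_re (L2.integrable_inner _ _)]
  refine integral_congr_ae (Eventually.of_forall fun y => ?_)
  simp only [inner_self_eq_norm_sq_to_K, RCLike.re_eq_complex_re]
  norm_cast

theorem integrable_norm_sq (f : L2) : Integrable fun y => ‖f y‖ ^ 2 :=
  (memLp_two_iff_integrable_sq_norm (Lp.memLp f).1).1 (Lp.memLp f)

/-- Dominated convergence for multiplication operators. -/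
theorem tendsto_norm_mulOp {a : ℝ → ℝ → ℝ} (ha : ∀ δ, 0 < δ → Continuous (a δ))
    (hb : ∀ δ, 0 < δ → ∃ C, ∀ y, |a δ y| ≤ C) {f : L2} {F : ℝ → ℝ}
    (hF : MemLp F 2 (volume : Measure ℝ)) (hle : ∀ δ, 0 < δ → ∀ᵐ y, |a δ y| * ‖f y‖ ≤ F y)
    (hlim : ∀ᵐ y, Tendsto (fun δ => a δ y) (𝓝[>] 0) (𝓝 0)) :
    Tendsto (fun δ => ‖mulOp (a δ) f‖) (𝓝[>] 0) (𝓝 0) := by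
  have key : Tendsto (fun δ => ‖mulOp (a δ) f‖ ^ 2) (𝓝[>] 0) (𝓝 0) := by
    have h1 : Tendsto (fun δ => ∫ y, (|a δ y| * ‖f y‖) ^ 2) (𝓝[>] 0) (𝓝 (∫ _ : ℝ, (0 : ℝ))) := by
      refine tendsto_integral_filter_of_dominated_convergence (fun y => ‖F y‖ ^ 2) ?_ ?_
        ((memLp_two_iff_integrable_sq_norm hF.1).1 hF) ?_
      · filter_upwards [self_mem_nhdsWithin] with δ hδ
        have h1 : AEStronglyMeasurable (fun y => |a δ y|) (volume : Measure ℝ) :=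
          (ha δ hδ).abs.aestronglyMeasurable
        exact (h1.mul (Lp.memLp f).1.norm).pow 2
      · filter_upwards [self_mem_nhdsWithin] with δ hδ
        filter_upwards [hle δ hδ] with y hy
        have h0 : 0 ≤ |a δ y| * ‖f y‖ := by positivity
        rw [Real.norm_eq_abs, abs_of_nonneg (by positivity), Real.norm_eq_abs, sq_abs]
        gcongr
      · filter_upwards [hlim] with y hy
        have := ((hy.abs.mul_const ‖f y‖).pow 2)
        simpa using this
    rw [integral_zero] at h1
    refine h1.congr' ?_
    filter_upwards [self_mem_nhdsWithin] with δ hδ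
    obtain ⟨C, hC⟩ := hb δ hδ
    rw [L2.norm_sq_eq_integral]
    refine integral_congr_ae ?_
    filter_upwards [coeFn_mulOp (ha δ hδ) hC f] with y hy
    rw [hy, norm_mul, Complex.norm_real, Real.norm_eq_abs]
  have h2 := (Real.continuous_sqrt.tendsto 0).comp key
  rw [Real.sqrt_zero] at h2
  refine h2.congr fun δ => ?_
  simp [Real.sqrt_sq (norm_nonneg _)]

/-- The energy identity behind the absence of eigenvalues: a solution of `φ'' = μ φ - q` satisfies
`‖φ' - aφ‖² + μ ‖φ‖² = Re ⟨φ, q + a'φ + a²φ⟩`. -/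
theorem mul_norm_sq_le {a a' : ℝ → ℝ} (ha : ∀ y, HasDerivAt a (a' y) y) (ha' : Continuous a')
    {C C' : ℝ} (hC : ∀ y, |a y| ≤ C) (hC' : ∀ y, |a' y| ≤ C') {μ : ℝ} {φ φ₁ q : L2}
    (h₁ : HasWeakDeriv φ φ₁) (h₂ : HasWeakDeriv φ₁ ((μ : ℂ) • φ - q)) :
    μ * ‖φ‖ ^ 2 ≤ (inner ℂ φ (q + mulOp a' φ + mulOp a (mulOp a φ))).re := by
  have hcomm := hasComm_mulOp ha ha' hC hC'
  have sq : ∀ f : L2, (inner ℂ f f : ℂ).re = ‖f‖ ^ 2 := fun f => by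
    rw [inner_self_eq_norm_sq_to_K]; norm_cast
  have sym : ∀ f g, inner ℂ (mulOp a f) g = inner ℂ f (mulOp a g) := mulOp_isSymmetric a
  have e1 : ‖φ₁‖ ^ 2 = -μ * ‖φ‖ ^ 2 + (inner ℂ φ q).re := by
    rw [← sq φ₁, h₁.inner_eq h₂, inner_sub_right, inner_smul_right, Complex.neg_re, Complex.sub_re,
      Complex.re_ofReal_mul, sq]
    ring
  have e2 : 2 * (inner ℂ φ₁ (mulOp a φ)).re = -(inner ℂ φ (mulOp a' φ)).re := by
    have h3 := congrArg Complex.re (h₁.inner_eq (hcomm _ _ h₁))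
    rw [inner_add_right, Complex.neg_re, Complex.add_re] at h3
    have h4 : (inner ℂ φ (mulOp a φ₁)).re = (inner ℂ φ₁ (mulOp a φ)).re := by
      rw [← sym, ← inner_conj_symm, Complex.conj_re]
    linarith
  have e3 : ‖mulOp a φ‖ ^ 2 = (inner ℂ φ (mulOp a (mulOp a φ))).re := by rw [← sq, sym]
  have e4 : ‖φ₁ - mulOp a φ‖ ^ 2 = ‖φ₁‖ ^ 2 - 2 * (inner ℂ φ₁ (mulOp a φ)).re + ‖mulOp a φ‖ ^ 2 := by
    have := norm_sub_sq (𝕜 := ℂ) φ₁ (mulOp a φ)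
    simpa using this
  rw [inner_add_right, inner_add_right, Complex.add_re, Complex.add_re]
  nlinarith [sq_nonneg ‖φ₁ - mulOp a φ‖]

namespace Flow

variable {U U₁ U₂ m m₁ m₂ : ℝ → ℝ} {κ : ℝ}

/-- There is no eigenfunction `g` of the Rayleigh equation `(U - c) g = m (α² - ∂_y²)⁻¹ (m U g)`
with `c` in the range of `U`. -/
theorem rayleigh_eq_zero (h : Flow U U₁ U₂ m m₁ m₂ κ) {μ : ℝ} (hμ : 1 ≤ μ) (y₀ : ℝ) {g : L2}
    (hg : mulOp U g - (U y₀ : ℂ) • g = mulOp m (green μ (mulOp m (mulOp U g)))) : g = 0 := by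
  have hκ := h.one_le
  set c := U y₀ with hc
  set φ := green μ (mulOp m (mulOp U g)) with hφ
  have hX : ∀ᵐ y, ((U y - c : ℝ) : ℂ) * g y = m y * φ y := by
    have h1 : (mulOp U g - (c : ℂ) • g : L2) =ᵐ[volume] mulOp m φ := by rw [hg]
    filter_upwards [h1, coeFn_mulOp h.cont_U h.U_le g, coeFn_mulOp h.cont_m h.m_le φ,
      Lp.coeFn_sub (mulOp U g) ((c : ℂ) • g), Lp.coeFn_smul (c : ℂ) g] with y e1 e2 e3 e4 e5
    rw [e4, e3, Pi.sub_apply, e2, e5, Pi.smul_apply, smul_eq_mul] at e1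
    rw [← e1]; push_cast; ring
  have hXne : ∀ᵐ y, U y - c ≠ 0 := by
    have : ∀ᵐ y : ℝ, y ≠ y₀ := by simp [ae_iff]
    filter_upwards [this] with y hy h0
    exact hy (h.strictMono.injective (sub_eq_zero.1 h0))
  have hU2 : ∀ y, |U y - c| ≤ 2 * κ := fun y =>
    (abs_sub _ _).trans (by linarith [h.U_le y, h.U_le y₀])
  -- near `y₀` the function `m` is bounded below, elsewhere `|U - c|` is
  obtain ⟨m₀, d, hm₀, hd, hsplit⟩ : ∃ m₀ d : ℝ, 0 < m₀ ∧ 0 < d ∧ ∀ y, m₀ ≤ m y ∨ d ≤ |U y - c| := by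
    obtain ⟨z, -, hz⟩ := (isCompact_Icc (a := y₀ - 1) (b := y₀ + 1)).exists_isMinOn
      ⟨y₀, by simp⟩ h.cont_m.continuousOn
    have d1 : 0 < U (y₀ + 1) - c := sub_pos.2 (h.strictMono (by linarith))
    have d2 : 0 < c - U (y₀ - 1) := sub_pos.2 (h.strictMono (by linarith))
    refine ⟨m z, min (U (y₀ + 1) - c) (c - U (y₀ - 1)), h.m_pos z, lt_min d1 d2, fun y => ?_⟩
    by_cases h1 : y < y₀ - 1
    · right
      have := h.strictMono h1
      exact (min_le_right _ _).trans (le_trans (by linarith) (neg_le_abs _))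
    by_cases h2 : y₀ + 1 < y
    · right
      have := h.strictMono h2
      exact (min_le_left _ _).trans (le_trans (by linarith) (le_abs_self _))
    · exact Or.inl (isMinOn_iff.1 hz y ⟨not_lt.1 h1, not_lt.1 h2⟩)
  have hφle : ∀ᵐ y, ‖φ y‖ ≤ |U y - c| * (1 / m₀ * ‖g y‖ + 1 / d * ‖φ y‖) := by
    filter_upwards [hX] with y hy
    have hn := congrArg norm hy
    rw [norm_mul, norm_mul, Complex.norm_real, Complex.norm_real, Real.norm_eq_abs,
      Real.norm_eq_abs, abs_of_pos (h.m_pos y)] at hn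
    rcases hsplit y with h1 | h1
    · have h2 : m₀ * ‖φ y‖ ≤ |U y - c| * ‖g y‖ := by rw [hn]; gcongr
      have h3 : 0 ≤ |U y - c| * (1 / d * ‖φ y‖) := by positivity
      have h4 : ‖φ y‖ ≤ |U y - c| * ‖g y‖ / m₀ := (le_div_iff₀' hm₀).2 h2
      calc ‖φ y‖ ≤ _ := h4
        _ = |U y - c| * (1 / m₀ * ‖g y‖) := by ring
        _ ≤ _ := by rw [mul_add]; linarith
    · have h3 : 0 ≤ |U y - c| * (1 / m₀ * ‖g y‖) := by positivity
      calc ‖φ y‖ = d * (1 / d * ‖φ y‖) := by field_simp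
        _ ≤ |U y - c| * (1 / d * ‖φ y‖) := by gcongr
        _ ≤ _ := by rw [mul_add]; linarith
  have hden : ∀ δ, 0 < δ → ∀ y, 0 < (U y - c) ^ 2 + δ ^ 2 := fun δ hδ y => by positivity
  have hcX : Continuous fun y => U y - c := h.cont_U.sub continuous_const
  set p : ℝ → ℝ → ℝ := fun δ y => m y * U y * (δ ^ 2 / ((U y - c) ^ 2 + δ ^ 2)) with hp
  set b : ℝ → ℝ → ℝ := fun δ y => U₁ y * (δ / ((U y - c) ^ 2 + δ ^ 2)) with hb
  have cp : ∀ δ, 0 < δ → Continuous (p δ) := fun δ hδ =>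
    (h.cont_m.mul h.cont_U).mul (continuous_const.div (by fun_prop) fun y => (hden δ hδ y).ne')
  have cb : ∀ δ, 0 < δ → Continuous (b δ) := fun δ hδ =>
    h.cont_U₁.mul (continuous_const.div (by fun_prop) fun y => (hden δ hδ y).ne')
  have bp : ∀ δ, 0 < δ → ∀ y, |p δ y| ≤ κ * κ := fun δ hδ y => by
    rw [hp, abs_mul, abs_mul, abs_of_nonneg (div_nonneg (sq_nonneg δ) (hden δ hδ y).le)]
    calc _ ≤ |m y| * |U y| * 1 := by
          gcongr
          exact (div_le_one (hden δ hδ y)).2 (by nlinarith [sq_nonneg (U y - c)])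
      _ ≤ κ * κ := by
          rw [mul_one]
          exact mul_le_mul (h.m_le y) (h.U_le y) (abs_nonneg _) (by linarith)
  have babs : ∀ δ, 0 < δ → ∀ y, |b δ y| ≤ κ * (δ / ((U y - c) ^ 2 + δ ^ 2)) := fun δ hδ y => by
    rw [hb, abs_mul, abs_of_nonneg (div_nonneg hδ.le (hden δ hδ y).le)]
    exact mul_le_mul_of_nonneg_right (h.U₁_le y) (div_nonneg hδ.le (hden δ hδ y).le)
  have bb : ∀ δ, 0 < δ → ∀ y, |b δ y| ≤ κ * (δ / δ ^ 2) := fun δ hδ y => by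
    refine (babs δ hδ y).trans ?_
    gcongr
    nlinarith [sq_nonneg (U y - c)]
  have t1 : Tendsto (fun δ => ‖mulOp (p δ) g‖) (𝓝[>] 0) (𝓝 0) := by
    refine tendsto_norm_mulOp cp (fun δ hδ => ⟨_, bp δ hδ⟩) ((Lp.memLp g).norm.const_mul (κ * κ))
      (fun δ hδ => Eventually.of_forall fun y => by gcongr; exact bp δ hδ y) ?_
    filter_upwards [hXne] with y hy
    have h1 : Tendsto (fun δ : ℝ => δ ^ 2 / ((U y - c) ^ 2 + δ ^ 2)) (𝓝 0)
        (𝓝 (0 ^ 2 / ((U y - c) ^ 2 + 0 ^ 2))) := by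
      refine Tendsto.div (Continuous.tendsto (by fun_prop) 0) (Continuous.tendsto (by fun_prop) 0) ?_
      simpa using hy
    have h2 := (h1.const_mul (m y * U y)).mono_left (nhdsWithin_le_nhds (s := Set.Ioi 0))
    simpa using h2
  have t2 : Tendsto (fun δ => ‖mulOp (b δ) φ‖) (𝓝[>] 0) (𝓝 0) := by
    refine tendsto_norm_mulOp cb (fun δ hδ => ⟨_, bb δ hδ⟩)
      ((((Lp.memLp g).norm.const_mul (1 / m₀)).add ((Lp.memLp φ).norm.const_mul (1 / d))).const_mul κ)
      (fun δ hδ => ?_) ?_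
    · filter_upwards [hφle] with y hy
      have h1 := babs δ hδ y
      have h2 : δ / ((U y - c) ^ 2 + δ ^ 2) * |U y - c| ≤ 1 := by
        rw [div_mul_eq_mul_div, div_le_one (hden δ hδ y)]
        nlinarith [sq_nonneg (|U y - c| - δ), sq_abs (U y - c), sq_nonneg (U y - c)]
      have h0 : 0 ≤ δ / ((U y - c) ^ 2 + δ ^ 2) := div_nonneg hδ.le (hden δ hδ y).le
      have h3 : 0 ≤ 1 / m₀ * ‖g y‖ + 1 / d * ‖φ y‖ := by positivity
      calc |b δ y| * ‖φ y‖ ≤ κ * (δ / ((U y - c) ^ 2 + δ ^ 2)) *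
            (|U y - c| * (1 / m₀ * ‖g y‖ + 1 / d * ‖φ y‖)) := by gcongr
        _ = κ * (δ / ((U y - c) ^ 2 + δ ^ 2) * |U y - c|) *
            (1 / m₀ * ‖g y‖ + 1 / d * ‖φ y‖) := by ring
        _ ≤ κ * 1 * (1 / m₀ * ‖g y‖ + 1 / d * ‖φ y‖) := by gcongr
        _ = _ := by rw [mul_one]; rfl
    · filter_upwards [hXne] with y hy
      have h1 : Tendsto (fun δ : ℝ => δ / ((U y - c) ^ 2 + δ ^ 2)) (𝓝 0)
          (𝓝 (0 / ((U y - c) ^ 2 + 0 ^ 2))) := by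
        refine Tendsto.div (Continuous.tendsto (by fun_prop) 0) (Continuous.tendsto (by fun_prop) 0) ?_
        simpa using hy
      have h2 := (h1.const_mul (U₁ y)).mono_left (nhdsWithin_le_nhds (s := Set.Ioi 0))
      simpa using h2
  have key : ∀ δ, 0 < δ → μ * ‖φ‖ ^ 2 ≤ ‖φ‖ * ‖mulOp (p δ) g‖ + ‖mulOp (b δ) φ‖ ^ 2 := by
    intro δ hδ
    have dG : ∀ y, HasDerivAt (fun y => (U y - c) / ((U y - c) ^ 2 + δ ^ 2))
        (U₁ y * ((δ ^ 2 - (U y - c) ^ 2) / ((U y - c) ^ 2 + δ ^ 2) ^ 2)) y := fun y => by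
      have h1 := (h.hasDerivAt_U y).sub_const c
      refine (h1.fun_div ((h1.fun_pow 2).add_const (δ ^ 2)) (hden δ hδ y).ne').congr_deriv ?_
      have := (hden δ hδ y).ne'
      field_simp
      push_cast
      ring
    have da := fun y => (h.hasDerivAt_U₁ y).mul (dG y)
    have hinv : ∀ y, 1 / ((U y - c) ^ 2 + δ ^ 2) ≤ 1 / δ ^ 2 := fun y =>
      one_div_le_one_div_of_le (by positivity) (by nlinarith [sq_nonneg (U y - c)])
    have bG : ∀ y, |(U y - c) / ((U y - c) ^ 2 + δ ^ 2)| ≤ 2 * κ * (1 / δ ^ 2) := fun y => by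
      rw [abs_div, abs_of_pos (hden δ hδ y), div_eq_mul_one_div]
      exact mul_le_mul (hU2 y) (hinv y) (one_div_nonneg.2 (hden δ hδ y).le) (by linarith)
    have bG' : ∀ y, |(δ ^ 2 - (U y - c) ^ 2) / ((U y - c) ^ 2 + δ ^ 2) ^ 2| ≤ 1 / δ ^ 2 := fun y => by
      refine le_trans ?_ (hinv y)
      rw [abs_div, abs_of_pos (pow_pos (hden δ hδ y) 2), div_le_div_iff₀ (pow_pos (hden δ hδ y) 2)
        (hden δ hδ y), one_mul, pow_two ((U y - c) ^ 2 + δ ^ 2)]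
      refine mul_le_mul_of_nonneg_right ?_ (hden δ hδ y).le
      · rw [abs_le]; constructor <;> nlinarith [sq_nonneg (U y - c), sq_nonneg δ]
    have ba : ∀ y, |(U₁ * fun y => (U y - c) / ((U y - c) ^ 2 + δ ^ 2)) y| ≤
        κ * (2 * κ * (1 / δ ^ 2)) := fun y => by
      rw [Pi.mul_apply, abs_mul]
      exact mul_le_mul (h.U₁_le y) (bG y) (abs_nonneg _) (by linarith)
    have ba' : ∀ y, |U₂ y * ((U y - c) / ((U y - c) ^ 2 + δ ^ 2)) +
        U₁ y * (U₁ y * ((δ ^ 2 - (U y - c) ^ 2) / ((U y - c) ^ 2 + δ ^ 2) ^ 2))| ≤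
        κ * (2 * κ * (1 / δ ^ 2)) + κ * (κ * (1 / δ ^ 2)) := fun y => by
      refine (abs_add_le _ _).trans (add_le_add ?_ ?_)
      · rw [abs_mul]
        exact mul_le_mul (h.U₂_le y) (bG y) (abs_nonneg _) (by linarith)
      · rw [abs_mul, abs_mul]
        exact mul_le_mul (h.U₁_le y) (mul_le_mul (h.U₁_le y) (bG' y) (abs_nonneg _) (by linarith))
          (by positivity) (by linarith)
    have ca' : Continuous fun y => U₂ y * ((U y - c) / ((U y - c) ^ 2 + δ ^ 2)) +
        U₁ y * (U₁ y * ((δ ^ 2 - (U y - c) ^ 2) / ((U y - c) ^ 2 + δ ^ 2) ^ 2)) := by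
      have := h.cont_U₁
      have := h.cont_U₂
      refine .add (.mul h.cont_U₂ (.div hcX (by fun_prop) fun y => (hden δ hδ y).ne'))
        (.mul h.cont_U₁ (.mul h.cont_U₁ (.div (by fun_prop) (by fun_prop)
          fun y => (pow_pos (hden δ hδ y) 2).ne')))
    have ca : Continuous (U₁ * fun y => (U y - c) / ((U y - c) ^ 2 + δ ^ 2)) :=
      .mul h.cont_U₁ (.div hcX (by fun_prop) fun y => (hden δ hδ y).ne')
    have main := mul_norm_sq_le da ca' ba ba' (hasWeakDeriv_green hμ _) (hasWeakDeriv_greenDeriv hμ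
      (mulOp m (mulOp U g)))
    rw [← hφ] at main
    set a : ℝ → ℝ := U₁ * fun y => (U y - c) / ((U y - c) ^ 2 + δ ^ 2) with hadef
    set a' : ℝ → ℝ := fun y => U₂ y * ((U y - c) / ((U y - c) ^ 2 + δ ^ 2)) +
        U₁ y * (U₁ y * ((δ ^ 2 - (U y - c) ^ 2) / ((U y - c) ^ 2 + δ ^ 2) ^ 2)) with hadef'
    have e : mulOp m (mulOp U g) + mulOp a' φ + mulOp a (mulOp a φ) =
        mulOp (p δ) g + mulOp (b δ) (mulOp (b δ) φ) := by
      refine Lp.ext ?_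
      filter_upwards [hX, coeFn_mulOp h.cont_m h.m_le (mulOp U g), coeFn_mulOp h.cont_U h.U_le g,
        coeFn_mulOp ca' ba' φ, coeFn_mulOp ca ba (mulOp a φ), coeFn_mulOp ca ba φ,
        coeFn_mulOp (cp δ hδ) (bp δ hδ) g, coeFn_mulOp (cb δ hδ) (bb δ hδ) (mulOp (b δ) φ),
        coeFn_mulOp (cb δ hδ) (bb δ hδ) φ,
        Lp.coeFn_add (mulOp m (mulOp U g) + mulOp a' φ) (mulOp a (mulOp a φ)),
        Lp.coeFn_add (mulOp m (mulOp U g)) (mulOp a' φ),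
        Lp.coeFn_add (mulOp (p δ) g) (mulOp (b δ) (mulOp (b δ) φ))] with
        y e0 e1 e2 e3 e4 e5 e6 e7 e8 e9 e10 e11
      rw [e9, e11, Pi.add_apply, Pi.add_apply, e10, Pi.add_apply, e1, e2, e3, e4, e5, e6, e7, e8]
      have hd := (hden δ hδ y).ne'
      have hd' : (((U y - c) ^ 2 + δ ^ 2 : ℝ) : ℂ) ≠ 0 := Complex.ofReal_ne_zero.2 hd
      have e12 : U₂ y = -(m y) ^ 2 * U y := h.U₂_eq y
      simp only [hadef, hadef', hp, hb, Pi.mul_apply, e12]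
      push_cast at e0 hd' ⊢
      field_simp
      linear_combination ((m y : ℂ) * U y * ((U y - c) ^ 2 + δ ^ 2) * (U y - c)) * e0
    rw [e, inner_add_right, Complex.add_re] at main
    have s : (inner ℂ φ (mulOp (b δ) (mulOp (b δ) φ)) : ℂ).re = ‖mulOp (b δ) φ‖ ^ 2 := by
      have h1 : inner ℂ (mulOp (b δ) φ) (mulOp (b δ) φ) = inner ℂ φ (mulOp (b δ) (mulOp (b δ) φ)) :=
        mulOp_isSymmetric _ _ _
      rw [← h1, inner_self_eq_norm_sq_to_K]; norm_cast
    rw [s] at main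
    have := (Complex.re_le_norm _).trans (norm_inner_le_norm (𝕜 := ℂ) φ (mulOp (p δ) g))
    linarith
  have hφ0 : φ = 0 := by
    have h1 : Tendsto (fun δ => ‖φ‖ * ‖mulOp (p δ) g‖ + ‖mulOp (b δ) φ‖ ^ 2) (𝓝[>] 0)
        (𝓝 (‖φ‖ * 0 + 0 ^ 2)) := (t1.const_mul _).add (t2.pow 2)
    have h2 : μ * ‖φ‖ ^ 2 ≤ ‖φ‖ * 0 + 0 ^ 2 := ge_of_tendsto h1 (by
      filter_upwards [self_mem_nhdsWithin] with δ hδ using key δ hδ)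
    have h3 : ‖φ‖ ^ 2 ≤ 0 := by nlinarith [sq_nonneg ‖φ‖]
    exact norm_eq_zero.1 (pow_eq_zero_iff two_ne_zero |>.1 (le_antisymm h3 (sq_nonneg _)))
  refine (Lp.eq_zero_iff_ae_eq_zero).2 ?_
  have h0 : (φ : L2) =ᵐ[volume] (0 : ℝ → ℂ) := Lp.eq_zero_iff_ae_eq_zero.1 hφ0
  filter_upwards [hX, hXne, h0] with y e1 e2 e3
  rw [e3, Pi.zero_apply, mul_zero] at e1
  exact (mul_eq_zero.1 e1).resolve_left (Complex.ofReal_ne_zero.2 e2)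

end Flow

/-! ### The operator `H` and its commutator with the derivative -/

theorem H_apply (U m : ℝ → ℝ) (α : ℤ) (f : L2) : H U m α f = S m α (mulOp U (S m α f)) := rfl

namespace SqrtBounds

variable {m m₁ : ℝ → ℝ} {α : ℤ} {C : ℝ}

theorem norm_S_apply_le (hs : SqrtBounds m m₁ α C) (f : L2) : ‖S m α f‖ ≤ ‖f‖ :=
  ((S m α).le_opNorm f).trans (mul_le_of_le_one_left (norm_nonneg _) hs.norm_le)

theorem S_S_apply (hs : SqrtBounds m m₁ α C) (f : L2) :
    S m α (S m α f) = f - birman m ((α : ℝ) ^ 2) f :=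
  congrArg (fun T : L2 →L[ℂ] L2 => T f) hs.mul_self

theorem S_Sinv_apply (hs : SqrtBounds m m₁ α C) (f : L2) : S m α (Sinv m α f) = f :=
  congrArg (fun T : L2 →L[ℂ] L2 => T f) hs.mul_inv

theorem Sinv_S_apply (hs : SqrtBounds m m₁ α C) (f : L2) : Sinv m α (S m α f) = f :=
  congrArg (fun T : L2 →L[ℂ] L2 => T f) hs.inv_mul

theorem H_isSymmetric (hs : SqrtBounds m m₁ α C) (U : ℝ → ℝ) :
    (H U m α : L2 →ₗ[ℂ] L2).IsSymmetric := by
  intro f g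
  have h1 : ∀ f g, inner ℂ (S m α f) g = inner ℂ f (S m α g) := hs.isSymmetric
  have h2 : ∀ f g, inner ℂ (mulOp U f) g = inner ℂ f (mulOp U g) := mulOp_isSymmetric U
  change inner ℂ (S m α (mulOp U (S m α f))) g = inner ℂ f (S m α (mulOp U (S m α g)))
  rw [h1, h2, h1]

end SqrtBounds

namespace Flow

variable {U U₁ U₂ m m₁ m₂ : ℝ → ℝ} {κ : ℝ}

theorem hasComm_U (h : Flow U U₁ U₂ m m₁ m₂ κ) : HasComm (mulOp U) (mulOp U₁) :=
  hasComm_mulOp h.hasDerivAt_U h.cont_U₁ h.U_le h.U₁_le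

theorem hasComm2_U (h : Flow U U₁ U₂ m m₁ m₂ κ) : HasComm2 (mulOp U) κ :=
  ⟨_, _, h.hasComm_U, hasComm_mulOp h.hasDerivAt_U₁ h.cont_U₂ h.U₁_le h.U₂_le,
    norm_mulOp_le h.cont_U₁ h.U₁_le, norm_mulOp_le h.cont_U₂ h.U₂_le⟩

theorem norm_H_le (h : Flow U U₁ U₂ m m₁ m₂ κ) {α : ℤ} {C : ℝ} (hs : SqrtBounds m m₁ α C) :
    ‖H U m α‖ ≤ κ := by
  refine ContinuousLinearMap.opNorm_le_bound _ (by linarith [h.one_le]) fun f => ?_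
  have := h.one_le
  calc ‖H U m α f‖ ≤ ‖mulOp U (S m α f)‖ := hs.norm_S_apply_le _
    _ ≤ κ * ‖S m α f‖ := norm_mulOp_apply_le h.cont_U h.U_le _
    _ ≤ κ * ‖f‖ := by gcongr; exact hs.norm_S_apply_le _

theorem exists_hasComm2_H (h : Flow U U₁ U₂ m m₁ m₂ κ) (C : ℝ) :
    ∃ C' : ℝ, ∀ α, SqrtBounds m m₁ α C → HasComm2 (H U m α) C' := by
  have hκ := h.one_le
  set c := max C κ
  set c' := max c (2 * c * (c + κ))
  refine ⟨2 * c' * (c' + κ), fun α hs => ?_⟩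
  have hU := h.hasComm2_U.mono (le_max_right C κ)
  have hS := hs.hasComm2.mono (le_max_left C κ)
  have nU := norm_mulOp_le h.cont_U h.U_le
  have nS : ‖S m α‖ ≤ κ := hs.norm_le.trans hκ
  have nUS : ‖mulOp U * S m α‖ ≤ κ := (norm_mul_le _ _).trans
    ((mul_le_mul nU hs.norm_le (norm_nonneg _) (by linarith)).trans (by rw [mul_one]))
  exact (hS.mono (le_max_left _ _)).mul ((hU.mul hS nU nS).mono (le_max_right _ _)) nS nUS

/-- `H` has no eigenvalue in the range of `U`. -/
theorem H_injective (h : Flow U U₁ U₂ m m₁ m₂ κ) {α : ℤ} (hα : α ≠ 0) {C : ℝ}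
    (hs : SqrtBounds m m₁ α C) (y₀ : ℝ) {f : L2} (hf : H U m α f = (U y₀ : ℂ) • f) : f = 0 := by
  have hg : S m α f = 0 := by
    refine h.rayleigh_eq_zero (one_le_sq_int hα) y₀ ?_
    have e := congrArg (S m α) hf
    rw [H_apply, hs.S_S_apply, map_smul] at e
    rw [← e]
    simp [birman_apply]
  rw [← hs.Sinv_S_apply f, hg, map_zero]

end Flow

/-! ### The Mourre estimate -/

theorem re_inner_mulOp {a : ℝ → ℝ} (ha : Continuous a) {C : ℝ} (hC : ∀ y, |a y| ≤ C) (f : L2) :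
    Integrable (fun y => a y * ‖f y‖ ^ 2) ∧ (inner ℂ (mulOp a f) f).re = ∫ y, a y * ‖f y‖ ^ 2 := by
  have h : ∀ᵐ y, RCLike.re (inner ℂ (mulOp a f y) (f y)) = a y * ‖f y‖ ^ 2 := by
    filter_upwards [coeFn_mulOp ha hC f] with y hy
    rw [hy, ← smul_eq_mul, inner_smul_left, inner_self_eq_norm_sq_to_K, Complex.conj_ofReal,
      RCLike.re_eq_complex_re, Complex.re_ofReal_mul]
    norm_cast
  refine ⟨((L2.integrable_inner (𝕜 := ℂ) (mulOp a f) f).re).congr h, ?_⟩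
  rw [L2.inner_def, ← RCLike.re_eq_complex_re, ← integral_re (L2.integrable_inner _ _)]
  exact integral_congr_ae h

theorem norm_mulOp_sq {a : ℝ → ℝ} (ha : Continuous a) {C : ℝ} (hC : ∀ y, |a y| ≤ C) (f : L2) :
    Integrable (fun y => a y ^ 2 * ‖f y‖ ^ 2) ∧ ‖mulOp a f‖ ^ 2 = ∫ y, a y ^ 2 * ‖f y‖ ^ 2 := by
  have h : ∀ᵐ y, ‖mulOp a f y‖ ^ 2 = a y ^ 2 * ‖f y‖ ^ 2 := by
    filter_upwards [coeFn_mulOp ha hC f] with y hy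
    rw [hy, norm_mul, Complex.norm_real, mul_pow, Real.norm_eq_abs, sq_abs]
  rw [L2.norm_sq_eq_integral]
  exact ⟨(integrable_norm_sq _).congr h, integral_congr_ae h⟩

/-- The size of the compact operators `K f` and `m G m' f`, which control `S - 1` and `[∂_y, S]`. -/
def defect (m m₁ : ℝ → ℝ) (α : ℤ) (f : L2) : ℝ :=
  ‖birman m ((α : ℝ) ^ 2) f‖ + ‖mulOp m (green ((α : ℝ) ^ 2) (mulOp m₁ f))‖

theorem defect_nonneg (m m₁ : ℝ → ℝ) (α : ℤ) (f : L2) : 0 ≤ defect m m₁ α f := by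
  unfold defect; positivity

namespace Flow

variable {U U₁ U₂ m m₁ m₂ : ℝ → ℝ} {κ : ℝ}

/-- The commutator `[∂, K]` is small on `f` as soon as the compact operators in `defect` are:
`|m'| ≤ κ m` reduces `m' (α² - ∂²)⁻¹ m` to `K`. -/
theorem norm_birmanDeriv_le (h : Flow U U₁ U₂ m m₁ m₂ κ) (α : ℤ) (f : L2) :
    ‖birmanDeriv m m₁ ((α : ℝ) ^ 2) f‖ ≤ κ * defect m m₁ α f := by
  have hκ := h.one_le
  have h1 : ‖mulOp m₁ (green ((α : ℝ) ^ 2) (mulOp m f))‖ ≤ κ * ‖birman m ((α : ℝ) ^ 2) f‖ := by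
    apply norm_le_of_ae_le
    rw [birman_apply]
    filter_upwards [coeFn_mulOp h.cont_m₁ h.m₁_le_sq (green ((α : ℝ) ^ 2) (mulOp m f)),
      coeFn_mulOp h.cont_m h.m_le (green ((α : ℝ) ^ 2) (mulOp m f))] with y e1 e2
    rw [e1, e2, norm_mul, norm_mul, Complex.norm_real, Complex.norm_real, Real.norm_eq_abs,
      Real.norm_eq_abs, abs_of_pos (h.m_pos y), ← mul_assoc]
    gcongr
    exact h.m₁_le y
  have h2 : ‖mulOp m (green ((α : ℝ) ^ 2) (mulOp m₁ f))‖ ≤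
      κ * ‖mulOp m (green ((α : ℝ) ^ 2) (mulOp m₁ f))‖ :=
    le_mul_of_one_le_left (norm_nonneg _) hκ
  refine (norm_add_le (mulOp m (green ((α : ℝ) ^ 2) (mulOp m₁ f)))
    (mulOp m₁ (green ((α : ℝ) ^ 2) (mulOp m f)))).trans ?_
  unfold defect
  linarith

theorem defect_le (h : Flow U U₁ U₂ m m₁ m₂ κ) {α : ℤ} (hα : α ≠ 0) (f : L2) :
    defect m m₁ α f ≤ (κ ^ 2 + κ ^ 3) / (α : ℝ) ^ 2 * ‖f‖ := by
  have hκ := h.one_le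
  have hμ : (0 : ℝ) < (α : ℝ) ^ 2 := by positivity
  have h1 : ‖birman m ((α : ℝ) ^ 2) f‖ ≤ κ ^ 2 / (α : ℝ) ^ 2 * ‖f‖ :=
    (ContinuousLinearMap.le_opNorm _ _).trans (by gcongr; exact h.norm_birman_le hμ)
  have h2 : ‖mulOp m (green ((α : ℝ) ^ 2) (mulOp m₁ f))‖ ≤ κ * (1 / (α : ℝ) ^ 2 * (κ * κ * ‖f‖)) :=
    (norm_mulOp_apply_le h.cont_m h.m_le _).trans (by
      gcongr
      refine (norm_green_apply_le hμ _).trans ?_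
      gcongr
      exact norm_mulOp_apply_le h.cont_m₁ h.m₁_le_sq _)
  unfold defect
  calc _ ≤ κ ^ 2 / (α : ℝ) ^ 2 * ‖f‖ + κ * (1 / (α : ℝ) ^ 2 * (κ * κ * ‖f‖)) := add_le_add h1 h2
    _ = _ := by ring

/-- Since `U y₀` is not an eigenvalue of `H`, compactness makes the defect small on functions that
are concentrated near the energy `U y₀`. -/
theorem exists_defect_le_single (h : Flow U U₁ U₂ m m₁ m₂ κ) {α : ℤ} (hα : α ≠ 0) {C : ℝ}
    (hs : SqrtBounds m m₁ α C) (y₀ : ℝ) {η : ℝ} (hη : 0 < η) :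
    ∃ M : ℝ, 0 ≤ M ∧ ∀ f, defect m m₁ α f ≤ η * ‖f‖ + M * ‖H U m α f - (U y₀ : ℂ) • f‖ := by
  have hμ := one_le_sq_int hα
  set X : L2 →L[ℂ] L2 := H U m α - (U y₀ : ℂ) • 1 with hX
  have hXf : ∀ f, X f = H U m α f - (U y₀ : ℂ) • f := fun f => rfl
  have hsym : (X : L2 →ₗ[ℂ] L2).IsSymmetric := by
    intro f g
    have h1 : inner ℂ (H U m α f) g = inner ℂ f (H U m α g) := hs.H_isSymmetric U f g
    change inner ℂ (X f) g = inner ℂ f (X g)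
    rw [hXf, hXf, inner_sub_left, inner_sub_right, h1, inner_smul_left, inner_smul_right,
      Complex.conj_ofReal]
  have hinj : ∀ f, X f = 0 → f = 0 := fun f hf =>
    h.H_injective hα hs y₀ (sub_eq_zero.1 ((hXf f).symm.trans hf))
  have hB : ∀ a f, HasWeakDeriv ((green ((α : ℝ) ^ 2) * mulOp a) f)
      ((greenDeriv ((α : ℝ) ^ 2) * mulOp a) f) := fun a f => hasWeakDeriv_green hμ _
  obtain ⟨M₁, h1, k1⟩ := exists_bound_mulOp_comp h.cont_m h.m_le h.tendsto_m (hB m) hsym hinj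
    (half_pos hη)
  obtain ⟨M₂, h2, k2⟩ := exists_bound_mulOp_comp h.cont_m h.m_le h.tendsto_m (hB m₁) hsym hinj
    (half_pos hη)
  refine ⟨M₁ + M₂, by positivity, fun f => ?_⟩
  have e1 : ‖birman m ((α : ℝ) ^ 2) f‖ ≤ _ := k1 f
  have e2 : ‖mulOp m (green ((α : ℝ) ^ 2) (mulOp m₁ f))‖ ≤ _ := k2 f
  unfold defect
  rw [hXf] at e1 e2
  linarith

/-- The bound of `exists_defect_le_single`, uniformly in the energy and in `α`. -/
theorem exists_defect_le (h : Flow U U₁ U₂ m m₁ m₂ κ) {C : ℝ}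
    (hs : ∀ α : ℤ, α ≠ 0 → SqrtBounds m m₁ α C) {a b : ℝ}
    (hab : ∀ E ∈ Set.Icc a b, ∃ y, U y = E) {η : ℝ} (hη : 0 < η) :
    ∃ M : ℝ, 0 ≤ M ∧ ∀ α : ℤ, α ≠ 0 → ∀ E ∈ Set.Icc a b, ∀ f,
      defect m m₁ α f ≤ η * ‖f‖ + M * ‖H U m α f - (E : ℂ) • f‖ := by
  have hκ := h.one_le
  have h1 : ∀ α : ℤ, ∃ M : ℝ, 0 ≤ M ∧ (α ≠ 0 → ∀ E ∈ Set.Icc a b, ∀ f,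
      defect m m₁ α f ≤ η * ‖f‖ + M * ‖H U m α f - (E : ℂ) • f‖) := by
    intro α
    by_cases hα : α = 0
    · exact ⟨0, le_rfl, fun h => (h hα).elim⟩
    have h2 : ∃ M : ℝ, 0 ≤ M ∧ ∀ E ∈ Set.Icc a b, ∀ f,
        defect m m₁ α f ≤ η * ‖f‖ + M * ‖H U m α f - (E : ℂ) • f‖ := by
      refine isCompact_Icc.induction_on (p := fun s : Set ℝ => ∃ M : ℝ, 0 ≤ M ∧ ∀ E ∈ s, ∀ f,
        defect m m₁ α f ≤ η * ‖f‖ + M * ‖H U m α f - (E : ℂ) • f‖) ⟨0, le_rfl, by simp⟩ ?_ ?_ ?_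
      · rintro s t hst ⟨M, hM, k⟩
        exact ⟨M, hM, fun E hE => k E (hst hE)⟩
      · rintro s t ⟨M, hM, k⟩ ⟨M', hM', k'⟩
        refine ⟨M + M', by positivity, fun E hE f => ?_⟩
        have p1 : 0 ≤ M * ‖H U m α f - (E : ℂ) • f‖ := by positivity
        have p2 : 0 ≤ M' * ‖H U m α f - (E : ℂ) • f‖ := by positivity
        rcases hE with hE | hE
        · linarith [k E hE f]
        · linarith [k' E hE f]
      · intro E₀ hE₀
        obtain ⟨y, rfl⟩ := hab E₀ hE₀
        obtain ⟨M, hM, k⟩ := h.exists_defect_le_single hα (hs α hα) y (half_pos hη)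
        refine ⟨Metric.ball (U y) (η / (2 * (M + 1))), mem_nhdsWithin_of_mem_nhds
          (Metric.ball_mem_nhds _ (by positivity)), M, hM, fun E hE f => ?_⟩
        rw [Metric.mem_ball, Real.dist_eq] at hE
        have e1 : ‖H U m α f - (U y : ℂ) • f‖ ≤ ‖H U m α f - (E : ℂ) • f‖ + |E - U y| * ‖f‖ := by
          have : H U m α f - (U y : ℂ) • f = (H U m α f - (E : ℂ) • f) +
              ((E - U y : ℝ) : ℂ) • f := by push_cast; rw [sub_smul]; abel
          rw [this]
          refine (norm_add_le _ _).trans ?_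
          rw [norm_smul, Complex.norm_real, Real.norm_eq_abs]
        have e2 : M * |E - U y| ≤ η / 2 := by
          have h3 : |E - U y| * (2 * (M + 1)) ≤ η := ((lt_div_iff₀ (by positivity)).1 hE).le
          nlinarith [abs_nonneg (E - U y)]
        calc defect m m₁ α f ≤ η / 2 * ‖f‖ + M * ‖H U m α f - (U y : ℂ) • f‖ := k f
          _ ≤ η / 2 * ‖f‖ + M * (‖H U m α f - (E : ℂ) • f‖ + |E - U y| * ‖f‖) := by gcongr
          _ = η / 2 * ‖f‖ + M * ‖H U m α f - (E : ℂ) • f‖ + M * |E - U y| * ‖f‖ := by ring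
          _ ≤ η / 2 * ‖f‖ + M * ‖H U m α f - (E : ℂ) • f‖ + η / 2 * ‖f‖ := by gcongr
          _ = _ := by ring
    obtain ⟨M, hM, k⟩ := h2
    exact ⟨M, hM, fun _ => k⟩
  choose M hM k using h1
  obtain ⟨N, hN⟩ := exists_nat_ge ((κ ^ 2 + κ ^ 3) / η)
  have hsum : 0 ≤ ∑ α ∈ Finset.Icc (-(N : ℤ)) N, M α := Finset.sum_nonneg fun α _ => hM α
  refine ⟨_, hsum, fun α hα E hE f => ?_⟩
  by_cases hαN : α ∈ Finset.Icc (-(N : ℤ)) N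
  · have : M α ≤ ∑ α ∈ Finset.Icc (-(N : ℤ)) N, M α :=
      Finset.single_le_sum (fun α _ => hM α) hαN
    refine (k α hα E hE f).trans ?_
    gcongr
  · -- for large `α` the defect is small without any compactness
    have h3 : (N : ℝ) ≤ (α : ℝ) ^ 2 := by
      have : (N : ℤ) ≤ α ^ 2 := by
        rw [Finset.mem_Icc, ← abs_le, not_le] at hαN
        have h5 : |α| ≤ α ^ 2 := by
          rw [← sq_abs]
          exact le_self_pow₀ (Int.one_le_abs hα) two_ne_zero
        omega
      exact_mod_cast this
    have h4 : (κ ^ 2 + κ ^ 3) / (α : ℝ) ^ 2 ≤ η := by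
      have hμ : (0 : ℝ) < (α : ℝ) ^ 2 := by positivity
      rw [div_le_iff₀ hμ]
      have := (div_le_iff₀ hη).1 (hN.trans h3)
      linarith
    have h5 : defect m m₁ α f ≤ η * ‖f‖ := (h.defect_le hα f).trans (by gcongr)
    have h6 : 0 ≤ (∑ α ∈ Finset.Icc (-(N : ℤ)) N, M α) * ‖H U m α f - (E : ℂ) • f‖ := by positivity
    linarith

/-- The derivative `U'` is bounded below on functions localized near an energy of `[U y₁, U y₂]`. -/
theorem exists_shear_lower (h : Flow U U₁ U₂ m m₁ m₂ κ) {a b y₁ y₂ : ℝ} (ha : U y₁ < a)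
    (hb : b < U y₂) : ∃ θ C : ℝ, 0 < θ ∧ 0 ≤ C ∧ ∀ E ∈ Set.Icc a b, ∀ f : L2,
      θ * ‖f‖ ^ 2 ≤ (inner ℂ (mulOp U₁ f) f).re + C * ‖mulOp U f - (E : ℂ) • f‖ ^ 2 := by
  by_cases hE : (Set.Icc a b).Nonempty
  swap
  · rw [Set.not_nonempty_iff_eq_empty] at hE
    exact ⟨1, 0, one_pos, le_rfl, by simp [hE]⟩
  have hab : a ≤ b := Set.nonempty_Icc.1 hE
  have hy : y₁ ≤ y₂ := (h.strictMono.lt_iff_lt.1 (by linarith)).le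
  obtain ⟨z, -, hz⟩ := (isCompact_Icc (a := y₁) (b := y₂)).exists_isMinOn
    ⟨y₁, by simp [hy]⟩ h.cont_U₁.continuousOn
  set d := min (a - U y₁) (U y₂ - b) with hd
  have hd0 : 0 < d := lt_min (by linarith) (by linarith)
  have hθ := h.U₁_pos z
  refine ⟨U₁ z, U₁ z / d ^ 2, hθ, by positivity, fun E hE f => ?_⟩
  have hpt : ∀ y, U₁ z ≤ U₁ y + U₁ z / d ^ 2 * (U y - E) ^ 2 := by
    intro y
    have far : d ≤ |U y - E| → U₁ z ≤ U₁ y + U₁ z / d ^ 2 * (U y - E) ^ 2 := fun h1 => by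
      have h2 : d ^ 2 ≤ (U y - E) ^ 2 := by rw [← sq_abs (U y - E)]; gcongr
      calc U₁ z = U₁ z / d ^ 2 * d ^ 2 := by field_simp
        _ ≤ U₁ z / d ^ 2 * (U y - E) ^ 2 := by gcongr
        _ ≤ _ := by linarith [h.U₁_pos y]
    by_cases h1 : y < y₁
    · have := h.strictMono h1
      exact far ((min_le_left _ _).trans (le_trans (by linarith [hE.1]) (neg_le_abs _)))
    by_cases h2 : y₂ < y
    · have := h.strictMono h2
      exact far ((min_le_right _ _).trans (le_trans (by linarith [hE.2]) (le_abs_self _)))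
    · have h3 := isMinOn_iff.1 hz y ⟨not_lt.1 h1, not_lt.1 h2⟩
      have : 0 ≤ U₁ z / d ^ 2 * (U y - E) ^ 2 := by positivity
      linarith
  have cE : Continuous fun y => U y - E := h.cont_U.sub continuous_const
  have bE : ∀ y, |U y - E| ≤ κ + |E| := fun y => (abs_sub _ _).trans (by linarith [h.U_le y])
  have eE : mulOp U f - (E : ℂ) • f = mulOp (fun y => U y - E) f := by
    refine Lp.ext ?_
    filter_upwards [Lp.coeFn_sub (mulOp U f) ((E : ℂ) • f), Lp.coeFn_smul (E : ℂ) f,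
      coeFn_mulOp h.cont_U h.U_le f, coeFn_mulOp cE bE f] with y e1 e2 e3 e4
    rw [e1, Pi.sub_apply, e2, e3, e4, Pi.smul_apply, smul_eq_mul]
    push_cast; ring
  obtain ⟨i1, j1⟩ := re_inner_mulOp h.cont_U₁ h.U₁_le f
  obtain ⟨i2, j2⟩ := norm_mulOp_sq cE bE f
  rw [eE, j1, j2, L2.norm_sq_eq_integral, ← integral_const_mul, ← integral_const_mul,
    ← integral_add i1 (i2.const_mul _)]
  refine integral_mono ((integrable_norm_sq f).const_mul _) (i1.add (i2.const_mul _)) fun y => ?_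
  have := mul_le_mul_of_nonneg_right (hpt y) (sq_nonneg ‖f y‖)
  linarith

/-- The absorption of errors at the end of the Mourre estimate: `F`, `G`, `p` and `X` stand for
`‖f‖`, `‖S f‖`, the defect and `‖(H - E) f‖`. -/
theorem mourre_absorb {θ D B C κ c η M F G p X V u t : ℝ} (hθ : 0 < θ) (hD : 0 ≤ D)
    (hB : B = θ + 2 * D * C ^ 2 * (1 + κ ^ 2) + 8 * c ^ 2 / θ) (hη : η ^ 2 = θ / (16 * B))
    (hp0 : 0 ≤ p) (hp : p ≤ η * F + M * X) (e3 : F ^ 2 ≤ 2 * G ^ 2 + 2 * p ^ 2)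
    (e5 : θ * G ^ 2 ≤ u + D * V) (e2 : V ≤ 2 * C ^ 2 * (X ^ 2 + κ ^ 2 * p ^ 2))
    (e4 : u - 2 * (c * p * F) ≤ t) :
    θ / 4 * F ^ 2 ≤ t + (B + 2 * B * M ^ 2) * X ^ 2 := by
  have hB0 : 0 < B := by rw [hB]; positivity
  have e6 : 2 * (c * p * F) ≤ θ / 8 * F ^ 2 + 8 * c ^ 2 / θ * p ^ 2 := by
    have h1 : 0 ≤ (θ * F - 8 * (c * p)) ^ 2 / (8 * θ) := by positivity
    have h2 : (θ * F - 8 * (c * p)) ^ 2 / (8 * θ) =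
        θ / 8 * F ^ 2 + 8 * c ^ 2 / θ * p ^ 2 - 2 * (c * p * F) := by field_simp; ring
    linarith
  have e7 : B * p ^ 2 ≤ θ / 8 * F ^ 2 + 2 * B * M ^ 2 * X ^ 2 := by
    have h3 : p ^ 2 ≤ 2 * η ^ 2 * F ^ 2 + 2 * M ^ 2 * X ^ 2 := by
      calc p ^ 2 ≤ (η * F + M * X) ^ 2 := by gcongr
        _ ≤ _ := by nlinarith [sq_nonneg (η * F - M * X)]
    calc B * p ^ 2 ≤ B * (2 * η ^ 2 * F ^ 2 + 2 * M ^ 2 * X ^ 2) := by gcongr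
      _ = _ := by rw [hη]; field_simp; ring
  have e8 : D * V ≤ D * (2 * C ^ 2 * (X ^ 2 + κ ^ 2 * p ^ 2)) := by gcongr
  have e9 : θ * p ^ 2 + D * (2 * C ^ 2 * (X ^ 2 + κ ^ 2 * p ^ 2)) + 8 * c ^ 2 / θ * p ^ 2 ≤
      B * p ^ 2 + B * X ^ 2 := by
    have q1 : 0 ≤ 2 * D * C ^ 2 * p ^ 2 := by positivity
    have q2 : 0 ≤ 2 * D * C ^ 2 * κ ^ 2 * X ^ 2 := by positivity
    have q3 : 0 ≤ 8 * c ^ 2 / θ * X ^ 2 := by positivity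
    have q4 : 0 ≤ θ * X ^ 2 := by positivity
    rw [hB]
    linarith
  have e10 : θ * F ^ 2 ≤ θ * (2 * G ^ 2 + 2 * p ^ 2) := by gcongr
  linarith

/-- The Mourre estimate: the commutator of `∂_y` with `H` is positive near an energy in the range of
`U`, uniformly in `α`. -/
theorem exists_mourre (h : Flow U U₁ U₂ m m₁ m₂ κ) {C : ℝ}
    (hs : ∀ α : ℤ, α ≠ 0 → SqrtBounds m m₁ α C) {a b y₁ y₂ : ℝ} (ha : U y₁ < a) (hb : b < U y₂) :
    ∃ θ M : ℝ, 0 < θ ∧ 0 ≤ M ∧ ∀ α : ℤ, α ≠ 0 → ∀ E ∈ Set.Icc a b, ∀ T, HasComm (H U m α) T →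
      ∀ f, θ * ‖f‖ ^ 2 ≤ (inner ℂ (T f) f).re + M * ‖H U m α f - (E : ℂ) • f‖ ^ 2 := by
  have hκ := h.one_le
  have hrange : ∀ E ∈ Set.Icc a b, ∃ y, U y = E := fun E hE =>
    mem_range_of_exists_le_of_exists_ge h.cont_U ⟨y₁, by linarith [hE.1]⟩ ⟨y₂, by linarith [hE.2]⟩
  obtain ⟨θ, D, hθ, hD, hlow⟩ := h.exists_shear_lower ha hb
  set c := κ * (κ + |C|) with hc
  have hc0 : 0 ≤ c := by positivity
  -- the final loss is `B * (defect ^ 2 + ‖(H - E) f‖ ^ 2)`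
  set B := θ + 2 * D * C ^ 2 * (1 + κ ^ 2) + 8 * c ^ 2 / θ with hB
  have hB0 : 0 < B := by positivity
  obtain ⟨M, hM, hdef⟩ := h.exists_defect_le hs hrange
    (show 0 < √(θ / (16 * B)) from Real.sqrt_pos.2 (by positivity))
  refine ⟨θ / 4, B + 2 * B * M ^ 2, by positivity, by positivity, fun α hα E hE T hT f => ?_⟩
  have hsα := hs α hα
  obtain ⟨S₁, S₂, hS₁, -, nS₁, -⟩ := hsα.hasComm2
  have hTeq : T = S m α * (mulOp U * S₁ + mulOp U₁ * S m α) + S₁ * (mulOp U * S m α) :=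
    hT.unique (hS₁.mul (h.hasComm_U.mul hS₁))
  set g := S m α f with hg
  set p := defect m m₁ α f with hp
  set X := ‖H U m α f - (E : ℂ) • f‖ with hX
  have hp0 : 0 ≤ p := defect_nonneg _ _ _ _
  have hX0 : 0 ≤ X := norm_nonneg _
  have hKp : ‖birman m ((α : ℝ) ^ 2) f‖ ≤ p := le_add_of_nonneg_right (norm_nonneg _)
  have hsub : ‖f - g‖ ≤ p := (hsα.norm_sub_le f).trans hKp
  have hS₁f : ‖S₁ f‖ ≤ (κ + |C|) * p := by
    have h1 := hsα.norm_comm_le S₁ hS₁ f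
    have h2 := h.norm_birmanDeriv_le α f
    have h3 : ‖S₁‖ * ‖f - g‖ ≤ |C| * p :=
      mul_le_mul (nS₁.trans (le_abs_self C)) hsub (norm_nonneg _) (abs_nonneg _)
    linarith
  have hgf : ‖g‖ ≤ ‖f‖ := hsα.norm_S_apply_le f
  have hEκ : |E| ≤ κ := by obtain ⟨y, rfl⟩ := hrange E hE; exact h.U_le y
  have e1 : ‖mulOp U g - (E : ℂ) • g‖ ≤ |C| * (X + κ * p) := by
    have h1 : mulOp U g - (E : ℂ) • g = Sinv m α ((H U m α f - (E : ℂ) • f) +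
        (E : ℂ) • birman m ((α : ℝ) ^ 2) f) := by
      have h2 : (H U m α f - (E : ℂ) • f) + (E : ℂ) • birman m ((α : ℝ) ^ 2) f =
          S m α (mulOp U g - (E : ℂ) • g) := by
        rw [map_sub, map_smul, hg, hsα.S_S_apply, H_apply, smul_sub]; abel
      rw [h2, hsα.Sinv_S_apply]
    rw [h1]
    refine ((Sinv m α).le_opNorm _).trans ?_
    refine mul_le_mul (hsα.norm_inv_le.trans (le_abs_self C)) ?_ (norm_nonneg _) (abs_nonneg _)
    refine (norm_add_le _ _).trans ?_
    rw [norm_smul, Complex.norm_real, Real.norm_eq_abs]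
    gcongr
  have e2 : ‖mulOp U g - (E : ℂ) • g‖ ^ 2 ≤ 2 * C ^ 2 * (X ^ 2 + κ ^ 2 * p ^ 2) := by
    calc _ ≤ (|C| * (X + κ * p)) ^ 2 := by gcongr
      _ = C ^ 2 * (X + κ * p) ^ 2 := by rw [mul_pow, sq_abs]
      _ ≤ C ^ 2 * (2 * (X ^ 2 + κ ^ 2 * p ^ 2)) := by
          gcongr
          nlinarith [sq_nonneg (X - κ * p)]
      _ = _ := by ring
  have e3 : ‖f‖ ^ 2 ≤ 2 * ‖g‖ ^ 2 + 2 * p ^ 2 := by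
    have h1 : ‖f‖ ≤ ‖g‖ + p := by
      have := norm_add_le g (f - g)
      rw [add_sub_cancel] at this
      linarith
    calc ‖f‖ ^ 2 ≤ (‖g‖ + p) ^ 2 := by gcongr
      _ ≤ _ := by nlinarith [sq_nonneg (‖g‖ - p)]
  have e4 : (inner ℂ (mulOp U₁ g) g).re - 2 * (c * p * ‖f‖) ≤ (inner ℂ (T f) f).re := by
    have s1 : ∀ x y, inner ℂ (S m α x) y = inner ℂ x (S m α y) := hsα.isSymmetric
    have s2 : ∀ x y, inner ℂ (S₁ x) y = inner ℂ x (S₁ y) := hS₁.isSymmetric hsα.isSymmetric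
    have h1 : inner ℂ (T f) f = inner ℂ (mulOp U (S₁ f)) g + inner ℂ (mulOp U₁ g) g +
        inner ℂ (mulOp U g) (S₁ f) := by
      have : T f = S m α (mulOp U (S₁ f) + mulOp U₁ g) + S₁ (mulOp U g) := by rw [hTeq]; rfl
      rw [this, inner_add_left, s1, s2, inner_add_left]
    have n1 : -(c * p * ‖f‖) ≤ (inner ℂ (mulOp U (S₁ f)) g : ℂ).re := by
      refine neg_le_of_abs_le ((Complex.abs_re_le_norm _).trans
        ((norm_inner_le_norm _ _).trans ?_))
      calc ‖mulOp U (S₁ f)‖ * ‖g‖ ≤ κ * ((κ + |C|) * p) * ‖f‖ := by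
            gcongr
            exact (norm_mulOp_apply_le h.cont_U h.U_le _).trans (by gcongr)
        _ = _ := by rw [hc]; ring
    have n2 : -(c * p * ‖f‖) ≤ (inner ℂ (mulOp U g) (S₁ f) : ℂ).re := by
      refine neg_le_of_abs_le ((Complex.abs_re_le_norm _).trans
        ((norm_inner_le_norm _ _).trans ?_))
      calc ‖mulOp U g‖ * ‖S₁ f‖ ≤ κ * ‖f‖ * ((κ + |C|) * p) := by
            gcongr
            exact (norm_mulOp_apply_le h.cont_U h.U_le _).trans (by gcongr)
        _ = _ := by rw [hc]; ring
    rw [h1, Complex.add_re, Complex.add_re]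
    linarith
  have e5 := hlow E hE g
  exact mourre_absorb hθ hD hB (Real.sq_sqrt (by positivity)) hp0
    (hdef α hα E hE f) e3 e5 e2 e4

end Flow

/-! ### The remainder -/

namespace Flow

variable {U U₁ U₂ m m₁ m₂ : ℝ → ℝ} {κ : ℝ}

theorem mulOp_m_injective (h : Flow U U₁ U₂ m m₁ m₂ κ) {f g : L2} (hfg : mulOp m f = mulOp m g) :
    f = g := by
  refine Lp.ext ?_
  have h1 : (mulOp m f : L2) =ᵐ[volume] mulOp m g := by rw [hfg]
  filter_upwards [h1, coeFn_mulOp h.cont_m h.m_le f, coeFn_mulOp h.cont_m h.m_le g] with y e1 e2 e3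
  rw [e2, e3] at e1
  exact mul_left_cancel₀ (Complex.ofReal_ne_zero.2 (h.m_pos y).ne') e1

theorem mulOp_m_div (h : Flow U U₁ U₂ m m₁ m₂ κ) {p : ℝ → ℝ} (hp : Continuous p)
    (hpm : ∀ y, |p y| ≤ κ * m y) : ∃ P : L2 →L[ℂ] L2, (∀ f, ‖P f‖ ≤ κ * ‖f‖) ∧
      ∀ f, mulOp m (P f) = mulOp p f := by
  have c : Continuous fun y => p y / m y := hp.div h.cont_m fun y => (h.m_pos y).ne'
  have b : ∀ y, |p y / m y| ≤ κ := fun y => by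
    rw [abs_div, abs_of_pos (h.m_pos y)]
    exact (div_le_iff₀ (h.m_pos y)).2 (hpm y)
  refine ⟨mulOp fun y => p y / m y, norm_mulOp_apply_le c b, fun f => ?_⟩
  rw [mulOp_mulOp h.cont_m h.m_le c b]
  congr 2
  funext y
  exact mul_div_cancel₀ _ (h.m_pos y).ne'

/-- The remainder `R` is an operator of first order, uniformly in `α`. -/
theorem exists_remainder_le (h : Flow U U₁ U₂ m m₁ m₂ κ) {C : ℝ}
    (hs : ∀ α : ℤ, α ≠ 0 → SqrtBounds m m₁ α C) :
    ∃ M : ℝ, 0 ≤ M ∧ ∀ α : ℤ, α ≠ 0 → ∀ f f₁ r, HasWeakDeriv f f₁ → IsRemainder m α f r →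
      ‖r‖ ≤ M * (‖f₁‖ + ‖f‖) := by
  have hκ := h.one_le
  obtain ⟨P, nP, hP⟩ := h.mulOp_m_div h.cont_m₁ h.m₁_le
  obtain ⟨Q, nQ, hQ⟩ := h.mulOp_m_div h.cont_m₂ h.m₂_le
  refine ⟨|C| * (3 + 5 * κ), by positivity, fun α hα f f₁ r hf hr => ?_⟩
  have hsα := hs α hα
  obtain ⟨I₁, I₂, hI₁, hI₂, n1, n2⟩ := hsα.hasComm2_inv
  obtain ⟨q, k, f₂, ⟨q₁, hq₁, hq⟩, hk, ⟨f₁', hf₁', hf₂⟩, rfl⟩ := hr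
  obtain rfl := hf₁'.unique hf
  set I := Sinv m α with hI
  obtain ⟨du, du'⟩ := hI₁.hasWeakDeriv2 hI₂ hf hf₂
  obtain ⟨dv, dv'⟩ := h.hasComm_m.hasWeakDeriv2 h.hasComm_m₁ du du'
  obtain rfl := hq₁.unique dv
  have hq' := hq.unique dv'
  have hkeq : k = (I f₂ + (2 : ℂ) • I₁ f₁' + I₂ f) + (2 : ℂ) • P (I f₁' + I₁ f) + Q (I f) := by
    refine h.mulOp_m_injective ?_
    rw [hk, hq']
    simp only [map_add, map_smul, hP, hQ]
  have hSI : S m α (I f₂) = f₂ := hsα.S_Sinv_apply f₂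
  have hr : S m α k - f₂ = S m α (((2 : ℂ) • I₁ f₁' + I₂ f) + (2 : ℂ) • P (I f₁' + I₁ f) + Q (I f)) := by
    rw [hkeq]
    nth_rewrite 2 [← hSI]
    rw [← map_sub]
    congr 1
    abel
  have b : ∀ {A : L2 →L[ℂ] L2}, ‖A‖ ≤ C → ∀ x, ‖A x‖ ≤ |C| * ‖x‖ := fun {A} hA x =>
    (A.le_opNorm x).trans (by gcongr; exact hA.trans (le_abs_self C))
  have two : ‖(2 : ℂ)‖ = 2 := by simp
  rw [hr]
  refine (hsα.norm_S_apply_le _).trans ?_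
  have b1 := b n1 f₁'
  have b2 := b n2 f
  have b3 := b hsα.norm_inv_le f₁'
  have b4 := b n1 f
  have b5 := b hsα.norm_inv_le f
  have b6 : ‖P (I f₁' + I₁ f)‖ ≤ κ * (|C| * ‖f₁'‖ + |C| * ‖f‖) :=
    (nP _).trans (mul_le_mul_of_nonneg_left (norm_add_le_of_le b3 b4) (by linarith))
  have b7 : ‖Q (I f)‖ ≤ κ * (|C| * ‖f‖) := (nQ _).trans (by gcongr)
  have p1 : 0 ≤ |C| * ‖f‖ := by positivity
  have p2 : 0 ≤ |C| * ‖f₁'‖ := by positivity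
  have p3 : 0 ≤ κ * (|C| * ‖f‖) := by positivity
  have p4 : 0 ≤ κ * (|C| * ‖f₁'‖) := by positivity
  calc _ ≤ 2 * ‖I₁ f₁'‖ + ‖I₂ f‖ + 2 * ‖P (I f₁' + I₁ f)‖ + ‖Q (I f)‖ := by
        refine (norm_add₃_le).trans ?_
        have k1 := norm_add_le ((2 : ℂ) • I₁ f₁') (I₂ f)
        have k2 : ‖(2 : ℂ) • I₁ f₁'‖ = 2 * ‖I₁ f₁'‖ := by rw [norm_smul, two]
        have k3 : ‖(2 : ℂ) • P (I f₁' + I₁ f)‖ = 2 * ‖P (I f₁' + I₁ f)‖ := by rw [norm_smul, two]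
        linarith
    _ ≤ _ := by linarith

end Flow

/-! ### The hypocoercive energy -/

theorem hasDerivAt_inner {ψ χ : ℝ → L2} {d e : L2} {t : ℝ} (h : HasDerivAt ψ d t)
    (h' : HasDerivAt χ e t) : HasDerivAt (fun s => (inner ℂ (ψ s) (χ s) : ℂ))
      (inner ℂ (ψ t) e + inner ℂ d (χ t)) t := h.inner ℂ h'

theorem hasDerivAt_re {u : ℝ → ℂ} {d : ℂ} {t : ℝ} (h : HasDerivAt u d t) :
    HasDerivAt (fun s => (u s).re) d.re t :=
  Complex.reCLM.hasFDerivAt.comp_hasDerivAt t h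

theorem hasDerivAt_im {u : ℝ → ℂ} {d : ℂ} {t : ℝ} (h : HasDerivAt u d t) :
    HasDerivAt (fun s => (u s).im) d.im t :=
  Complex.imCLM.hasFDerivAt.comp_hasDerivAt t h

theorem hasDerivAt_norm_sq {ψ : ℝ → L2} {d : L2} {t : ℝ} (h : HasDerivAt ψ d t) :
    HasDerivAt (fun s => ‖ψ s‖ ^ 2) (2 * (inner ℂ d (ψ t)).re) t := by
  have e : (fun s => ‖ψ s‖ ^ 2) = fun s => (inner ℂ (ψ s) (ψ s) : ℂ).re := by
    funext s
    rw [inner_self_eq_norm_sq_to_K]; norm_cast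
  rw [e]
  refine (hasDerivAt_re (hasDerivAt_inner h h)).congr_deriv ?_
  rw [Complex.add_re, ← inner_conj_symm, Complex.conj_re]
  ring

theorem hasDerivAt_clm (A : L2 →L[ℂ] L2) {ψ : ℝ → L2} {d : L2} {t : ℝ} (h : HasDerivAt ψ d t) :
    HasDerivAt (fun s => A (ψ s)) (A d) t :=
  (A.restrictScalars ℝ).hasFDerivAt.comp_hasDerivAt t h

/-- A differential form of Grönwall's inequality. -/
theorem le_exp_mul_of_deriv_le {X X' : ℝ → ℝ} {k : ℝ} (hc : ContinuousOn X (Set.Ici 0))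
    (hd : ∀ t, 0 < t → HasDerivAt X (X' t) t) (hle : ∀ t, 0 < t → X' t ≤ k * X t) {t : ℝ}
    (ht : 0 ≤ t) : X t ≤ Real.exp (k * t) * X 0 := by
  have hdY : ∀ t, 0 < t → HasDerivAt (fun s => Real.exp (-(k * s)) * X s)
      (Real.exp (-(k * t)) * -(k * 1) * X t + Real.exp (-(k * t)) * X' t) t := fun t ht =>
    (((hasDerivAt_id t).const_mul k).neg.exp).mul (hd t ht)
  have hanti : AntitoneOn (fun s => Real.exp (-(k * s)) * X s) (Set.Ici 0) := by
    refine antitoneOn_of_deriv_nonpos (convex_Ici 0) ?_ ?_ ?_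
    · exact (Continuous.continuousOn (by fun_prop)).mul hc
    · rw [interior_Ici]
      exact fun t ht => (hdY t ht).differentiableAt.differentiableWithinAt
    · rw [interior_Ici]
      intro t ht
      rw [(hdY t ht).deriv]
      nlinarith [Real.exp_pos (-(k * t)), hle t ht]
  have h1 := hanti (Set.self_mem_Ici (a := (0 : ℝ))) ht ht
  simp only [mul_zero, neg_zero, Real.exp_zero, one_mul] at h1
  calc X t = Real.exp (k * t) * (Real.exp (-(k * t)) * X t) := by
        rw [← mul_assoc, ← Real.exp_add]; simp
    _ ≤ _ := by gcongr

section Derivatives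

variable {H T : L2 →L[ℂ] L2} {τ α ν ε F : ℝ} {w v w₂ w' v' G : L2}

theorem HasComm.re_inner_apply (hH : (H : L2 →ₗ[ℂ] L2).IsSymmetric) (hT : HasComm H T)
    (hw : HasWeakDeriv w v) : 2 * (inner ℂ (H w) v).re = -(inner ℂ (T w) w).re := by
  have h1 : ∀ x y, inner ℂ (H x) y = inner ℂ x (H y) := hH
  have h2 := congrArg Complex.re ((hT _ _ hw).inner_eq hw)
  rw [inner_add_left, Complex.add_re, Complex.neg_re, h1 v w, ← inner_conj_symm,
    Complex.conj_re] at h2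
  linarith

theorem im_inner_apply_self (hH : (H : L2 →ₗ[ℂ] L2).IsSymmetric) (f : L2) :
    (inner ℂ (H f) f).im = 0 := by
  have h1 : inner ℂ (H f) f = inner ℂ f (H f) := hH f f
  have h2 := congrArg Complex.im h1
  rw [← inner_conj_symm f, Complex.conj_im] at h2
  linarith

theorem inner_velocity (P L y : L2) : inner ℂ (-(Complex.I * α) • P + (ν : ℂ) • L + (ν : ℂ) • G) y =
    Complex.I * α * inner ℂ P y + ν * inner ℂ L y + ν * inner ℂ G y := by
  rw [inner_add_left, inner_add_left, inner_smul_left, inner_smul_left, inner_smul_left]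
  simp

theorem re_I_mul_mul (z : ℂ) : (Complex.I * α * z).re = -(α * z.im) := by
  simp [mul_assoc]

theorem im_I_mul_mul (z : ℂ) : (Complex.I * α * z).im = α * z.re := by
  simp [mul_assoc]

theorem HasComm.hasWeakDeriv_regularized (hT : HasComm H T) (hε : ε ≠ 0) (hw : HasWeakDeriv w v) :
    HasWeakDeriv (H w + (ε : ℂ) • J ε (T w)) (H v + J ε (T w)) := by
  have h1 := (hT _ _ hw).add ((hasWeakDeriv_J hε (T w)).smul (ε : ℂ))
  rw [smul_smul, mul_inv_cancel₀ (Complex.ofReal_ne_zero.2 hε), one_smul] at h1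
  convert h1 using 1
  abel

/-- The equation satisfied by the mollified solution `w`; the term `ε J T w` comes from the
commutator of the mollifier `J` with `H`. -/
structure IsVelocity (H T : L2 →L[ℂ] L2) (α ν ε : ℝ) (w v w₂ w' v' G : L2) : Prop where
  hasWeakDeriv : HasWeakDeriv w v
  hasWeakDeriv' : HasWeakDeriv v w₂
  hasWeakDeriv_velocity : HasWeakDeriv w' v'
  eq : w' = -(Complex.I * α) • (H w + (ε : ℂ) • J ε (T w)) +
    (ν : ℂ) • (w₂ - ((α : ℂ) ^ 2) • w) + (ν : ℂ) • G

namespace IsVelocity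

theorem norm_J_apply (hτ : ‖T‖ ≤ τ) (w : L2) : ‖J ε (T w)‖ ≤ τ * ‖w‖ :=
  (norm_J_apply_le _ _).trans ((T.le_opNorm w).trans (by gcongr))

theorem inner_L (w w₂ y : L2) : inner ℂ (w₂ - ((α : ℂ) ^ 2) • w) y =
    inner ℂ w₂ y - ((α ^ 2 : ℝ) : ℂ) * inner ℂ w y := by
  rw [inner_sub_left, inner_smul_left]
  simp

theorem neg_le_re (x y : L2) : -(‖x‖ * ‖y‖) ≤ (inner ℂ x y : ℂ).re :=
  neg_le_of_abs_le ((Complex.abs_re_le_norm _).trans (norm_inner_le_norm _ _))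

theorem re_le (x y : L2) : (inner ℂ x y : ℂ).re ≤ ‖x‖ * ‖y‖ :=
  le_of_abs_le ((Complex.abs_re_le_norm _).trans (norm_inner_le_norm _ _))

theorem abs_im_le (x y : L2) : |(inner ℂ x y : ℂ).im| ≤ ‖x‖ * ‖y‖ :=
  (Complex.abs_im_le_norm _).trans (norm_inner_le_norm _ _)

theorem re_inner_self (x : L2) : (inner ℂ x x : ℂ).re = ‖x‖ ^ 2 := by
  rw [inner_self_eq_norm_sq_to_K]; norm_cast

theorem re_inner_velocity_le (h : IsVelocity H T α ν ε w v w₂ w' v' G)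
    (hH : (H : L2 →ₗ[ℂ] L2).IsSymmetric) (hτ : ‖T‖ ≤ τ) (hν : 0 ≤ ν) (hε : 0 ≤ ε) (hF : ‖G‖ ≤ F) :
    (inner ℂ w' w).re ≤ |α| * ε * τ * ‖w‖ ^ 2 - ν * ‖v‖ ^ 2 - ν * α ^ 2 * ‖w‖ ^ 2 +
      ν * F * ‖w‖ := by
  have e1 : (inner ℂ w₂ w : ℂ).re = -‖v‖ ^ 2 := by
    rw [h.hasWeakDeriv'.inner_eq h.hasWeakDeriv, Complex.neg_re, re_inner_self]
  have e2 : |α * (inner ℂ (J ε (T w)) w : ℂ).im| ≤ |α| * (τ * ‖w‖ * ‖w‖) := by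
    rw [abs_mul]
    gcongr
    exact (abs_im_le _ _).trans (by gcongr; exact norm_J_apply hτ w)
  have e3 : (inner ℂ G w : ℂ).re ≤ F * ‖w‖ := (re_le _ _).trans (by gcongr)
  rw [h.eq, inner_velocity, Complex.add_re, Complex.add_re, re_I_mul_mul, Complex.re_ofReal_mul,
    Complex.re_ofReal_mul, inner_L, Complex.sub_re, Complex.re_ofReal_mul, e1, re_inner_self,
    inner_add_left, Complex.add_im, im_inner_apply_self hH, inner_smul_left, Complex.conj_ofReal,
    Complex.im_ofReal_mul]
  have e4 := neg_le_of_abs_le e2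
  nlinarith

theorem re_inner_velocity_deriv_le (h : IsVelocity H T α ν ε w v w₂ w' v' G)
    (hH : (H : L2 →ₗ[ℂ] L2).IsSymmetric) (hT : HasComm H T) (hτ : ‖T‖ ≤ τ) (hν : 0 ≤ ν)
    (hε : 0 < ε) (hF : ‖G‖ ≤ F) :
    (inner ℂ v' v).re ≤ |α| * τ * ‖w‖ * ‖v‖ - ν * ‖w₂‖ ^ 2 - ν * α ^ 2 * ‖v‖ ^ 2 +
      ν * F * ‖w₂‖ := by
  have e1 : (inner ℂ w w₂ : ℂ).re = -‖v‖ ^ 2 := by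
    have := h.hasWeakDeriv.inner_eq h.hasWeakDeriv'
    rw [← re_inner_self, this, Complex.neg_re, neg_neg]
  have e2 : |α * (inner ℂ (J ε (T w)) v : ℂ).im| ≤ |α| * (τ * ‖w‖ * ‖v‖) := by
    rw [abs_mul]
    gcongr
    exact (abs_im_le _ _).trans (by gcongr; exact norm_J_apply hτ w)
  have e3 : -(F * ‖w₂‖) ≤ (inner ℂ G w₂ : ℂ).re :=
    le_trans (by gcongr) (neg_le_re G w₂)
  have e4 : (inner ℂ (H w + (ε : ℂ) • J ε (T w)) w₂ : ℂ).im = -(inner ℂ (J ε (T w)) v : ℂ).im := by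
    have := (hT.hasWeakDeriv_regularized hε.ne' h.hasWeakDeriv).inner_eq h.hasWeakDeriv'
    have h1 := congrArg Complex.im this
    rw [inner_add_left, Complex.add_im, im_inner_apply_self hH, Complex.neg_im] at h1
    linarith
  rw [h.hasWeakDeriv_velocity.inner_eq h.hasWeakDeriv', h.eq, inner_velocity, Complex.neg_re,
    Complex.add_re, Complex.add_re, re_I_mul_mul, Complex.re_ofReal_mul,
    Complex.re_ofReal_mul, inner_L, Complex.sub_re, Complex.re_ofReal_mul, e1, re_inner_self, e4]
  have e5 := neg_le_of_abs_le e2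
  nlinarith

theorem im_inner_velocity_le (h : IsVelocity H T α ν ε w v w₂ w' v' G)
    (hH : (H : L2 →ₗ[ℂ] L2).IsSymmetric) (hT : HasComm H T) (hτ : ‖T‖ ≤ τ) (hν : 0 ≤ ν)
    (hε : 0 ≤ ε) (hF : ‖G‖ ≤ F) :
    α * (inner ℂ w' v).im ≤ -(α ^ 2 * (inner ℂ (T w) w).re) / 2 + α ^ 2 * ε * τ * ‖w‖ * ‖v‖ +
      ν * |α| * ‖w₂‖ * ‖v‖ + ν * |α| ^ 3 * ‖w‖ * ‖v‖ + ν * |α| * F * ‖v‖ := by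
  have e1 : (inner ℂ (H w) v : ℂ).re = -(inner ℂ (T w) w).re / 2 := by
    have := hT.re_inner_apply hH h.hasWeakDeriv
    linarith
  have e2 : (inner ℂ (J ε (T w)) v : ℂ).re ≤ τ * ‖w‖ * ‖v‖ :=
    (re_le _ _).trans (by gcongr; exact norm_J_apply hτ w)
  have e3 : α * (inner ℂ G v : ℂ).im ≤ |α| * (F * ‖v‖) := by
    refine (le_abs_self _).trans ?_
    rw [abs_mul]
    gcongr
    exact (abs_im_le _ _).trans (by gcongr)
  have e4 : α * (inner ℂ w₂ v : ℂ).im ≤ |α| * (‖w₂‖ * ‖v‖) := by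
    refine (le_abs_self _).trans ?_
    rw [abs_mul]
    gcongr
    exact abs_im_le _ _
  have e5 : -(α ^ 3 * (inner ℂ w v : ℂ).im) ≤ |α| ^ 3 * (‖w‖ * ‖v‖) := by
    refine (neg_le_abs _).trans ?_
    rw [abs_mul, abs_pow]
    gcongr
    exact abs_im_le _ _
  rw [h.eq, inner_velocity, Complex.add_im, Complex.add_im, im_I_mul_mul, Complex.im_ofReal_mul,
    Complex.im_ofReal_mul, inner_L, Complex.sub_im, Complex.im_ofReal_mul, inner_add_left,
    Complex.add_re, e1, inner_smul_left, Complex.conj_ofReal, Complex.re_ofReal_mul]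
  have f2 : α ^ 2 * ε * (inner ℂ (J ε (T w)) v : ℂ).re ≤ α ^ 2 * ε * (τ * ‖w‖ * ‖v‖) := by gcongr
  have f3 := mul_le_mul_of_nonneg_left e3 hν
  have f4 := mul_le_mul_of_nonneg_left e4 hν
  have f5 := mul_le_mul_of_nonneg_left e5 hν
  linarith

end IsVelocity

end Derivatives

/-! ### Absorbing the errors in the energy inequality -/

theorem two_mul_le_add_div {s : ℝ} (hs : 0 < s) (p q : ℝ) : 2 * (p * q) ≤ s * p ^ 2 + q ^ 2 / s := by
  have h1 : 0 ≤ (s * p - q) ^ 2 / s := by positivity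
  have h2 : (s * p - q) ^ 2 / s = s * p ^ 2 + q ^ 2 / s - 2 * (p * q) := by field_simp; ring
  linarith

set_option maxHeartbeats 1000000 in
/-- The weights of the energy: `a = l ^ 4` and `b = l ^ 3` for a small `l`, so that the
errors are controlled by `a ^ 2 ≪ b` and `b ^ 2 ≪ a`. -/
theorem energy_absorb {l θ τ δ β ε x y z F t₁ t₂ t₃ P : ℝ} (hl : 0 < l) (hl1 : l ≤ 1 / 4) (hθ : 0 < θ)
    (hlτ : 32 * l * τ ^ 2 ≤ θ) (hτ : 0 ≤ τ) (hδ : 0 < δ) (hδ1 : δ ≤ 1) (hβ : 1 ≤ β) (hε : 0 ≤ ε)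
    (hε1 : 32 * (β * ε * τ) ≤ l ^ 3 * θ * δ) (hε2 : 16 * (β * ε * τ) ≤ θ * δ)
    (hε3 : 4 * (β * ε * τ) ≤ δ) (hx : 0 ≤ x) (hy : 0 ≤ y)
    (h₁ : t₁ ≤ β * ε * τ * x ^ 2 - δ ^ 3 * β ^ 2 * y ^ 2 - δ ^ 3 * β ^ 2 * x ^ 2 + δ ^ 3 * β * F * x)
    (h₂ : t₂ ≤ τ * x * y - δ ^ 3 * z ^ 2 - δ ^ 3 * β ^ 2 * y ^ 2 + δ ^ 3 * F * z)
    (h₃ : t₃ ≤ -P / 2 + β * ε * τ * x * y + δ ^ 3 * β * z * y + δ ^ 3 * β ^ 2 * x * y +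
      δ ^ 3 * β * F * y) (hP : θ / 2 * x ^ 2 ≤ P) :
    2 * t₁ + l ^ 4 * δ ^ 2 * (2 * t₂) + l ^ 3 * δ * (2 * t₃) ≤
      -(δ * (l ^ 3 * θ / 8 * x ^ 2 + δ ^ 2 * y ^ 2 / 2)) +
        (8 / (l ^ 3 * θ) + 2) * δ ^ 5 * β ^ 2 * F ^ 2 := by
  have hb0 : 0 < l ^ 3 := by positivity
  have hb1 : l ^ 3 ≤ 1 / 4 := by
    calc l ^ 3 ≤ (1 / 4) ^ 3 := by gcongr
      _ ≤ 1 / 4 := by norm_num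
  have ha1 : l ^ 4 ≤ 1 / 4 := by
    calc l ^ 4 ≤ (1 / 4) ^ 4 := by gcongr
      _ ≤ 1 / 4 := by norm_num
  have hβ2 : 1 ≤ β ^ 2 := one_le_pow₀ hβ
  -- the diffusive gain
  set D := δ ^ 3 * β ^ 2 * y ^ 2 with hD
  have hD0 : 0 ≤ D := by positivity
  have hDy : δ ^ 3 * y ^ 2 ≤ D := by
    rw [hD, mul_right_comm]
    exact le_mul_of_one_le_right (by positivity) hβ2
  have m1 : l ^ 4 * δ ^ 2 * (2 * (τ * x * y)) ≤ l ^ 3 * θ / 8 * (δ * x ^ 2) + D / 4 := by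
    have q := two_mul_le_add_div (s := l ^ 3 * θ / 8 * δ) (by positivity) x (l ^ 4 * δ ^ 2 * τ * y)
    have r : (l ^ 4 * δ ^ 2 * τ * y) ^ 2 / (l ^ 3 * θ / 8 * δ) =
        8 * l ^ 4 * (l * τ ^ 2) / θ * (δ ^ 3 * y ^ 2) := by field_simp
    have r2 : 8 * l ^ 4 * (l * τ ^ 2) / θ ≤ 1 / 4 := by
      rw [div_le_iff₀ hθ]
      have p1 : l ^ 4 * (l * τ ^ 2) ≤ 1 * (l * τ ^ 2) := by gcongr; linarith only [ha1]
      linarith only [p1, hlτ]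
    have r3 : 8 * l ^ 4 * (l * τ ^ 2) / θ * (δ ^ 3 * y ^ 2) ≤ 1 / 4 * (δ ^ 3 * y ^ 2) := by gcongr
    linarith only [q, r, r3, hDy]
  have m2 : l ^ 3 * δ * (2 * (δ ^ 3 * β * z * y)) ≤ l ^ 4 * δ ^ 2 * (δ ^ 3 * z ^ 2) + D / 4 := by
    have q := two_mul_le_add_div (s := l ^ 4 * δ ^ 5) (by positivity) z (l ^ 3 * δ ^ 4 * β * y)
    have r : (l ^ 3 * δ ^ 4 * β * y) ^ 2 / (l ^ 4 * δ ^ 5) = l ^ 2 * D := by rw [hD]; field_simp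
    have r2 : l ^ 2 * D ≤ 1 / 4 * D := by
      gcongr
      nlinarith only [hl, hl1]
    linarith only [q, r, r2]
  have m3 : l ^ 3 * δ * (2 * (δ ^ 3 * β ^ 2 * x * y)) ≤ δ ^ 3 * β ^ 2 * x ^ 2 + D / 4 := by
    have q : 2 * (x * y) ≤ x ^ 2 + y ^ 2 := by nlinarith only [sq_nonneg (x - y)]
    have r : l ^ 3 * δ ≤ 1 / 4 := (mul_le_of_le_one_right hb0.le hδ1).trans hb1
    calc l ^ 3 * δ * (2 * (δ ^ 3 * β ^ 2 * x * y)) = l ^ 3 * δ * (δ ^ 3 * β ^ 2 * (2 * (x * y))) := by ring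
      _ ≤ 1 / 4 * (δ ^ 3 * β ^ 2 * (x ^ 2 + y ^ 2)) := by gcongr
      _ ≤ _ := by
          have : 0 ≤ δ ^ 3 * β ^ 2 * x ^ 2 := by positivity
          rw [hD]; linarith only [this, hD0]
  have m4 : 2 * (δ ^ 3 * β * F * x) ≤ l ^ 3 * θ / 8 * (δ * x ^ 2) +
      8 / (l ^ 3 * θ) * δ ^ 5 * β ^ 2 * F ^ 2 := by
    have q := two_mul_le_add_div (s := l ^ 3 * θ / 8 * δ) (by positivity) x (δ ^ 3 * β * F)
    have r : (δ ^ 3 * β * F) ^ 2 / (l ^ 3 * θ / 8 * δ) =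
        8 / (l ^ 3 * θ) * δ ^ 5 * β ^ 2 * F ^ 2 := by field_simp
    linarith only [q, r]
  have m5 : l ^ 4 * δ ^ 2 * (2 * (δ ^ 3 * F * z)) ≤ l ^ 4 * δ ^ 2 * (δ ^ 3 * z ^ 2) +
      δ ^ 5 * β ^ 2 * F ^ 2 := by
    have q : 2 * (F * z) ≤ z ^ 2 + F ^ 2 := by nlinarith only [sq_nonneg (F - z)]
    have r : l ^ 4 * (δ ^ 5 * F ^ 2) ≤ β ^ 2 * (δ ^ 5 * F ^ 2) := by
      gcongr
      linarith only [ha1, hβ2]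
    calc _ = l ^ 4 * δ ^ 5 * (2 * (F * z)) := by ring
      _ ≤ l ^ 4 * δ ^ 5 * (z ^ 2 + F ^ 2) := by gcongr
      _ ≤ _ := by linarith only [r]
  have m6 : l ^ 3 * δ * (2 * (δ ^ 3 * β * F * y)) ≤ D / 4 + δ ^ 5 * β ^ 2 * F ^ 2 := by
    have q := two_mul_le_add_div (s := β ^ 2 * δ ^ 3 / 4) (by positivity) y (l ^ 3 * δ ^ 4 * β * F)
    have r : (l ^ 3 * δ ^ 4 * β * F) ^ 2 / (β ^ 2 * δ ^ 3 / 4) = 4 * (l ^ 3) ^ 2 * (δ ^ 5 * F ^ 2) := by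
      field_simp
    have r2 : 4 * (l ^ 3) ^ 2 * (δ ^ 5 * F ^ 2) ≤ β ^ 2 * (δ ^ 5 * F ^ 2) := by
      gcongr
      nlinarith only [hb0, hb1, hβ2]
    rw [hD]
    linarith only [q, r, r2]
  have m7 : 2 * (β * ε * τ * x ^ 2) ≤ l ^ 3 * θ / 16 * (δ * x ^ 2) := by
    have p1 := mul_le_mul_of_nonneg_right hε1 (sq_nonneg x)
    linarith only [p1]
  have m8 : l ^ 3 * δ * (2 * (β * ε * τ * x * y)) ≤ l ^ 3 * θ / 16 * (δ * x ^ 2) + D / 4 := by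
    have q : 2 * (x * (δ * y)) ≤ x ^ 2 + δ ^ 2 * y ^ 2 := by nlinarith only [sq_nonneg (x - δ * y)]
    have h0 : 0 ≤ β * ε * τ := by positivity
    have r1 : l ^ 3 * (β * ε * τ) * x ^ 2 ≤ l ^ 3 * (θ * δ / 16) * x ^ 2 := by
      gcongr; linarith only [hε2]
    have r2 : l ^ 3 * (β * ε * τ) * (δ ^ 2 * y ^ 2) ≤ 1 * (δ / 4) * (δ ^ 2 * y ^ 2) := by
      gcongr
      · linarith only [hb1]
      · linarith only [hε3]
    calc _ = l ^ 3 * (β * ε * τ) * (2 * (x * (δ * y))) := by ring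
      _ ≤ l ^ 3 * (β * ε * τ) * (x ^ 2 + δ ^ 2 * y ^ 2) := by gcongr
      _ ≤ _ := by linarith only [r1, r2, hDy]
  have m9 : 0 ≤ l ^ 4 * δ ^ 2 * D := by positivity
  have hP' : l ^ 3 * δ * (θ / 2 * x ^ 2) ≤ l ^ 3 * δ * P := by gcongr
  have h₂' := mul_le_mul_of_nonneg_left h₂ (show 0 ≤ l ^ 4 * δ ^ 2 * 2 by positivity)
  have h₃' := mul_le_mul_of_nonneg_left h₃ (show 0 ≤ l ^ 3 * δ * 2 by positivity)
  have h₁' : 2 * t₁ ≤ 2 * (β * ε * τ * x ^ 2) - 2 * D - 2 * (δ ^ 3 * β ^ 2 * x ^ 2) +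
    2 * (δ ^ 3 * β * F * x) := by rw [hD]; linarith
  have hxx : 0 ≤ δ ^ 3 * β ^ 2 * x ^ 2 := by positivity
  clear_value D
  linarith only [m1, m2, m3, m4, m5, m6, m7, m8, m9, hP', h₂', h₃', h₁', hDy, hD0, hxx]

/-! ### Decay of localized solutions -/

/-- A solution of `∂_t ψ + i α H ψ - ν (∂_y² - α²) ψ = ν r`, where the forcing `r` is bounded by
`C ‖ψ‖_{H¹}`. -/
structure IsForcedSolution (H : L2 →L[ℂ] L2) (α ν C : ℝ) (ψ : ℝ → L2) : Prop where
  continuousOn : ContinuousOn ψ (Set.Ici 0)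
  equation : ∀ t, 0 < t → ∃ dψ ψ₁ ψ₂ r : L2, HasDerivAt ψ dψ t ∧ HasWeakDeriv (ψ t) ψ₁ ∧
    HasWeakDeriv ψ₁ ψ₂ ∧ ‖r‖ ≤ C * (‖ψ₁‖ + ‖ψ t‖) ∧
    dψ = -(Complex.I * α) • H (ψ t) + (ν : ℂ) • (ψ₂ - ((α : ℂ) ^ 2) • ψ t) + (ν : ℂ) • r

theorem re_inner_dissipation_le {H : L2 →L[ℂ] L2} {α ν C : ℝ} {f f₁ f₂ r d : L2}
    (hH : (H : L2 →ₗ[ℂ] L2).IsSymmetric) (hν : 0 ≤ ν) (h₁ : HasWeakDeriv f f₁)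
    (h₂ : HasWeakDeriv f₁ f₂) (hr : ‖r‖ ≤ C * (‖f₁‖ + ‖f‖))
    (hd : d = -(Complex.I * α) • H f + (ν : ℂ) • (f₂ - ((α : ℂ) ^ 2) • f) + (ν : ℂ) • r) :
    2 * (inner ℂ d f).re ≤ -(ν * ‖f₁‖ ^ 2) + (C ^ 2 + 2 * C) * ν * ‖f‖ ^ 2 := by
  have e1 : (inner ℂ f₂ f : ℂ).re = -‖f₁‖ ^ 2 := by
    rw [h₂.inner_eq h₁, Complex.neg_re, IsVelocity.re_inner_self]
  have e2 : (inner ℂ r f : ℂ).re ≤ C * (‖f₁‖ + ‖f‖) * ‖f‖ :=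
    (IsVelocity.re_le _ _).trans (by gcongr)
  have e3 : 2 * (C * (‖f₁‖ + ‖f‖) * ‖f‖) ≤ ‖f₁‖ ^ 2 + (C ^ 2 + 2 * C) * ‖f‖ ^ 2 := by
    nlinarith [sq_nonneg (‖f₁‖ - C * ‖f‖)]
  have e4 : ν * (2 * (inner ℂ r f : ℂ).re) ≤ ν * (‖f₁‖ ^ 2 + (C ^ 2 + 2 * C) * ‖f‖ ^ 2) := by
    gcongr; linarith
  rw [hd, inner_velocity, Complex.add_re, Complex.add_re, re_I_mul_mul, Complex.re_ofReal_mul,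
    Complex.re_ofReal_mul, IsVelocity.inner_L, Complex.sub_re, Complex.re_ofReal_mul, e1,
    IsVelocity.re_inner_self, im_inner_apply_self hH]
  have e5 : 0 ≤ ν * (α ^ 2 * ‖f‖ ^ 2) := by positivity
  linarith

theorem IsForcedSolution.norm_sq_le {H : L2 →L[ℂ] L2} {α ν C : ℝ} {ψ : ℝ → L2}
    (h : IsForcedSolution H α ν C ψ) (hH : (H : L2 →ₗ[ℂ] L2).IsSymmetric) (hν : 0 ≤ ν) {t : ℝ}
    (ht : 0 ≤ t) : ‖ψ t‖ ^ 2 ≤ Real.exp ((C ^ 2 + 2 * C) * ν * t) * ‖ψ 0‖ ^ 2 := by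
  choose! dψ ψ₁ ψ₂ r e1 e2 e3 e4 e5 using h.equation
  refine le_exp_mul_of_deriv_le (X := fun t => ‖ψ t‖ ^ 2) (h.continuousOn.norm.pow 2)
    (fun t ht => hasDerivAt_norm_sq (e1 t ht)) (fun t ht => ?_) ht
  have := re_inner_dissipation_le hH hν (e2 t ht) (e3 t ht) (e4 t ht) (e5 t ht)
  have h2 : 0 ≤ ν * ‖ψ₁ t‖ ^ 2 := by positivity
  linarith

/-- The energy of the pair `w, v`, where `v` stands for `∂_y w`. -/
def energy (l δ α : ℝ) (w v : L2) : ℝ :=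
  α ^ 2 * ‖w‖ ^ 2 + l ^ 4 * δ ^ 2 * ‖v‖ ^ 2 + l ^ 3 * δ * (α * (inner ℂ w v).im)

theorem abs_energy_sub_le {l δ α : ℝ} (hl : 0 < l) (hl1 : l ≤ 1 / 4) (hδ : 0 < δ) (w v : L2) :
    |energy l δ α w v - (α ^ 2 * ‖w‖ ^ 2 + l ^ 4 * δ ^ 2 * ‖v‖ ^ 2)| ≤
      (α ^ 2 * ‖w‖ ^ 2 + l ^ 4 * δ ^ 2 * ‖v‖ ^ 2) / 2 := by
  have h1 : |l ^ 3 * δ * (α * (inner ℂ w v).im)| ≤ l ^ 3 * δ * (|α| * (‖w‖ * ‖v‖)) := by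
    rw [abs_mul, abs_mul α, abs_of_pos (by positivity : 0 < l ^ 3 * δ)]
    gcongr
    exact IsVelocity.abs_im_le _ _
  have h2 : l ^ 3 * δ * (|α| * (‖w‖ * ‖v‖)) ≤ l ^ 2 * δ * (|α| * (‖w‖ * ‖v‖)) := by
    gcongr ?_ * δ * _
    exact pow_le_pow_of_le_one hl.le (by linarith) (by norm_num)
  have h3 := sq_nonneg (|α| * ‖w‖ - l ^ 2 * δ * ‖v‖)
  have h4 : (|α| * ‖w‖ - l ^ 2 * δ * ‖v‖) ^ 2 = α ^ 2 * ‖w‖ ^ 2 + l ^ 4 * δ ^ 2 * ‖v‖ ^ 2 -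
      2 * (l ^ 2 * δ * (|α| * (‖w‖ * ‖v‖))) := by
    rw [← sq_abs α]; ring
  unfold energy
  rw [add_sub_cancel_left]
  linarith

theorem hasDerivAt_energy {l δ α t : ℝ} {w v : ℝ → L2} {w' v' : L2} (hw : HasDerivAt w w' t)
    (hv : HasDerivAt v v' t) (h : HasWeakDeriv (w t) (v t)) (h' : HasWeakDeriv w' v') :
    HasDerivAt (fun s => energy l δ α (w s) (v s)) (α ^ 2 * (2 * (inner ℂ w' (w t)).re) +
      l ^ 4 * δ ^ 2 * (2 * (inner ℂ v' (v t)).re) +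
      l ^ 3 * δ * (2 * (α * (inner ℂ w' (v t)).im))) t := by
  have e : (inner ℂ (w t) v' + inner ℂ w' (v t) : ℂ).im = 2 * (inner ℂ w' (v t) : ℂ).im := by
    have h1 := congrArg Complex.im (h.inner_eq h')
    rw [Complex.neg_im, ← inner_conj_symm, Complex.conj_im] at h1
    rw [Complex.add_im]
    linarith
  refine ((((hasDerivAt_norm_sq hw).const_mul (α ^ 2)).add
    ((hasDerivAt_norm_sq hv).const_mul (l ^ 4 * δ ^ 2))).add
    (((hasDerivAt_im (hasDerivAt_inner hw hv)).const_mul α).const_mul (l ^ 3 * δ))).congr_deriv ?_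
  rw [e]
  ring

section Localized

variable {H T A A₁ A₂ : L2 →L[ℂ] L2} {α δ C K : ℝ} {ψ : ℝ → L2}

/-- The equation of the mollified localized solution `J A ψ`, for an operator `A` that commutes
with `H`. -/
theorem isVelocity_localized {ν ε : ℝ} (hε : ε ≠ 0) (hT : HasComm H T) (hA : HasComm A A₁)
    (hA₁ : HasComm A₁ A₂) (hAH : Commute A H) {f f₁ f₂ r d : L2} (h₁ : HasWeakDeriv f f₁)
    (h₂ : HasWeakDeriv f₁ f₂)
    (hd : d = -(Complex.I * α) • H f + (ν : ℂ) • (f₂ - ((α : ℂ) ^ 2) • f) + (ν : ℂ) • r) :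
    ∃ w₂, IsVelocity H T α ν ε (J ε (A f)) ((ε : ℂ)⁻¹ • (J ε (A f) - A f)) w₂ (J ε (A d))
      ((ε : ℂ)⁻¹ • (J ε (A d) - A d)) (J ε (A r - (2 : ℂ) • A₁ f₁ - A₂ f)) := by
  obtain ⟨d₁, d₂⟩ := hA.hasWeakDeriv2 hA₁ h₁ h₂
  have hv : (ε : ℂ)⁻¹ • (J ε (A f) - A f) = J ε (A f₁ + A₁ f) :=
    (hasWeakDeriv_J hε _).unique (d₁.J ε)
  refine ⟨_, hasWeakDeriv_J hε _, hv ▸ d₂.J ε, hasWeakDeriv_J hε _, ?_⟩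
  have hc : A (H f) = H (A f) := congrArg (fun X : L2 →L[ℂ] L2 => X f) hAH
  rw [hd, ← hT.J_apply hε (A f), ← hc]
  simp only [map_add, map_sub, map_smul, smul_sub, smul_add]
  abel

/-- The energy identity: up to the forcing, the energy decays at the rate `c δ`. -/
theorem energy_deriv_le {l θ τ ε : ℝ} {w v w₂ w' v' G f f₁ : L2}
    (hv : IsVelocity H T α (δ ^ 3) ε w v w₂ w' v' G)
    (hH : (H : L2 →ₗ[ℂ] L2).IsSymmetric) (hT : HasComm H T) (hτT : ‖T‖ ≤ τ)
    (hF : ‖G‖ ≤ K * (‖f₁‖ + ‖f‖))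
    (hl : 0 < l) (hl1 : l ≤ 1 / 4) (hθ : 0 < θ) (hlτ : 32 * l * τ ^ 2 ≤ θ) (hδ : 0 < δ) (hδ1 : δ ≤ 1)
    (hα : 1 ≤ |α|) (hε : 0 < ε) (hε1 : 32 * (|α| * ε * τ) ≤ l ^ 3 * θ * δ)
    (hε2 : 16 * (|α| * ε * τ) ≤ θ * δ) (hε3 : 4 * (|α| * ε * τ) ≤ δ)
    (hP : θ / 2 * ‖w‖ ^ 2 ≤ (inner ℂ (T w) w).re) {c C₁ : ℝ} (hc : c = min (l ^ 3 * θ / 12) 1)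
    (hC₁ : C₁ = (8 / (l ^ 3 * θ) + 2) * (2 * K ^ 2)) :
    α ^ 2 * (2 * (inner ℂ w' w).re) + l ^ 4 * δ ^ 2 * (2 * (inner ℂ v' v).re) +
      l ^ 3 * δ * (2 * (α * (inner ℂ w' v).im)) ≤
      -(c * δ) * energy l δ α w v + C₁ * (δ ^ 5 * α ^ 2) * (‖f₁‖ ^ 2 + ‖f‖ ^ 2) := by
  have hτ : 0 ≤ τ := (norm_nonneg _).trans hτT
  have hν : 0 ≤ δ ^ 3 := by positivity
  have hc0 : 0 < c := by rw [hc]; exact lt_min (by positivity) one_pos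
  have h₁ := hv.re_inner_velocity_le hH hτT hν hε.le hF
  have h₂ := hv.re_inner_velocity_deriv_le hH hT hτT hν hε hF
  have h₃ := hv.im_inner_velocity_le hH hT hτT hν hε.le hF
  have hα2 : |α| ^ 2 = α ^ 2 := sq_abs α
  have key := energy_absorb (l := l) (θ := θ) (τ := τ) (δ := δ) (β := |α|) (ε := ε)
    (x := |α| * ‖w‖) (y := ‖v‖) (z := ‖w₂‖) (F := K * (‖f₁‖ + ‖f‖))
    (t₁ := α ^ 2 * (inner ℂ w' w).re) (t₂ := (inner ℂ v' v).re)
    (t₃ := α * (inner ℂ w' v).im)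
    (P := α ^ 2 * (inner ℂ (T w) w).re) hl hl1 hθ hlτ hτ hδ hδ1 hα hε.le hε1 hε2
    hε3 (by positivity) (norm_nonneg _) ?_ ?_ ?_ ?_
  · clear h₁ h₂ h₃ hv hP hH hT
    have hEt := abs_le.1 (abs_energy_sub_le (α := α) hl hl1 hδ w v)
    have f1 : (K * (‖f₁‖ + ‖f‖)) ^ 2 ≤ 2 * K ^ 2 * (‖f₁‖ ^ 2 + ‖f‖ ^ 2) := by
      rw [mul_pow]
      nlinarith only [mul_nonneg (sq_nonneg K) (sq_nonneg (‖f₁‖ - ‖f‖))]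
    have f2 : (8 / (l ^ 3 * θ) + 2) * δ ^ 5 * |α| ^ 2 * (K * (‖f₁‖ + ‖f‖)) ^ 2 ≤
        C₁ * (δ ^ 5 * α ^ 2) * (‖f₁‖ ^ 2 + ‖f‖ ^ 2) := by
      rw [hα2, hC₁]
      calc _ ≤ (8 / (l ^ 3 * θ) + 2) * δ ^ 5 * α ^ 2 *
            (2 * K ^ 2 * (‖f₁‖ ^ 2 + ‖f‖ ^ 2)) := by gcongr
        _ = _ := by ring
    have f3 : c * energy l δ α w v ≤ l ^ 3 * θ / 8 * (|α| * ‖w‖) ^ 2 + δ ^ 2 * ‖v‖ ^ 2 / 2 := by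
      have c1 : c ≤ l ^ 3 * θ / 12 := hc ▸ min_le_left _ _
      have c2 : c ≤ 1 := hc ▸ min_le_right _ _
      have c3 : c * l ^ 4 ≤ 1 * (1 / 4) ^ 4 := by gcongr
      have c4 : c * energy l δ α w v ≤
          c * (3 / 2 * (α ^ 2 * ‖w‖ ^ 2 + l ^ 4 * δ ^ 2 * ‖v‖ ^ 2)) := by
        gcongr
        linarith only [hEt.2]
      have c5 : c * (α ^ 2 * ‖w‖ ^ 2) ≤ l ^ 3 * θ / 12 * (α ^ 2 * ‖w‖ ^ 2) := by gcongr
      have c6 : c * l ^ 4 * (δ ^ 2 * ‖v‖ ^ 2) ≤ 1 * (1 / 4) ^ 4 * (δ ^ 2 * ‖v‖ ^ 2) := by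
        gcongr
      have c7 : 0 ≤ δ ^ 2 * ‖v‖ ^ 2 := by positivity
      rw [mul_pow, hα2]
      linarith only [c4, c5, c6, c7]
    have f4 := mul_le_mul_of_nonneg_left f3 hδ.le
    linarith only [key, f2, f4]
  · have := mul_le_mul_of_nonneg_left h₁ (sq_nonneg |α|)
    rw [← hα2]
    refine this.trans (le_of_eq ?_)
    rw [← hα2]; ring
  · rw [hα2]
    refine h₂.trans (le_of_eq ?_)
    ring
  · refine h₃.trans (le_of_eq ?_)
    rw [← hα2]; ring
  · rw [mul_pow, hα2]
    have := mul_le_mul_of_nonneg_left hP (sq_nonneg α)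
    linarith only [this]

theorem energy_le {l θ τ ε t : ℝ} (hH : (H : L2 →ₗ[ℂ] L2).IsSymmetric) (hT : HasComm H T)
    (hτT : ‖T‖ ≤ τ) (hA : HasComm A A₁) (hA₁ : HasComm A₁ A₂) (hAH : Commute A H)
    (hψ : IsForcedSolution H α (δ ^ 3) C ψ) (hC : 0 ≤ C)
    (hK : ∀ f f₁ r, ‖r‖ ≤ C * (‖f₁‖ + ‖f‖) → ‖A r - (2 : ℂ) • A₁ f₁ - A₂ f‖ ≤ K * (‖f₁‖ + ‖f‖))
    (hl : 0 < l) (hl1 : l ≤ 1 / 4) (hθ : 0 < θ) (hlτ : 32 * l * τ ^ 2 ≤ θ) (hδ : 0 < δ) (hδ1 : δ ≤ 1)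
    (hα : 1 ≤ |α|) (hε : 0 < ε) (hε1 : 32 * (|α| * ε * τ) ≤ l ^ 3 * θ * δ)
    (hε2 : 16 * (|α| * ε * τ) ≤ θ * δ) (hε3 : 4 * (|α| * ε * τ) ≤ δ)
    (hP : ∀ f, θ / 2 * ‖J ε (A f)‖ ^ 2 ≤ (inner ℂ (T (J ε (A f))) (J ε (A f))).re)
    {c C₁ M B : ℝ} (hc : c = min (l ^ 3 * θ / 12) 1) (hC₁ : C₁ = (8 / (l ^ 3 * θ) + 2) * (2 * K ^ 2))
    (hM : M = C ^ 2 + 2 * C) (hB : B = C₁ * (1 + M + c) / c) (ht : 0 ≤ t) :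
    energy l δ α (J ε (A (ψ t))) ((ε : ℂ)⁻¹ • (J ε (A (ψ t)) - A (ψ t))) ≤
      Real.exp (-(c * δ) * t) *
        energy l δ α (J ε (A (ψ 0))) ((ε : ℂ)⁻¹ • (J ε (A (ψ 0)) - A (ψ 0))) +
      (C₁ + B) * (δ ^ 2 * α ^ 2 * (Real.exp (M * δ ^ 3 * t) * ‖ψ 0‖ ^ 2)) := by
  choose! dψ ψ₁ ψ₂ r e1 e2 e3 e4 e5 using hψ.equation
  have hτ : 0 ≤ τ := (norm_nonneg _).trans hτT
  have hν : 0 ≤ δ ^ 3 := by positivity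
  have hM0 : 0 ≤ M := by rw [hM]; positivity
  have hc0 : 0 < c := by rw [hc]; exact lt_min (by positivity) one_pos
  have hC₁0 : 0 ≤ C₁ := by rw [hC₁]; positivity
  have hB0 : 0 ≤ B := by rw [hB]; positivity
  have hBc : B * c = C₁ * (1 + M + c) := by rw [hB]; field_simp
  set W : L2 →L[ℂ] L2 := J ε * A with hW
  set V : L2 →L[ℂ] L2 := (ε : ℂ)⁻¹ • (J ε * A - A) with hV
  set E : ℝ → ℝ := fun t => energy l δ α (W (ψ t)) (V (ψ t)) with hE
  set g : ℝ → ℝ := fun t => Real.exp (M * δ ^ 3 * t) * ‖ψ 0‖ ^ 2 with hg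
  have hdg : ∀ t, HasDerivAt g (M * δ ^ 3 * g t) t := fun t => by
    refine ((((hasDerivAt_id t).const_mul (M * δ ^ 3)).exp).mul_const (‖ψ 0‖ ^ 2)).congr_deriv ?_
    simp only [hg, id, mul_one]
    ring
  have hψg : ∀ t, 0 ≤ t → ‖ψ t‖ ^ 2 ≤ g t := fun t ht => by
    have := hψ.norm_sq_le hH hν ht
    rwa [← hM] at this
  -- a Lyapunov function: the energy, the `L²` norm to absorb the forcing, and its known growth
  set Y : ℝ → ℝ := fun t => E t + C₁ * (δ ^ 2 * α ^ 2) * ‖ψ t‖ ^ 2 - B * (δ ^ 2 * α ^ 2) * g t with hY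
  have hdE : ∀ t, 0 < t → ∃ E', HasDerivAt E E' t ∧
      E' ≤ -(c * δ) * E t + C₁ * (δ ^ 5 * α ^ 2) * (‖ψ₁ t‖ ^ 2 + ‖ψ t‖ ^ 2) := by
    intro t ht
    obtain ⟨w₂, hv⟩ := isVelocity_localized hε.ne' hT hA hA₁ hAH (e2 t ht) (e3 t ht) (e5 t ht)
    have hF : ‖J ε (A (r t) - (2 : ℂ) • A₁ (ψ₁ t) - A₂ (ψ t))‖ ≤ K * (‖ψ₁ t‖ + ‖ψ t‖) :=
      (norm_J_apply_le _ _).trans (hK _ _ _ (e4 t ht))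
    refine ⟨_, hasDerivAt_energy (hasDerivAt_clm W (e1 t ht)) (hasDerivAt_clm V (e1 t ht))
      hv.hasWeakDeriv hv.hasWeakDeriv_velocity, ?_⟩
    exact energy_deriv_le hv hH hT hτT hF hl hl1 hθ hlτ hδ hδ1 hα hε hε1 hε2 hε3 (hP _) hc hC₁
  choose! E' hE' hE'le using hdE
  have hdY : ∀ t, 0 < t → HasDerivAt Y (E' t + C₁ * (δ ^ 2 * α ^ 2) * (2 * (inner ℂ (dψ t) (ψ t)).re) -
      B * (δ ^ 2 * α ^ 2) * (M * δ ^ 3 * g t)) t := fun t ht =>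
    ((hE' t ht).add ((hasDerivAt_norm_sq (e1 t ht)).const_mul _)).sub ((hdg t).const_mul _)
  have hcY : ContinuousOn Y (Set.Ici 0) := by
    have cW : ContinuousOn (fun t => W (ψ t)) (Set.Ici 0) :=
      W.continuous.comp_continuousOn hψ.continuousOn
    have cV : ContinuousOn (fun t => V (ψ t)) (Set.Ici 0) :=
      V.continuous.comp_continuousOn hψ.continuousOn
    have cE : ContinuousOn E (Set.Ici 0) :=
      ((continuousOn_const.mul (cW.norm.pow 2)).add (continuousOn_const.mul (cV.norm.pow 2))).add
        (continuousOn_const.mul (continuousOn_const.mul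
          (Complex.continuous_im.comp_continuousOn (continuous_inner.comp_continuousOn (cW.prodMk cV)))))
    have cg : ContinuousOn g (Set.Ici 0) := fun t _ => (hdg t).continuousAt.continuousWithinAt
    exact (cE.add (continuousOn_const.mul (hψ.continuousOn.norm.pow 2))).sub
      (continuousOn_const.mul cg)
  have hY' : Y t ≤ Real.exp (-(c * δ) * t) * Y 0 := by
    refine le_exp_mul_of_deriv_le hcY hdY (fun t ht => ?_) ht
    have h1 := re_inner_dissipation_le hH hν (e2 t ht) (e3 t ht) (e4 t ht) (e5 t ht)
    rw [← hM] at h1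
    have h2 := mul_le_mul_of_nonneg_left h1 (show 0 ≤ C₁ * (δ ^ 2 * α ^ 2) by positivity)
    have h3 := hE'le t ht
    have h4 := hψg t ht.le
    have h0 : 0 ≤ g t := (sq_nonneg _).trans h4
    have h5 : C₁ * (δ ^ 3 * α ^ 2) * (1 + M + c) * ‖ψ t‖ ^ 2 ≤ B * c * (δ ^ 3 * α ^ 2) * g t := by
      rw [hBc]
      calc _ ≤ C₁ * (δ ^ 3 * α ^ 2) * (1 + M + c) * g t := by gcongr
        _ = _ := by ring
    have h6 : C₁ * (δ ^ 5 * α ^ 2) * (1 + M) * ‖ψ t‖ ^ 2 ≤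
        C₁ * (δ ^ 3 * α ^ 2) * (1 + M) * ‖ψ t‖ ^ 2 := by
      have : δ ^ 5 ≤ δ ^ 3 := pow_le_pow_of_le_one hδ.le hδ1 (by norm_num)
      gcongr
    have h7 : 0 ≤ B * (δ ^ 2 * α ^ 2) * (M * δ ^ 3 * g t) := by positivity
    simp only [hY]
    linarith only [h2, h3, h5, h6, h7]
  have hexp : Real.exp (-(c * δ) * t) ≤ Real.exp (M * δ ^ 3 * t) := by
    apply Real.exp_le_exp.2
    have : 0 ≤ M * δ ^ 3 * t := by positivity
    have : 0 ≤ c * δ * t := by positivity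
    linarith
  have hg0 : 0 ≤ g 0 := by positivity
  have hx := (Real.exp_pos (-(c * δ) * t)).le
  have i1 : Real.exp (-(c * δ) * t) * (C₁ * (δ ^ 2 * α ^ 2) * ‖ψ 0‖ ^ 2) ≤
      C₁ * (δ ^ 2 * α ^ 2) * g t := by
    calc _ ≤ Real.exp (M * δ ^ 3 * t) * (C₁ * (δ ^ 2 * α ^ 2) * ‖ψ 0‖ ^ 2) := by gcongr
      _ = _ := by simp only [hg]; ring
  have i2 : 0 ≤ Real.exp (-(c * δ) * t) * (B * (δ ^ 2 * α ^ 2) * g 0) := by positivity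
  have i3 : 0 ≤ C₁ * (δ ^ 2 * α ^ 2) * ‖ψ t‖ ^ 2 := by positivity
  change E t ≤ Real.exp (-(c * δ) * t) * E 0 + (C₁ + B) * (δ ^ 2 * α ^ 2 * g t)
  simp only [hY] at hY'
  linarith only [hY', i1, i2, i3]

end Localized

/-! ### From the mollified energy to the localized norm -/

/-- On functions `g(H) f` with `g` supported near `E`, mollified at scale `ε`, the operator `H` is
close to `E`. -/
theorem exists_localization {H : L2 →L[ℂ] L2} {κ τ : ℝ} (hH : IsSelfAdjoint H) (hκ : ‖H‖ ≤ κ)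
    (hτ : HasComm2 H τ) {g : ℝ → ℂ} (hg : Continuous g) {E η : ℝ} (hη : 0 < η)
    (hgE : ∀ x, g x ≠ 0 → |x - E| ≤ η / 2) :
    ∃ C : ℝ, ∀ ε : ℝ, 0 < ε → ∀ f, ‖H (J ε (cfc (fun z : ℂ => g z.re) H f)) -
      (E : ℂ) • J ε (cfc (fun z : ℂ => g z.re) H f)‖ ≤
        (η + ε * C) * ‖J ε (cfc (fun z : ℂ => g z.re) H f)‖ := by
  have hn : IsStarNormal H := hH.isStarNormal
  let χ : ContDiffBump E := ⟨η / 2, η, half_pos hη, half_lt_self hη⟩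
  have hχ : ContDiff ℝ ∞ fun x => (χ x : ℂ) := Complex.ofRealCLM.contDiff.comp χ.contDiff
  obtain ⟨C, -, hC⟩ := exists_hasComm2_cfc hχ
    (χ.hasCompactSupport.comp_left (g := fun x : ℝ => (x : ℂ)) rfl) κ τ
  obtain ⟨B, -, hB, -, hBC, -⟩ := hC H hH hκ hτ
  set A := cfc (fun z : ℂ => g z.re) H with hA
  set X := cfc (fun z : ℂ => (χ z.re : ℂ)) H with hX
  have cg : Continuous fun z : ℂ => g z.re := by fun_prop
  have cχ : Continuous fun z : ℂ => (χ z.re : ℂ) := by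
    have := χ.continuous; fun_prop
  have hXA : X * A = A := by
    rw [hX, hA, ← cfc_mul _ _ H cχ.continuousOn cg.continuousOn]
    refine cfc_congr fun z _ => ?_
    by_cases h0 : g z.re = 0
    · simp [h0]
    · have : χ z.re = 1 := by
        apply χ.one_of_mem_closedBall
        rw [Metric.mem_closedBall, Real.dist_eq]
        exact hgE _ h0
      simp [this]
  have hHX : ‖H * X - (E : ℂ) • X‖ ≤ η := by
    have e : H * X - (E : ℂ) • X = cfc (fun z : ℂ => (z - E) * (χ z.re : ℂ)) H := by
      rw [cfc_mul (fun z : ℂ => z - E) _ H (by fun_prop) cχ.continuousOn,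
        cfc_sub (fun z : ℂ => z) (fun _ => (E : ℂ)) H, cfc_id' ℂ H, cfc_const (E : ℂ) H, sub_mul,
        Algebra.algebraMap_eq_smul_one, smul_mul_assoc, one_mul]
    rw [e]
    refine norm_cfc_le hη.le fun z hz => ?_
    have hz' : z = (z.re : ℂ) := hH.mem_spectrum_eq_re hz
    rw [norm_mul, Complex.norm_real, Real.norm_eq_abs, abs_of_nonneg χ.nonneg]
    by_cases h0 : χ z.re = 0
    · rw [h0, mul_zero]; exact hη.le
    · have h1 : z.re ∈ Metric.ball E η := by
        rw [← show Function.support χ = Metric.ball E η from χ.support_eq]; exact h0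
      rw [Metric.mem_ball, Real.dist_eq] at h1
      have h2 : ‖z - E‖ = |z.re - E| := by
        rw [hz', ← Complex.ofReal_sub, Complex.norm_real, Real.norm_eq_abs, Complex.ofReal_re]
      rw [h2]
      calc _ ≤ η * 1 := mul_le_mul h1.le χ.le_one χ.nonneg hη.le
        _ = η := mul_one _
  refine ⟨(κ + |E|) * C, fun ε hε f => ?_⟩
  set w := J ε (A f) with hw
  have e1 : w = X w + (ε : ℂ) • J ε (B w) := by
    rw [hw, ← hB.J_apply hε.ne']
    exact congrArg (J ε) (congrArg (fun Y : L2 →L[ℂ] L2 => Y f) hXA).symm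
  set q := J ε (B w) with hq
  have e2 : H w - (E : ℂ) • w = (H * X - (E : ℂ) • X) w + (ε : ℂ) • (H q - (E : ℂ) • q) := by
    calc H w - (E : ℂ) • w = H (X w + (ε : ℂ) • q) - (E : ℂ) • (X w + (ε : ℂ) • q) := by rw [← e1]
      _ = (H (X w) - (E : ℂ) • X w) + (ε : ℂ) • (H q - (E : ℂ) • q) := by
        rw [map_add, map_smul, smul_add, smul_sub, smul_comm (E : ℂ) (ε : ℂ)]; abel
      _ = _ := rfl
  have hC0 : 0 ≤ C := (norm_nonneg _).trans hBC
  have e3 : ‖q‖ ≤ C * ‖w‖ := (norm_J_apply_le _ _).trans ((B.le_opNorm w).trans (by gcongr))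
  have e4 : ‖H q - (E : ℂ) • q‖ ≤ (κ + |E|) * ‖q‖ := by
    refine (norm_sub_le _ _).trans ?_
    rw [norm_smul, Complex.norm_real, Real.norm_eq_abs, add_mul]
    gcongr
    exact (H.le_opNorm q).trans (by gcongr)
  have hκ0 : 0 ≤ κ := (norm_nonneg _).trans hκ
  rw [e2]
  calc _ ≤ ‖(H * X - (E : ℂ) • X) w‖ + ‖(ε : ℂ) • (H q - (E : ℂ) • q)‖ := norm_add_le _ _
    _ ≤ η * ‖w‖ + ε * ((κ + |E|) * (C * ‖w‖)) := by
      rw [norm_smul, Complex.norm_real, Real.norm_eq_abs, abs_of_pos hε]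
      gcongr
      · exact ((H * X - (E : ℂ) • X).le_opNorm w).trans (by gcongr)
      · exact e4.trans (by gcongr)
    _ = _ := by ring

section Localized

variable {H T A A₁ A₂ : L2 →L[ℂ] L2} {α δ C K : ℝ} {ψ : ℝ → L2}

/-- The limit `ε → 0` of `energy_le`. -/
theorem norm_sq_localized_le {l θ τ t : ℝ} (hH : (H : L2 →ₗ[ℂ] L2).IsSymmetric) (hT : HasComm H T)
    (hτT : ‖T‖ ≤ τ) (hA : HasComm A A₁) (hA₁ : HasComm A₁ A₂) (hAH : Commute A H)
    (hψ : IsForcedSolution H α (δ ^ 3) C ψ) (hC : 0 ≤ C)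
    (hK : ∀ f f₁ r, ‖r‖ ≤ C * (‖f₁‖ + ‖f‖) → ‖A r - (2 : ℂ) • A₁ f₁ - A₂ f‖ ≤ K * (‖f₁‖ + ‖f‖))
    (hl : 0 < l) (hl1 : l ≤ 1 / 4) (hθ : 0 < θ) (hlτ : 32 * l * τ ^ 2 ≤ θ) (hδ : 0 < δ) (hδ1 : δ ≤ 1)
    (hα : 1 ≤ |α|) (hP : ∀ᶠ ε in 𝓝[>] 0, ∀ f,
      θ / 2 * ‖J ε (A f)‖ ^ 2 ≤ (inner ℂ (T (J ε (A f))) (J ε (A f))).re)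
    {c C₁ M B : ℝ} (hc : c = min (l ^ 3 * θ / 12) 1) (hC₁ : C₁ = (8 / (l ^ 3 * θ) + 2) * (2 * K ^ 2))
    (hM : M = C ^ 2 + 2 * C) (hB : B = C₁ * (1 + M + c) / c) (ht : 0 ≤ t) {φ₁ φ₀ : L2}
    (h₁ : HasWeakDeriv (A (ψ t)) φ₁) (h₀ : HasWeakDeriv (A (ψ 0)) φ₀) :
    α ^ 2 * ‖A (ψ t)‖ ^ 2 + l ^ 4 * δ ^ 2 * ‖φ₁‖ ^ 2 ≤
      3 * (Real.exp (-(c * δ) * t) * (α ^ 2 * ‖A (ψ 0)‖ ^ 2 + l ^ 4 * δ ^ 2 * ‖φ₀‖ ^ 2)) +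
      2 * (C₁ + B) * (δ ^ 2 * α ^ 2 * (Real.exp (M * δ ^ 3 * t) * ‖ψ 0‖ ^ 2)) := by
  have hsm : ∀ (k : ℝ) {r : ℝ}, 0 < r → ∀ᶠ ε in 𝓝[>] (0 : ℝ), k * (|α| * ε * τ) ≤ r := by
    intro k r hr
    have h1 : Tendsto (fun ε : ℝ => k * (|α| * ε * τ)) (𝓝[>] 0) (𝓝 0) :=
      ((by fun_prop : Continuous fun ε : ℝ => k * (|α| * ε * τ)).tendsto' 0 0 (by simp)).mono_left
        nhdsWithin_le_nhds
    exact h1.eventually_le_const hr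
  have hlim : Tendsto (fun ε => α ^ 2 * ‖J ε (A (ψ t))‖ ^ 2 + l ^ 4 * δ ^ 2 * ‖J ε φ₁‖ ^ 2)
      (𝓝[>] 0) (𝓝 (α ^ 2 * ‖A (ψ t)‖ ^ 2 + l ^ 4 * δ ^ 2 * ‖φ₁‖ ^ 2)) :=
    (((tendsto_J _).norm.pow 2).const_mul _).add (((tendsto_J _).norm.pow 2).const_mul _)
  refine le_of_tendsto hlim ?_
  filter_upwards [hP, hsm 32 (show 0 < l ^ 3 * θ * δ by positivity),
    hsm 16 (show 0 < θ * δ by positivity), hsm 4 hδ, self_mem_nhdsWithin] with ε k0 k1 k2 k3 hε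
  have hε : 0 < ε := hε
  have main := energy_le hH hT hτT hA hA₁ hAH hψ hC hK hl hl1 hθ hlτ hδ hδ1 hα hε k1 k2 k3 k0 hc hC₁
    hM hB ht
  rw [(hasWeakDeriv_J hε.ne' _).unique (h₁.J ε), (hasWeakDeriv_J hε.ne' _).unique (h₀.J ε)] at main
  have b1 := (abs_le.1 (abs_energy_sub_le (α := α) hl hl1 hδ (J ε (A (ψ t))) (J ε φ₁))).1
  have b2 := (abs_le.1 (abs_energy_sub_le (α := α) hl hl1 hδ (J ε (A (ψ 0))) (J ε φ₀))).2
  have n1 := norm_J_apply_le ε (A (ψ 0))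
  have n2 := norm_J_apply_le ε φ₀
  have n3 : α ^ 2 * ‖J ε (A (ψ 0))‖ ^ 2 + l ^ 4 * δ ^ 2 * ‖J ε φ₀‖ ^ 2 ≤
      α ^ 2 * ‖A (ψ 0)‖ ^ 2 + l ^ 4 * δ ^ 2 * ‖φ₀‖ ^ 2 := by gcongr
  have b3 : energy l δ α (J ε (A (ψ 0))) (J ε φ₀) ≤
      3 / 2 * (α ^ 2 * ‖A (ψ 0)‖ ^ 2 + l ^ 4 * δ ^ 2 * ‖φ₀‖ ^ 2) := by linarith only [b2, n3]
  have b4 := mul_le_mul_of_nonneg_left b3 (Real.exp_pos (-(c * δ) * t)).le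
  linarith only [main, b1, b4]

end Localized

/-- The norm `‖f‖ + |α| ‖f‖ + δ ‖∂_y f‖`. -/
def hypoNorm (δ α : ℝ) (f : L2) : ℝ := ‖f‖ + |α| * ‖f‖ + δ * ‖weakDeriv f‖

theorem le_of_sq_le_add {N k₁ k₂ u v : ℝ} (hu : 0 ≤ u) (hv : 0 ≤ v)
    (hk₁ : 0 ≤ k₁) (hk₂ : 0 ≤ k₂) (h : N ^ 2 ≤ k₁ * u ^ 2 + k₂ * v ^ 2) :
    N ≤ √(k₁ + k₂) * (u + v) := by
  refine le_of_sq_le_sq ?_ (by positivity)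
  rw [mul_pow, Real.sq_sqrt (by positivity)]
  have h1 : 0 ≤ k₁ * (2 * (u * v) + v ^ 2) := by positivity
  have h2 : 0 ≤ k₂ * (2 * (u * v) + u ^ 2) := by positivity
  linarith

theorem mul_exp_le {δ M s : ℝ} (hδ : 0 ≤ δ) (hδ1 : δ ≤ 1) (hM : 0 ≤ M) (hs : 0 ≤ s) :
    δ * Real.exp (M * s) ≤ Real.exp M * (δ + s ^ (1 / 2 : ℝ) * Real.exp (M * s)) := by
  have h0 : 0 ≤ s ^ (1 / 2 : ℝ) * Real.exp (M * s) := by positivity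
  rcases le_total s 1 with h | h
  · calc δ * Real.exp (M * s) ≤ δ * Real.exp M := by
          gcongr
          exact mul_le_of_le_one_right hM h
      _ = Real.exp M * (δ + 0) := by ring
      _ ≤ _ := by gcongr
  · have h2 : 1 ≤ s ^ (1 / 2 : ℝ) := Real.one_le_rpow h (by norm_num)
    calc δ * Real.exp (M * s) ≤ 1 * (0 + s ^ (1 / 2 : ℝ) * Real.exp (M * s)) := by
          rw [one_mul, zero_add]
          gcongr
          exact hδ1.trans h2
      _ ≤ _ := by
          gcongr
          exact Real.one_le_exp hM

/-- Decay of `g(H) ψ` for a function `g` supported near an energy `E` at which the Mourre estimate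
holds. The rate and the size of the support do not depend on `g`. -/
theorem exists_localized_decay (κ τ : ℝ) {θ M C : ℝ} (hθ : 0 < θ) (hM : 0 ≤ M) (hC : 0 ≤ C) :
    ∃ η c : ℝ, 0 < η ∧ 0 < c ∧ ∀ (E : ℝ) (g : ℝ → ℂ), ContDiff ℝ ∞ g →
      (∀ x, g x ≠ 0 → |x - E| ≤ η / 2) → ∃ C₀ : ℝ, 0 ≤ C₀ ∧ ∀ H : L2 →L[ℂ] L2, IsSelfAdjoint H →
        ‖H‖ ≤ κ → HasComm2 H τ → (∀ T, HasComm H T → ∀ f,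
          θ * ‖f‖ ^ 2 ≤ (inner ℂ (T f) f).re + M * ‖H f - (E : ℂ) • f‖ ^ 2) →
        ∀ (δ α : ℝ), 0 < δ → δ ≤ 1 → 1 ≤ |α| → ∀ ψ : ℝ → L2, IsForcedSolution H α (δ ^ 3) C ψ →
          MemH1 (ψ 0) → ∀ t : ℝ, 0 ≤ t →
            MemH1 (cfc (fun z : ℂ => g z.re) H (ψ t)) ∧
            hypoNorm δ α (cfc (fun z : ℂ => g z.re) H (ψ t)) ≤
              C₀ * (Real.exp (-c * δ * t) * hypoNorm δ α (cfc (fun z : ℂ => g z.re) H (ψ 0)) +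
                (δ + (δ ^ 3 * t) ^ (1 / 2 : ℝ) * Real.exp ((C ^ 2 + 2 * C) / 2 * (δ ^ 3 * t))) *
                  (|α| * ‖ψ 0‖)) := by
  set l := min (1 / 4) (θ / (32 * (τ ^ 2 + 1))) with hl
  have hl0 : 0 < l := lt_min (by norm_num) (by positivity)
  have hl1 : l ≤ 1 / 4 := min_le_left _ _
  have hlτ : 32 * l * τ ^ 2 ≤ θ := by
    have h1 : l * (32 * (τ ^ 2 + 1)) ≤ θ := (le_div_iff₀ (by positivity)).1 (min_le_right _ _)
    linarith
  set c := min (l ^ 3 * θ / 12) 1 with hc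
  have hc0 : 0 < c := lt_min (by positivity) one_pos
  set η := √(θ / (8 * (M + 1))) with hη
  have hη0 : 0 < η := Real.sqrt_pos.2 (by positivity)
  have hMη : M * η ^ 2 < θ / 2 := by
    rw [hη, Real.sq_sqrt (by positivity), mul_div_assoc', div_lt_div_iff₀ (by positivity) two_pos]
    nlinarith
  refine ⟨η, c / 2, hη0, half_pos hc0, fun E g hg hgE => ?_⟩
  have hgc : HasCompactSupport g := HasCompactSupport.intro
    (isCompact_closedBall E (η / 2)) fun x hx => by
      by_contra h0
      exact hx (by rw [Metric.mem_closedBall, Real.dist_eq]; exact hgE x h0)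
  obtain ⟨cA, hcA, hA⟩ := exists_hasComm2_cfc hg hgc κ τ
  obtain ⟨G, hG⟩ := hgc.exists_bound_of_continuous hg.continuous
  have hG0 : 0 ≤ G := (norm_nonneg _).trans (hG 0)
  set K := G * C + 2 * cA with hK
  set C₁ := (8 / (l ^ 3 * θ) + 2) * (2 * K ^ 2) with hC₁
  set L := C ^ 2 + 2 * C with hL
  set B := C₁ * (1 + L + c) / c with hB
  have hL0 : 0 ≤ L := by positivity
  have hC₁0 : 0 ≤ C₁ := by positivity
  have hB0 : 0 ≤ B := by positivity
  set k₁ := 8 / l ^ 4 * 3 with hk₁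
  set k₂ := 8 / l ^ 4 * (2 * (C₁ + B)) with hk₂
  refine ⟨√(k₁ + k₂) * Real.exp (L / 2), by positivity, ?_⟩
  intro H hH hHκ hHτ hmourre δ α hδ hδ1 hα ψ hψ hψ0 t ht
  obtain ⟨A₁, A₂, hA₁, hA₂, nA₁, nA₂⟩ := hA H hH hHκ hHτ
  have hHτ' := hHτ
  obtain ⟨T, -, hT, -, nT, -⟩ := hHτ
  have hsym : (H : L2 →ₗ[ℂ] L2).IsSymmetric := ContinuousLinearMap.isSelfAdjoint_iff_isSymmetric.1 hH
  have hn : IsStarNormal H := hH.isStarNormal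
  obtain ⟨C', hloc⟩ := exists_localization hH hHκ hHτ' hg.continuous hη0 hgE
  set A := cfc (fun z : ℂ => g z.re) H with hAdef
  have hAH : Commute A H := by
    have := cfc_commute_cfc (fun z : ℂ => g z.re) id H
    rwa [cfc_id ℂ H] at this
  have nA : ‖A‖ ≤ G := norm_cfc_le hG0 fun z _ => hG z.re
  -- the Mourre estimate for the mollified localized functions
  have hP : ∀ᶠ ε in 𝓝[>] (0 : ℝ), ∀ f,
      θ / 2 * ‖J ε (A f)‖ ^ 2 ≤ (inner ℂ (T (J ε (A f))) (J ε (A f))).re := by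
    have h1 : Tendsto (fun ε : ℝ => M * (η + ε * C') ^ 2) (𝓝[>] 0) (𝓝 (M * η ^ 2)) :=
      ((by fun_prop : Continuous fun ε : ℝ => M * (η + ε * C') ^ 2).tendsto' 0 _ (by simp)).mono_left
        nhdsWithin_le_nhds
    filter_upwards [h1.eventually_le_const hMη, self_mem_nhdsWithin] with ε h2 hε f
    have h3 := hmourre T hT (J ε (A f))
    have h4 : ‖H (J ε (A f)) - (E : ℂ) • J ε (A f)‖ ^ 2 ≤ ((η + ε * C') * ‖J ε (A f)‖) ^ 2 := by
      gcongr
      exact hloc ε hε f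
    have h5 : M * ‖H (J ε (A f)) - (E : ℂ) • J ε (A f)‖ ^ 2 ≤ θ / 2 * ‖J ε (A f)‖ ^ 2 := by
      calc _ ≤ M * ((η + ε * C') * ‖J ε (A f)‖) ^ 2 := by gcongr
        _ = M * (η + ε * C') ^ 2 * ‖J ε (A f)‖ ^ 2 := by ring
        _ ≤ _ := by gcongr
    linarith only [h3, h5]
  have hKbound : ∀ f f₁ r : L2, ‖r‖ ≤ C * (‖f₁‖ + ‖f‖) →
      ‖A r - (2 : ℂ) • A₁ f₁ - A₂ f‖ ≤ K * (‖f₁‖ + ‖f‖) := by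
    intro f f₁ r hr
    have b1 : ‖A r‖ ≤ G * (C * (‖f₁‖ + ‖f‖)) := (A.le_opNorm r).trans (by gcongr)
    have b2 : ‖A₁ f₁‖ ≤ cA * ‖f₁‖ := (A₁.le_opNorm f₁).trans (by gcongr)
    have b3 : ‖A₂ f‖ ≤ cA * ‖f‖ := (A₂.le_opNorm f).trans (by gcongr)
    have b4 : ‖(2 : ℂ) • A₁ f₁‖ = 2 * ‖A₁ f₁‖ := by rw [norm_smul]; simp
    have b5 := norm_sub_le (A r - (2 : ℂ) • A₁ f₁) (A₂ f)
    have b6 := norm_sub_le (A r) ((2 : ℂ) • A₁ f₁)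
    have b7 : 0 ≤ cA * ‖f‖ := by positivity
    rw [hK]
    linarith only [b1, b2, b3, b4, b5, b6, b7]
  have hmem : ∀ t, 0 ≤ t → MemH1 (A (ψ t)) := by
    intro t ht
    rcases ht.eq_or_lt with h0 | h0
    · rw [← h0]; exact hA₁.memH1 hψ0
    · obtain ⟨-, ψ₁, -, -, -, h1, -⟩ := hψ.equation t h0
      exact hA₁.memH1 ⟨ψ₁, h1⟩
  refine ⟨hmem t ht, ?_⟩
  obtain ⟨φ₁, h₁⟩ := hmem t ht
  obtain ⟨φ₀, h₀⟩ := hmem 0 le_rfl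
  have main := norm_sq_localized_le hsym hT nT hA₁ hA₂ hAH hψ hC hKbound hl0 hl1 hθ hlτ hδ hδ1 hα hP hc
    hC₁ hL hB ht h₁ h₀
  set N := hypoNorm δ α (A (ψ t)) with hN
  set N₀ := hypoNorm δ α (A (ψ 0)) with hN₀
  have eN : N = ‖A (ψ t)‖ + |α| * ‖A (ψ t)‖ + δ * ‖φ₁‖ := by rw [hN, hypoNorm, h₁.weakDeriv_eq]
  have eN₀ : N₀ = ‖A (ψ 0)‖ + |α| * ‖A (ψ 0)‖ + δ * ‖φ₀‖ := by
    rw [hN₀, hypoNorm, h₀.weakDeriv_eq]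
  have hl4 : l ^ 4 ≤ 1 := pow_le_one₀ hl0.le (by linarith only [hl1])
  have hα2 : |α| ^ 2 = α ^ 2 := sq_abs α
  have q1 : l ^ 4 * N ^ 2 ≤ 8 * (α ^ 2 * ‖A (ψ t)‖ ^ 2 + l ^ 4 * δ ^ 2 * ‖φ₁‖ ^ 2) := by
    have r1 : N ≤ 2 * (|α| * ‖A (ψ t)‖) + δ * ‖φ₁‖ := by
      have := mul_le_mul_of_nonneg_right hα (norm_nonneg (A (ψ t)))
      rw [eN]
      linarith only [this]
    have r0 : 0 ≤ N := by rw [eN]; positivity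
    have r2 : N ^ 2 ≤ 8 * (|α| * ‖A (ψ t)‖) ^ 2 + 2 * (δ * ‖φ₁‖) ^ 2 := by
      calc N ^ 2 ≤ (2 * (|α| * ‖A (ψ t)‖) + δ * ‖φ₁‖) ^ 2 := by gcongr
        _ ≤ _ := by nlinarith only [sq_nonneg (2 * (|α| * ‖A (ψ t)‖) - δ * ‖φ₁‖)]
    have r3 : l ^ 4 * (8 * (α ^ 2 * ‖A (ψ t)‖ ^ 2)) ≤ 1 * (8 * (α ^ 2 * ‖A (ψ t)‖ ^ 2)) := by gcongr
    have r4 := mul_le_mul_of_nonneg_left r2 (show 0 ≤ l ^ 4 by positivity)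
    have r5 : 0 ≤ l ^ 4 * δ ^ 2 * ‖φ₁‖ ^ 2 := by positivity
    rw [mul_pow, mul_pow, hα2] at r4
    linarith only [r3, r4, r5]
  have q2 : α ^ 2 * ‖A (ψ 0)‖ ^ 2 + l ^ 4 * δ ^ 2 * ‖φ₀‖ ^ 2 ≤ N₀ ^ 2 := by
    have r1 : l ^ 4 * (δ ^ 2 * ‖φ₀‖ ^ 2) ≤ 1 * (δ ^ 2 * ‖φ₀‖ ^ 2) := by gcongr
    have r2 : (|α| * ‖A (ψ 0)‖) ^ 2 + (δ * ‖φ₀‖) ^ 2 ≤ (|α| * ‖A (ψ 0)‖ + δ * ‖φ₀‖) ^ 2 := by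
      have : 0 ≤ (|α| * ‖A (ψ 0)‖) * (δ * ‖φ₀‖) := by positivity
      linarith only [this]
    have r3 : (|α| * ‖A (ψ 0)‖ + δ * ‖φ₀‖) ^ 2 ≤ N₀ ^ 2 := by
      gcongr
      rw [eN₀]
      linarith only [norm_nonneg (A (ψ 0))]
    rw [mul_pow, mul_pow, hα2] at r2
    linarith only [r1, r2, r3]
  set e := Real.exp (-(c / 2) * δ * t) with he
  have he2 : Real.exp (-(c * δ) * t) = e ^ 2 := by
    rw [he, ← Real.exp_nat_mul]; congr 1; push_cast; ring
  set e' := Real.exp (L / 2 * (δ ^ 3 * t)) with he'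
  have he2' : Real.exp (L * δ ^ 3 * t) = e' ^ 2 := by
    rw [he', ← Real.exp_nat_mul]; congr 1; push_cast; ring
  have q3 : N ^ 2 ≤ k₁ * (e * N₀) ^ 2 + k₂ * (δ * e' * (|α| * ‖ψ 0‖)) ^ 2 := by
    rw [he2, he2'] at main
    have r1 : e ^ 2 * (α ^ 2 * ‖A (ψ 0)‖ ^ 2 + l ^ 4 * δ ^ 2 * ‖φ₀‖ ^ 2) ≤ e ^ 2 * N₀ ^ 2 := by gcongr
    have r2 : l ^ 4 * N ^ 2 ≤ 8 * (3 * (e ^ 2 * N₀ ^ 2) +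
        2 * (C₁ + B) * (δ ^ 2 * α ^ 2 * (e' ^ 2 * ‖ψ 0‖ ^ 2))) := by
      linarith only [q1, main, r1]
    have r3 : N ^ 2 ≤ 8 * (3 * (e ^ 2 * N₀ ^ 2) +
        2 * (C₁ + B) * (δ ^ 2 * α ^ 2 * (e' ^ 2 * ‖ψ 0‖ ^ 2))) / l ^ 4 :=
      (le_div_iff₀' (by positivity)).2 r2
    refine r3.trans (le_of_eq ?_)
    rw [hk₁, hk₂, ← hα2]
    ring
  have hN₀0 : 0 ≤ N₀ := by rw [eN₀]; positivity
  have q4 := le_of_sq_le_add (by positivity) (by positivity) (by positivity) (by positivity) q3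
  have q5 : δ * e' ≤ Real.exp (L / 2) * (δ + (δ ^ 3 * t) ^ (1 / 2 : ℝ) * e') :=
    mul_exp_le hδ.le hδ1 (by positivity) (by positivity)
  have q6 : e * N₀ ≤ Real.exp (L / 2) * (e * N₀) :=
    le_mul_of_one_le_left (by positivity) (Real.one_le_exp (by positivity))
  calc N ≤ _ := q4
    _ ≤ √(k₁ + k₂) * (Real.exp (L / 2) * (e * N₀) +
        Real.exp (L / 2) * (δ + (δ ^ 3 * t) ^ (1 / 2 : ℝ) * e') * (|α| * ‖ψ 0‖)) := by gcongr
    _ = _ := by ring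

/-! ### A partition of the energy interval -/

/-- A smooth bump supported in `[0, 2]` whose integer translates add up to `1`. -/
def stepBump (u : ℝ) : ℝ := Real.smoothTransition u - Real.smoothTransition (u - 1)

theorem contDiff_stepBump : ContDiff ℝ ∞ stepBump :=
  Real.smoothTransition.contDiff.sub
    (Real.smoothTransition.contDiff.comp (contDiff_id.sub contDiff_const))

theorem stepBump_ne_zero {u : ℝ} (h : stepBump u ≠ 0) : 0 < u ∧ u < 2 := by
  constructor
  · by_contra! h0
    exact h (by simp [stepBump, Real.smoothTransition.zero_of_nonpos h0,
      Real.smoothTransition.zero_of_nonpos (show u - 1 ≤ 0 by linarith)])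
  · by_contra! h0
    exact h (by simp [stepBump, Real.smoothTransition.one_of_one_le (show 1 ≤ u by linarith),
      Real.smoothTransition.one_of_one_le (show 1 ≤ u - 1 by linarith)])

theorem abs_stepBump_le (u : ℝ) : |stepBump u| ≤ 1 := by
  rw [stepBump, abs_le]
  constructor <;> linarith [Real.smoothTransition.nonneg u, Real.smoothTransition.le_one u,
    Real.smoothTransition.nonneg (u - 1), Real.smoothTransition.le_one (u - 1)]

theorem sum_stepBump {u : ℝ} {N : ℕ} (h1 : 1 ≤ u) (h2 : u ≤ N + 1) :
    ∑ k ∈ Finset.range (N + 1), stepBump (u - k) = 1 := by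
  have h : ∀ k : ℕ, stepBump (u - k) = Real.smoothTransition (u - k) -
      Real.smoothTransition (u - (k + 1 : ℕ)) := fun k => by
    rw [stepBump]; congr 2; push_cast; ring
  simp only [h]
  rw [Finset.sum_range_sub' (fun k : ℕ => Real.smoothTransition (u - k)),
    Real.smoothTransition.one_of_one_le (by simpa using h1),
    Real.smoothTransition.zero_of_nonpos (by push_cast; linarith), sub_zero]

theorem hypoNorm_nonneg {δ : ℝ} (hδ : 0 ≤ δ) (α : ℝ) (f : L2) : 0 ≤ hypoNorm δ α f := by
  unfold hypoNorm; positivity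

theorem hypoNorm_sum_le {ι : Type*} {δ α : ℝ} (hδ : 0 ≤ δ) (s : Finset ι) (f : ι → L2)
    (hf : ∀ i ∈ s, MemH1 (f i)) : MemH1 (∑ i ∈ s, f i) ∧
      hypoNorm δ α (∑ i ∈ s, f i) ≤ ∑ i ∈ s, hypoNorm δ α (f i) := by
  classical
  induction s using Finset.induction_on with
  | empty =>
    refine ⟨⟨0, hasWeakDeriv_zero⟩, ?_⟩
    simp [hypoNorm, hasWeakDeriv_zero.weakDeriv_eq]
  | insert i s hi ih =>
    obtain ⟨⟨q, hq⟩, hle⟩ := ih fun j hj => hf j (Finset.mem_insert_of_mem hj)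
    obtain ⟨p, hp⟩ := hf i (Finset.mem_insert_self i s)
    rw [Finset.sum_insert hi, Finset.sum_insert hi]
    refine ⟨⟨_, hp.add hq⟩, le_trans ?_ (add_le_add_right hle _)⟩
    rw [hypoNorm, hypoNorm, hypoNorm, (hp.add hq).weakDeriv_eq, hp.weakDeriv_eq, hq.weakDeriv_eq]
    have h1 := norm_add_le (f i) (∑ j ∈ s, f j)
    have h2 := mul_le_mul_of_nonneg_left h1 (abs_nonneg α)
    have h3 := mul_le_mul_of_nonneg_left (norm_add_le p q) hδ
    linarith

theorem hypoNorm_apply_le {X Y : L2 →L[ℂ] L2} {c δ α : ℝ} (h : HasComm X Y) (hX : ‖X‖ ≤ 1)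
    (hY : ‖Y‖ ≤ c) (hδ : 0 ≤ δ) (hδ1 : δ ≤ 1) {f : L2} (hf : MemH1 f) :
    hypoNorm δ α (X f) ≤ (1 + c) * hypoNorm δ α f := by
  obtain ⟨f', hf⟩ := hf
  have hc : 0 ≤ c := (norm_nonneg _).trans hY
  have b : ∀ x, ‖X x‖ ≤ ‖x‖ := fun x =>
    (X.le_opNorm x).trans (mul_le_of_le_one_left (norm_nonneg _) hX)
  have b' : ‖Y f‖ ≤ c * ‖f‖ := (Y.le_opNorm f).trans (by gcongr)
  rw [hypoNorm, hypoNorm, (h _ _ hf).weakDeriv_eq, hf.weakDeriv_eq]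
  have h1 := b f
  have h2 := mul_le_mul_of_nonneg_left h1 (abs_nonneg α)
  have h3 : δ * ‖X f' + Y f‖ ≤ δ * (‖f'‖ + c * ‖f‖) := by
    gcongr
    exact norm_add_le_of_le (b f') b'
  have h4 : δ * (c * ‖f‖) ≤ 1 * (c * ‖f‖) := by gcongr
  have h5 : 0 ≤ c * (|α| * ‖f‖) := by positivity
  have h6 : 0 ≤ c * (δ * ‖f'‖) := by positivity
  linarith

theorem localNorm_eq (U m : ℝ → ℝ) (α : ℤ) (ν : ℝ) (g : ℝ → ℂ) (f : L2) :
    localNorm U m α ν g f = hypoNorm (ν ^ (1 / 3 : ℝ)) α (funcH U m α g f) := by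
  have : ‖(α : ℂ)‖ = |(α : ℝ)| := by
    rw [← Complex.ofReal_intCast, Complex.norm_real, Real.norm_eq_abs]
  rw [localNorm, hypoNorm, norm_smul, this]

theorem IsSolution.isForcedSolution {U m : ℝ → ℝ} {α : ℤ} {ν δ M C : ℝ} {ψ₀ : L2} {ψ : ℝ → L2}
    (h : IsSolution U m α ν ψ₀ ψ) (hδ : δ ^ 3 = ν) (hMC : M ≤ C)
    (hR : ∀ f f₁ r, HasWeakDeriv f f₁ → IsRemainder m α f r → ‖r‖ ≤ M * (‖f₁‖ + ‖f‖)) :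
    IsForcedSolution (H U m α) α (δ ^ 3) C ψ := by
  refine ⟨h.continuousOn, fun t ht => ?_⟩
  obtain ⟨dψ, ψ₂, r, h1, ⟨ψ₁, h2, h3⟩, h4, h5⟩ := h.equation t ht
  refine ⟨dψ, ψ₁, ψ₂, r, h1, h2, h3, (hR _ _ _ h2 h4).trans (by gcongr), ?_⟩
  rw [hδ, Complex.ofReal_intCast, ← h5, neg_smul]
  abel

/-- Decay of `g(H) ψ` in the abstract setting, for a function `g` supported in an interval on which
the Mourre estimate holds. -/
theorem exists_decay (κ τ : ℝ) {θ M C a b : ℝ} (hθ : 0 < θ) (hM : 0 ≤ M) (hC : 0 ≤ C) (hab : a < b) :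
    ∃ c : ℝ, 0 < c ∧ ∀ g : ℝ → ℂ, ContDiff ℝ ∞ g → tsupport g ⊆ Set.Icc a b →
      ∃ C₀ : ℝ, 0 ≤ C₀ ∧ ∀ H : L2 →L[ℂ] L2, IsSelfAdjoint H → ‖H‖ ≤ κ → HasComm2 H τ →
        (∀ E ∈ Set.Icc a b, ∀ T, HasComm H T → ∀ f,
          θ * ‖f‖ ^ 2 ≤ (inner ℂ (T f) f).re + M * ‖H f - (E : ℂ) • f‖ ^ 2) →
        ∀ (δ α : ℝ), 0 < δ → δ ≤ 1 → 1 ≤ |α| → ∀ ψ : ℝ → L2, IsForcedSolution H α (δ ^ 3) C ψ →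
          MemH1 (ψ 0) → ∀ t : ℝ, 0 ≤ t →
            MemH1 (cfc (fun z : ℂ => g z.re) H (ψ t)) ∧
            hypoNorm δ α (cfc (fun z : ℂ => g z.re) H (ψ t)) ≤
              C₀ * (Real.exp (-c * δ * t) * hypoNorm δ α (cfc (fun z : ℂ => g z.re) H (ψ 0)) +
                (δ + (δ ^ 3 * t) ^ (1 / 2 : ℝ) * Real.exp ((C ^ 2 + 2 * C) / 2 * (δ ^ 3 * t))) *
                  (|α| * ‖ψ 0‖)) := by
  obtain ⟨η, c, hη, hc, hdecay⟩ := exists_localized_decay κ τ hθ hM hC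
  obtain ⟨N, hN⟩ := exists_nat_gt ((b - a) / (η / 2))
  have hba : 0 < b - a := sub_pos.2 hab
  have hN0 : (0 : ℝ) < N := lt_of_le_of_lt (by positivity) hN
  set h := (b - a) / N with hh
  have hh0 : 0 < h := by positivity
  have hhη : h ≤ η / 2 := by
    rw [hh, div_le_iff₀ hN0]
    have := (div_lt_iff₀ (half_pos hη)).1 hN
    linarith
  set χ : ℕ → ℝ → ℝ := fun k x => stepBump ((x - a) / h + 1 - k) with hχ
  have hχs : ∀ k, ContDiff ℝ ∞ (χ k) := fun k => contDiff_stepBump.comp (by fun_prop)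
  have hχ1 : ∀ k x, |χ k x| ≤ 1 := fun k x => abs_stepBump_le _
  have hχE : ∀ k x, χ k x ≠ 0 → |x - (a + k * h)| ≤ h := fun k x hx => by
    obtain ⟨h1, h2⟩ := stepBump_ne_zero hx
    have e : x - (a + k * h) = h * ((x - a) / h + 1 - k - 1) := by field_simp; ring
    rw [e, abs_mul, abs_of_pos hh0]
    exact mul_le_of_le_one_right hh0.le (abs_le.2 ⟨by linarith, by linarith⟩)
  have hχC : ∀ k, ContDiff ℝ ∞ fun x => (χ k x : ℂ) := fun k => Complex.ofRealCLM.contDiff.comp (hχs k)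
  have hχc : ∀ k, HasCompactSupport fun x => (χ k x : ℂ) := fun k =>
    HasCompactSupport.intro (isCompact_closedBall (a + k * h) h) fun x hx => by
      by_contra h0
      refine hx ?_
      rw [Metric.mem_closedBall, Real.dist_eq]
      exact hχE k x fun h1 => h0 (by rw [h1]; rfl)
  refine ⟨c, hc, fun g hg hgab => ?_⟩
  have hgk : ∀ k, ContDiff ℝ ∞ fun x => (χ k x : ℂ) * g x := fun k => (hχC k).mul hg
  choose D hD0 hD using fun k : ℕ => hdecay (a + k * h) _ (hgk k) fun x hx =>
    (hχE k x fun h0 => hx (by simp [h0])).trans hhη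
  choose c' hc'0 hc' using fun k : ℕ => exists_hasComm2_cfc (hχC k) (hχc k) κ τ
  refine ⟨∑ k ∈ Finset.range (N + 1), D k * (1 + c' k),
    Finset.sum_nonneg fun k _ => mul_nonneg (hD0 k) (by linarith [hc'0 k]), ?_⟩
  intro H hH hHκ hHτ hmourre δ α hδ hδ1 hα ψ hψ hψ0 t ht
  have hn : IsStarNormal H := hH.isStarNormal
  have cg : Continuous fun z : ℂ => g z.re := by have := hg.continuous; fun_prop
  have cχ : ∀ k, Continuous fun z : ℂ => (χ k z.re : ℂ) := fun k => by
    have := (hχs k).continuous; fun_prop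
  have hgsum : ∀ x, ∑ k ∈ Finset.range (N + 1), (χ k x : ℂ) * g x = g x := by
    intro x
    by_cases h0 : g x = 0
    · simp [h0]
    · obtain ⟨h1, h2⟩ := hgab (subset_tsupport g h0)
      have h3 : (x - a) / h ≤ N := by
        rw [hh, div_div_eq_mul_div, div_le_iff₀ hba, mul_comm]
        gcongr
      have h4 : 0 ≤ (x - a) / h := div_nonneg (by linarith) hh0.le
      have h5 := sum_stepBump (u := (x - a) / h + 1) (N := N) (by linarith) (by linarith)
      rw [← Finset.sum_mul, ← Complex.ofReal_sum, h5, Complex.ofReal_one, one_mul]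
  set A := cfc (fun z : ℂ => g z.re) H with hA
  set Ak : ℕ → L2 →L[ℂ] L2 := fun k => cfc (fun z : ℂ => (χ k z.re : ℂ) * g z.re) H with hAk
  have hAsum : A = ∑ k ∈ Finset.range (N + 1), Ak k := by
    refine Eq.trans (cfc_congr fun z _ => ?_) (cfc_sum (fun (k : ℕ) (z : ℂ) => (χ k z.re : ℂ) * g z.re)
      H _ fun k _ => ((cχ k).mul cg).continuousOn)
    rw [Finset.sum_apply]
    exact (hgsum z.re).symm
  have hgc : HasCompactSupport g := HasCompactSupport.intro isCompact_Icc fun x hx => by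
    by_contra h0
    exact hx (hgab (subset_tsupport g h0))
  have hA0 : MemH1 (A (ψ 0)) := by
    obtain ⟨_, -, h1⟩ := exists_hasComm2_cfc hg hgc κ τ
    obtain ⟨_, -, h2, -⟩ := h1 H hH hHκ hHτ
    exact h2.memH1 hψ0
  set R := (δ + (δ ^ 3 * t) ^ (1 / 2 : ℝ) * Real.exp ((C ^ 2 + 2 * C) / 2 * (δ ^ 3 * t))) *
    (|α| * ‖ψ 0‖) with hR
  have hR0 : 0 ≤ R := by
    have : 0 ≤ δ ^ 3 * t := by positivity
    positivity
  have hk : ∀ k ∈ Finset.range (N + 1), MemH1 (Ak k (ψ t)) ∧ hypoNorm δ α (Ak k (ψ t)) ≤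
      D k * (1 + c' k) * (Real.exp (-c * δ * t) * hypoNorm δ α (A (ψ 0)) + R) := by
    intro k hkN
    have hE : a + k * h ∈ Set.Icc a b := by
      have h1 : (k : ℝ) ≤ N := by exact_mod_cast Nat.lt_succ_iff.1 (Finset.mem_range.1 hkN)
      have h2 : (k : ℝ) * h ≤ N * h := by gcongr
      have h3 : (N : ℝ) * h = b - a := by rw [hh]; field_simp
      exact ⟨by linarith [mul_nonneg k.cast_nonneg hh0.le], by linarith⟩
    obtain ⟨h1, h2⟩ := hD k H hH hHκ hHτ (hmourre _ hE) δ α hδ hδ1 hα ψ hψ hψ0 t ht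
    refine ⟨h1, h2.trans ?_⟩
    obtain ⟨Y, -, hY, -, nY, -⟩ := hc' k H hH hHκ hHτ
    have nX : ‖cfc (fun z : ℂ => (χ k z.re : ℂ)) H‖ ≤ 1 := norm_cfc_le zero_le_one fun z _ => by
      rw [Complex.norm_real]; exact hχ1 k _
    have h3 := hypoNorm_apply_le (α := α) hY nX nY hδ.le hδ1 hA0
    have h4 : cfc (fun z : ℂ => (χ k z.re : ℂ)) H (A (ψ 0)) = Ak k (ψ 0) := by
      rw [hAk]
      simp only
      rw [cfc_mul _ _ H (cχ k).continuousOn cg.continuousOn]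
      rfl
    rw [h4] at h3
    have hc0 := hc'0 k
    have h5 : R ≤ (1 + c' k) * R := le_mul_of_one_le_left hR0 (by linarith)
    have h6 := hD0 k
    calc _ ≤ D k * (Real.exp (-c * δ * t) * ((1 + c' k) * hypoNorm δ α (A (ψ 0))) +
          (1 + c' k) * R) := by
            gcongr
      _ = _ := by ring
  have e : ∀ s, A (ψ s) = ∑ k ∈ Finset.range (N + 1), Ak k (ψ s) := fun s => by
    rw [hAsum, sum_apply]
  obtain ⟨f1, f2⟩ := hypoNorm_sum_le (α := α) hδ.le (Finset.range (N + 1)) (fun k => Ak k (ψ t))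
    fun k hkN => (hk k hkN).1
  rw [← e] at f1 f2
  refine ⟨f1, f2.trans ?_⟩
  rw [Finset.sum_mul]
  exact Finset.sum_le_sum fun k hkN => (hk k hkN).2

end

end ShearFlow

theorem theorem3 (U m : ℝ → ℝ) (Um Up : ℝ)
    (hU : IsMixingLayer U m Um Up) (hm : HasDecay U m Um Up) (hS : IsSpectrallyStable m)
    (a b : ℝ) (ha : Um < a) (hab : a ≤ b) (hb : b < Up) :
    ∃ M₀ c₀ : ℝ, 0 < M₀ ∧ 0 < c₀ ∧
      ∀ g : ℝ → ℂ, ContDiff ℝ ∞ g → tsupport g ⊆ Set.Icc a b →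
        ∃ C₀ : ℝ, 0 < C₀ ∧
          ∀ (ν : ℝ), 0 < ν → ν ≤ 1 → ∀ (α : ℤ), α ≠ 0 →
            ∀ (ψ₀ : L2), MemH1 ψ₀ → ∀ (ψ : ℝ → L2), IsSolution U m α ν ψ₀ ψ →
              ∀ t : ℝ, 0 ≤ t →
                MemH1 (funcH U m α g (ψ t)) ∧
                localNorm U m α ν g (ψ t) ≤
                  C₀ * (Real.exp (-c₀ * ν ^ (1 / 3 : ℝ) * t) * localNorm U m α ν g (ψ 0) +
                    (ν ^ (1 / 3 : ℝ) + (ν * t) ^ (1 / 2 : ℝ) * Real.exp (M₀ * ν * t)) *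
                      (‖ψ₀‖ + ‖(α : ℂ) • ψ₀‖)) := by
  obtain ⟨κ, hF⟩ := exists_flow hU hm
  obtain ⟨C, hs⟩ := hF.exists_sqrtBounds hS
  obtain ⟨τ, hτ⟩ := hF.exists_hasComm2_H C
  obtain ⟨M, hM, hR⟩ := hF.exists_remainder_le hs
  obtain ⟨b', hbb', hb'⟩ := exists_between hb
  obtain ⟨y₁, hy₁⟩ := (hU.tendsto_atBot.eventually_lt_const ha).exists
  obtain ⟨y₂, hy₂⟩ := (hU.tendsto_atTop.eventually_const_lt hb').exists
  obtain ⟨θ, L, hθ, hL, hmourre⟩ := hF.exists_mourre hs hy₁ hy₂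
  obtain ⟨c, hc, hdecay⟩ := exists_decay κ τ hθ hL (show 0 ≤ max M 1 by positivity)
    (show a < b' by linarith)
  have hM1 : 0 < max M 1 := lt_max_of_lt_right one_pos
  refine ⟨(max M 1 ^ 2 + 2 * max M 1) / 2, c, by positivity, hc, fun g hg hgab => ?_⟩
  obtain ⟨C₀, hC₀, hest⟩ := hdecay g hg (hgab.trans (Set.Icc_subset_Icc_right hbb'.le))
  refine ⟨C₀ + 1, by positivity, fun ν hν hν1 α hα ψ₀ hψ₀ ψ hψ t ht => ?_⟩
  have hδ0 : 0 < ν ^ (1 / 3 : ℝ) := Real.rpow_pos_of_pos hν _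
  have hδ1 : ν ^ (1 / 3 : ℝ) ≤ 1 := Real.rpow_le_one hν.le hν1 (by norm_num)
  have hδ3 : (ν ^ (1 / 3 : ℝ)) ^ 3 = ν := by
    rw [← Real.rpow_natCast, ← Real.rpow_mul hν.le]; norm_num
  have hα1 : (1 : ℝ) ≤ |(α : ℝ)| := by exact_mod_cast Int.one_le_abs hα
  have hsa : IsSelfAdjoint (H U m α) :=
    ContinuousLinearMap.isSelfAdjoint_iff_isSymmetric.2 ((hs α hα).H_isSymmetric U)
  have hψf := hψ.isForcedSolution hδ3 (le_max_left M 1) (hR α hα)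
  obtain ⟨h1, h2⟩ := hest (H U m α) hsa (hF.norm_H_le (hs α hα)) (hτ α (hs α hα))
    (hmourre α hα) _ α hδ0 hδ1 hα1 ψ hψf (by rw [hψ.initial]; exact hψ₀) t ht
  refine ⟨h1, ?_⟩
  rw [localNorm_eq, localNorm_eq]
  refine h2.trans ?_
  rw [hδ3, hψ.initial, mul_assoc _ ν t]
  have hn : ‖(α : ℂ) • ψ₀‖ = |(α : ℝ)| * ‖ψ₀‖ := by
    rw [norm_smul, ← Complex.ofReal_intCast, Complex.norm_real, Real.norm_eq_abs]
  have hνt : 0 ≤ ν * t := by positivity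
  have hN0 := hypoNorm_nonneg hδ0.le α (funcH U m α g ψ₀)
  change C₀ * (_ * hypoNorm _ _ (funcH U m α g ψ₀) + _) ≤ _
  rw [hn]
  gcongr
  · linarith
  · linarith [norm_nonneg ψ₀]
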